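/- **Proposition.** Let $H$ be a $C^*$-quantum groupoid: a finite-dimensional complex unital algebra and coalgebra $(H,m,1,\Delta,\varepsilon)$ with an algebra and coalgebra anti-homomorphism $S$ (the antipode) and an antilinear involutive algebra anti-homomorphism $*$, such that $\Delta$ is multiplicative, $(\Delta\otimes\mathrm{id})\Delta(1)=(\Delta(1)\otimes1)(1\otimes\Delta(1))=(1\otimes\Delta(1))(\Delta(1)\otimes1)$, $\varepsilon(fgh)=\varepsilon(fg_{(1)})\varepsilon(g_{(2)}h)=\varepsilon(fg_{(2)})\varepsilon(g_{(1)}h)$, $\varepsilon_t(h):=h_{(1)}S(h_{(2)})=(\varepsilon\otimes\mathrm{id})(\Delta(1)(h\otimes1))$, $\varepsilon_s(h):=S(h_{(1)})h_{(2)}=(\mathrm{id}\otimes\varepsilon)((1\otimes h)\Delta(1))$, $\Delta(h^*)=\Delta(h)^{*\otimes *}$, and $x^*x=0$ if and only if $x=0$. Let $\widehat H=\mathrm{Hom}(H,\mathbb C)$ carry the dual structure maps ($\langle h,\phi\psi\rangle=\langle\Delta(h),\phi\otimes\psi\rangle$, $\langle g\otimes h,\widehat\Delta(\phi)\rangle=\langle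 gh,\phi\rangle$, unit $\varepsilon$, counit $\phi\mapsto\langle 1,\phi\rangle$, $\langle h,S(\phi)\rangle=\langle S(h),\phi\rangle$) and the involution $\langle\phi^*,h\rangle=\overline{\langle\phi,S(h)^*\rangle}$. Products of elements of $\widehat H$ below are taken in $\widehat H$. The Drinfeld double is $D(H)=(\widehat H\otimes H)/J$, where $J$ is the span of all $\phi\otimes zh-\langle z,\varepsilon_{(1)}\rangle\varepsilon_{(2)}\phi\otimes h$ with $z\in\varepsilon_t(H)$ and all $\phi\otimes yh-\langle y,\varepsilon_{(2)}\rangle\varepsilon_{(1)}\phi\otimes h$ with $y\in\varepsilon_s(H)$; $[x]$ denotes the class of $x$. Then $S$ is bijective, and: 1. The formulas $$[\phi\otimes h][\psi\otimes g]=[\psi_{(2)}\phi\otimes h_{(2)}g]\,\langle S(h_{(1)}),\psi_{(1)}\rangle\langle h_{(3)},\psi_{(3)}\rangle,\qquad 1=[\varepsilon\otimes1],$$ $$\Delta([\phi\otimes h])=[\phi_{(1)}\otimes h_{(1)}]\otimes[\phi_{(2)}\otimes h_{(2)}],\qquad \varepsilon([\phi\otimes h])=\langle\varepsilon_t(h),\phi\rangle,$$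 $$S([\phi\otimes h])=[S^{-1}(\phi_{(2)})\otimes S(h_{(2)})]\,\langle h_{(1)},\phi_{(1)}\rangle\langle S(h_{(3)}),\phi_{(3)}\rangle$$ are well defined on $D(H)$, and with them and a suitable involution (the one determined by 3) $D(H)$ is a $C^*$-quantum groupoid. 2. $D(H)$ is quasitriangular: with dual bases $f_i$, $\xi^i$ of $H$, $\widehat H$, the element $\mathcal R=\sum_i[\xi^i\otimes1]\otimes[\varepsilon\otimes f_i]$ lies in $\Delta^{op}(1)(D(H)\otimes D(H))\Delta(1)$ and satisfies $\Delta^{op}(x)\mathcal R=\mathcal R\Delta(x)$ for all $x$, $(\mathrm{id}\otimes\Delta)\mathcal R=\mathcal R_{13}\mathcal R_{12}$ and $(\Delta\otimes\mathrm{id})\mathcal R=\mathcal R_{13}\mathcal R_{23}$; the element $\bar{\mathcal R}=\sum_i[S^{-1}(\xi^i)\otimes1]\otimes[\varepsilon\otimes f_i]$ lies in $\Delta(1)(D(H)\otimes D(H))\Delta^{op}(1)$ and satisfies $\mathcal R\bar{\mathcal R}=\Delta^{op}(1)$, $\bar{\mathcal R}\mathcal R=\Delta(1)$; and $\mathcal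 R^*=\bar{\mathcal R}$. 3. The dual $\widehat{D(H)}$, with the dual structure maps and the natural involution $\langle X^*,[\phi\otimes h]\rangle=\overline{\langle X,[(S\phi)^*\otimes S(h)^*]\rangle}$ (which is the involution dual to that of $D(H)$), is a $C^*$-quantum groupoid. The algebra $H\otimes\widehat H$ with $(g\otimes\psi)^*=g^*\otimes\psi^*$ is a finite-dimensional $C^*$-algebra, and the pairing $\langle g\otimes\psi,\phi\otimes h\rangle=\langle g,\phi\rangle\langle h,\psi\rangle$ identifies $\widehat{D(H)}$ with the annihilator of $J$ in $H\otimes\widehat H$, compatibly with products and involutions; so $\widehat{D(H)}$ is a $C^*$-subalgebra of $H\otimes\widehat H$ (its unit need not be that of $H\otimes\widehat H$). -/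

import Mathlib

open scoped TensorProduct

/-- The structure maps `(m, 1, Δ, ε, S)` of a quantum groupoid on a complex vector space
`H`. No laws are imposed here: they are the predicate `QGData.IsQuantumGroupoid` below. Keeping
the maps explicit allows one space (a dual space, a quotient) to receive exactly the prescribed
structure maps. -/
structure QGData (H : Type*) [AddCommGroup H] [Module ℂ H] where
  /-- multiplication `m`, as a bilinear map -/
  mul : H →ₗ[ℂ] H →ₗ[ℂ] H
  /-- unit `1` -/
  one : H
  /-- comultiplication `Δ` -/
  comul : H →ₗ[ℂ] H ⊗[ℂ] H
  /-- counit `ε` -/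
  counit : H →ₗ[ℂ] ℂ
  /-- antipode `S` -/
  antipode : H →ₗ[ℂ] H

namespace QGData

noncomputable section General

variable {H : Type*} [AddCommGroup H] [Module ℂ H]

/-- The product of the algebra `H ⊗ H`. -/
def mulTwo (A : QGData H) : H ⊗[ℂ] H →ₗ[ℂ] H ⊗[ℂ] H →ₗ[ℂ] H ⊗[ℂ] H :=
  TensorProduct.map₂ A.mul A.mul

/-- The product of the algebra `H ⊗ (H ⊗ H)`. -/
def mulThree (A : QGData H) :
    H ⊗[ℂ] (H ⊗[ℂ] H) →ₗ[ℂ] H ⊗[ℂ] (H ⊗[ℂ] H) →ₗ[ℂ] H ⊗[ℂ] (H ⊗[ℂ] H) :=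
  TensorProduct.map₂ A.mul A.mulTwo

/-- `h ↦ h₁ ⊗ (h₂ ⊗ h₃)`, i.e. `(id ⊗ Δ) Δ`. -/
def comulThree (A : QGData H) : H →ₗ[ℂ] H ⊗[ℂ] (H ⊗[ℂ] H) :=
  TensorProduct.map LinearMap.id A.comul ∘ₗ A.comul

/-- The opposite comultiplication `Δᵒᵖ : h ↦ h₂ ⊗ h₁`. -/
def comulOp (A : QGData H) : H →ₗ[ℂ] H ⊗[ℂ] H :=
  (TensorProduct.comm ℂ H H).toLinearMap ∘ₗ A.comul

/-- The target counital map `ε_t = m (id ⊗ S) Δ`. -/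
def epsT (A : QGData H) : H →ₗ[ℂ] H :=
  TensorProduct.lift A.mul ∘ₗ TensorProduct.map LinearMap.id A.antipode ∘ₗ A.comul

/-- The source counital map `ε_s = m (S ⊗ id) Δ`. -/
def epsS (A : QGData H) : H →ₗ[ℂ] H :=
  TensorProduct.lift A.mul ∘ₗ TensorProduct.map A.antipode LinearMap.id ∘ₗ A.comul

/-- The target counital subalgebra `H_t = ε_t(H)`. -/
def targetSub (A : QGData H) : Submodule ℂ H := LinearMap.range A.epsT

/-- The source counital subalgebra `H_s = ε_s(H)`. -/
def sourceSub (A : QGData H) : Submodule ℂ H := LinearMap.range A.epsS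

/-- `H` with the structure maps `A` is a (finite) quantum groupoid, i.e. a finite-dimensional weak
Hopf algebra. -/
structure IsQuantumGroupoid (A : QGData H) : Prop where
  finite : FiniteDimensional ℂ H
  mul_assoc : ∀ f g h : H, A.mul (A.mul f g) h = A.mul f (A.mul g h)
  one_mul : ∀ h : H, A.mul A.one h = h
  mul_one : ∀ h : H, A.mul h A.one = h
  /-- coassociativity -/
  coassoc : ∀ h : H,
    TensorProduct.assoc ℂ H H H (TensorProduct.map A.comul LinearMap.id (A.comul h)) =
      TensorProduct.map LinearMap.id A.comul (A.comul h)
  counit_left : ∀ h : H,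
    TensorProduct.lid ℂ H (TensorProduct.map A.counit LinearMap.id (A.comul h)) = h
  counit_right : ∀ h : H,
    TensorProduct.rid ℂ H (TensorProduct.map LinearMap.id A.counit (A.comul h)) = h
  /-- `Δ` is multiplicative (not necessarily unital) -/
  comul_mul : ∀ g h : H, A.comul (A.mul g h) = A.mulTwo (A.comul g) (A.comul h)
  /-- `(Δ ⊗ id) Δ(1) = (Δ(1) ⊗ 1) (1 ⊗ Δ(1))` -/
  comul_one_left :
    TensorProduct.assoc ℂ H H H (TensorProduct.map A.comul LinearMap.id (A.comul A.one)) =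
      A.mulThree (TensorProduct.assoc ℂ H H H (A.comul A.one ⊗ₜ[ℂ] A.one))
        (A.one ⊗ₜ[ℂ] A.comul A.one)
  /-- `(Δ ⊗ id) Δ(1) = (1 ⊗ Δ(1)) (Δ(1) ⊗ 1)` -/
  comul_one_right :
    TensorProduct.assoc ℂ H H H (TensorProduct.map A.comul LinearMap.id (A.comul A.one)) =
      A.mulThree (A.one ⊗ₜ[ℂ] A.comul A.one)
        (TensorProduct.assoc ℂ H H H (A.comul A.one ⊗ₜ[ℂ] A.one))
  /-- `ε(fgh) = ε(f g₁) ε(g₂ h)` -/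
  counit_mul_left : ∀ f g h : H,
    A.counit (A.mul (A.mul f g) h) =
      TensorProduct.lid ℂ ℂ (TensorProduct.map (A.counit ∘ₗ A.mul f) (A.counit ∘ₗ A.mul.flip h)
        (A.comul g))
  /-- `ε(fgh) = ε(f g₂) ε(g₁ h)` -/
  counit_mul_right : ∀ f g h : H,
    A.counit (A.mul (A.mul f g) h) =
      TensorProduct.lid ℂ ℂ (TensorProduct.map (A.counit ∘ₗ A.mul f) (A.counit ∘ₗ A.mul.flip h)
        (A.comulOp g))
  /-- `S` is an algebra anti-homomorphism -/
  antipode_mul : ∀ g h : H, A.antipode (A.mul g h) = A.mul (A.antipode h) (A.antipode g)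
  antipode_one : A.antipode A.one = A.one
  /-- `S` is a coalgebra anti-homomorphism -/
  comul_antipode : ∀ h : H,
    A.comul (A.antipode h) = TensorProduct.map A.antipode A.antipode (A.comulOp h)
  counit_antipode : ∀ h : H, A.counit (A.antipode h) = A.counit h
  /-- `m (id ⊗ S) Δ(h) = (ε ⊗ id) (Δ(1) (h ⊗ 1))` -/
  antipode_target : ∀ h : H,
    TensorProduct.lift A.mul (TensorProduct.map LinearMap.id A.antipode (A.comul h)) =
      TensorProduct.lid ℂ H (TensorProduct.map A.counit LinearMap.id
        (A.mulTwo (A.comul A.one) (h ⊗ₜ[ℂ] A.one)))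
  /-- `m (S ⊗ id) Δ(h) = (id ⊗ ε) ((1 ⊗ h) Δ(1))` -/
  antipode_source : ∀ h : H,
    TensorProduct.lift A.mul (TensorProduct.map A.antipode LinearMap.id (A.comul h)) =
      TensorProduct.rid ℂ H (TensorProduct.map LinearMap.id A.counit
        (A.mulTwo (A.one ⊗ₜ[ℂ] h) (A.comul A.one)))

/-- `Rbar ∈ Δ(1) (H ⊗ H) Δᵒᵖ(1)` with `R Rbar = Δᵒᵖ(1)` and `Rbar R = Δ(1)`. -/
structure IsRMatrixInverse (A : QGData H) (R Rbar : H ⊗[ℂ] H) : Prop where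
  mem : ∃ X : H ⊗[ℂ] H, Rbar = A.mulTwo (A.mulTwo (A.comul A.one) X) (A.comulOp A.one)
  mul_inv : A.mulTwo R Rbar = A.comulOp A.one
  inv_mul : A.mulTwo Rbar R = A.comul A.one

/-- `(H, R)` is quasitriangular (for a quantum groupoid `H`). -/
structure IsQuasitriangular (A : QGData H) (R : H ⊗[ℂ] H) : Prop where
  /-- `R ∈ Δᵒᵖ(1) (H ⊗ H) Δ(1)` -/
  mem : ∃ X : H ⊗[ℂ] H, R = A.mulTwo (A.mulTwo (A.comulOp A.one) X) (A.comul A.one)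
  /-- `Δᵒᵖ(h) R = R Δ(h)` -/
  intertwines : ∀ h : H, A.mulTwo (A.comulOp h) R = A.mulTwo R (A.comul h)
  /-- `(id ⊗ Δ) R = R₁₃ R₁₂` -/
  id_comul :
    TensorProduct.map LinearMap.id A.comul R =
      A.mulThree (TensorProduct.map LinearMap.id (TensorProduct.mk ℂ H H A.one) R)
        (TensorProduct.assoc ℂ H H H (R ⊗ₜ[ℂ] A.one))
  /-- `(Δ ⊗ id) R = R₁₃ R₂₃` -/
  comul_id :
    TensorProduct.assoc ℂ H H H (TensorProduct.map A.comul LinearMap.id R) =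
      A.mulThree (TensorProduct.map LinearMap.id (TensorProduct.mk ℂ H H A.one) R)
        (A.one ⊗ₜ[ℂ] R)
  exists_inverse : ∃ Rbar : H ⊗[ℂ] H, A.IsRMatrixInverse R Rbar

/-- The inverse `S⁻¹` of the antipode (`Ring.inverse` is the two-sided inverse whenever one
exists, and `0` otherwise). -/
def antipodeInv (A : QGData H) : H →ₗ[ℂ] H :=
  Ring.inverse (M₀ := Module.End ℂ H) A.antipode

/-- `B` is pulled down to `D` by the linear map `q`: each structure map of `D` on classes is given
by the corresponding map of `B` on representatives. -/
structure Descends {V : Type*} [AddCommGroup V] [Module ℂ V]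
    (B : QGData H) (q : H →ₗ[ℂ] V) (D : QGData V) : Prop where
  mul : ∀ x y : H, D.mul (q x) (q y) = q (B.mul x y)
  one : D.one = q B.one
  comul : ∀ x : H, D.comul (q x) = TensorProduct.map q q (B.comul x)
  counit : ∀ x : H, D.counit (q x) = B.counit x
  antipode : ∀ x : H, D.antipode (q x) = q (B.antipode x)

variable [FiniteDimensional ℂ H]

/-- The dual structure maps on `Ĥ = Hom(H, ℂ)`: `⟨h, φψ⟩ = ⟨Δ h, φ ⊗ ψ⟩`, unit `ε`,
`⟨g ⊗ h, Δ̂ φ⟩ = ⟨gh, φ⟩`, counit `φ ↦ ⟨φ, 1⟩`, `⟨h, Ŝ φ⟩ = ⟨S h, φ⟩`. -/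
def dual (A : QGData H) : QGData (Module.Dual ℂ H) where
  mul := (TensorProduct.mk ℂ (Module.Dual ℂ H) (Module.Dual ℂ H)).compr₂
    (A.comul.dualMap ∘ₗ TensorProduct.dualDistrib ℂ H H)
  one := A.counit
  comul := (TensorProduct.dualDistribEquiv ℂ H H).symm.toLinearMap ∘ₗ
    (TensorProduct.lift A.mul).dualMap
  counit := Module.Dual.eval ℂ H A.one
  antipode := A.antipode.dualMap

/-- `h ⇀ φ = φ₁ ⟨h, φ₂⟩`. -/
def arrowL (A : QGData H) (h : H) (φ : Module.Dual ℂ H) : Module.Dual ℂ H :=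
  TensorProduct.rid ℂ _
    (TensorProduct.map LinearMap.id (Module.Dual.eval ℂ H h) (A.dual.comul φ))

/-- `φ ↼ h = ⟨h, φ₁⟩ φ₂`. -/
def arrowR (A : QGData H) (φ : Module.Dual ℂ H) (h : H) : Module.Dual ℂ H :=
  TensorProduct.lid ℂ _
    (TensorProduct.map (Module.Dual.eval ℂ H h) LinearMap.id (A.dual.comul φ))

/-- For bilinear forms `b, c` on `H × Ĥ`, the map
`h ⊗ ψ ↦ b(h₁, ψ₁) c(h₃, ψ₃) • (h₂ ⊗ ψ₂)` on `H ⊗ Ĥ`. -/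
def sandwich (A : QGData H) (b c : H →ₗ[ℂ] Module.Dual ℂ H →ₗ[ℂ] ℂ) :
    H ⊗[ℂ] Module.Dual ℂ H →ₗ[ℂ] H ⊗[ℂ] Module.Dual ℂ H :=
  (TensorProduct.lid ℂ _ ≪≫ₗ TensorProduct.rid ℂ _).toLinearMap ∘ₗ
    TensorProduct.lift
      ((TensorProduct.map₂ b
        (TensorProduct.map₂ (TensorProduct.mk ℂ H (Module.Dual ℂ H)) c)).compl₁₂
          A.comulThree A.dual.comulThree)

/-- The structure maps on `Ĥᵒᵖ ⊗ H` from which those of the Drinfeld double are induced. Products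
of functionals are written in `Ĥ`, so the product of `Ĥᵒᵖ` is the flipped one:
* `(φ ⊗ h)(ψ ⊗ g) = ψ₂ φ ⊗ h₂ g ⟨S h₁, ψ₁⟩ ⟨h₃, ψ₃⟩`, unit `ε ⊗ 1`;
* `Δ(φ ⊗ h) = (φ₁ ⊗ h₁) ⊗ (φ₂ ⊗ h₂)`, `ε(φ ⊗ h) = ⟨ε_t(h), φ⟩`;
* `S(φ ⊗ h) = Ŝ⁻¹(φ₂) ⊗ S(h₂) ⟨h₁, φ₁⟩ ⟨S h₃, φ₃⟩`. -/
def preDouble (A : QGData H) : QGData (Module.Dual ℂ H ⊗[ℂ] H) where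
  mul := TensorProduct.curry
    (TensorProduct.lift (TensorProduct.map₂ A.dual.mul.flip A.mul) ∘ₗ
      (TensorProduct.tensorTensorTensorAssoc ℂ (Module.Dual ℂ H) H
        (Module.Dual ℂ H) H).symm.toLinearMap ∘ₗ
      TensorProduct.map
        (TensorProduct.map LinearMap.id
          (A.sandwich (Module.Dual.eval ℂ H ∘ₗ A.antipode) (Module.Dual.eval ℂ H)))
        LinearMap.id ∘ₗ
      (TensorProduct.tensorTensorTensorAssoc ℂ (Module.Dual ℂ H) H
        (Module.Dual ℂ H) H).toLinearMap)
  one := A.counit ⊗ₜ[ℂ] A.one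
  comul := (TensorProduct.tensorTensorTensorComm ℂ (Module.Dual ℂ H) (Module.Dual ℂ H)
      H H).toLinearMap ∘ₗ TensorProduct.map A.dual.comul A.comul
  counit := contractLeft ℂ H ∘ₗ TensorProduct.map LinearMap.id A.epsT
  antipode := TensorProduct.map A.dual.antipodeInv A.antipode ∘ₗ
    (TensorProduct.comm ℂ H (Module.Dual ℂ H)).toLinearMap ∘ₗ
    A.sandwich (Module.Dual.eval ℂ H) (Module.Dual.eval ℂ H ∘ₗ A.antipode) ∘ₗ
    (TensorProduct.comm ℂ (Module.Dual ℂ H) H).toLinearMap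

/-- The span `J` of the elements `φ ⊗ zh - (ε ↼ z)φ ⊗ h` (`z ∈ H_t`) and
`φ ⊗ yh - (y ⇀ ε)φ ⊗ h` (`y ∈ H_s`). -/
def doubleIdeal (A : QGData H) : Submodule ℂ (Module.Dual ℂ H ⊗[ℂ] H) :=
  Submodule.span ℂ
    ({x | ∃ z ∈ A.targetSub, ∃ (φ : Module.Dual ℂ H) (h : H),
        x = φ ⊗ₜ[ℂ] A.mul z h - A.dual.mul (A.arrowR A.counit z) φ ⊗ₜ[ℂ] h} ∪
     {x | ∃ y ∈ A.sourceSub, ∃ (φ : Module.Dual ℂ H) (h : H),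
        x = φ ⊗ₜ[ℂ] A.mul y h - A.dual.mul (A.arrowL y A.counit) φ ⊗ₜ[ℂ] h})

/-- The underlying space `(Ĥᵒᵖ ⊗ H) / J` of the Drinfeld double `D(H)`. -/
abbrev DrinfeldDouble (A : QGData H) : Type _ :=
  (Module.Dual ℂ H ⊗[ℂ] H) ⧸ A.doubleIdeal

/-- The class `[x]` in `D(H)` of `x ∈ Ĥᵒᵖ ⊗ H`. -/
def toDouble (A : QGData H) : Module.Dual ℂ H ⊗[ℂ] H →ₗ[ℂ] A.DrinfeldDouble :=
  A.doubleIdeal.mkQ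

/-- `R = ∑ᵢ [ξⁱ ⊗ 1] ⊗ [ε ⊗ fᵢ]` for dual bases `f`, `ξ` of `H`, `Ĥ`. -/
def doubleR (A : QGData H) : A.DrinfeldDouble ⊗[ℂ] A.DrinfeldDouble :=
  ∑ i, A.toDouble ((Module.finBasis ℂ H).coord i ⊗ₜ[ℂ] A.one) ⊗ₜ[ℂ]
    A.toDouble (A.counit ⊗ₜ[ℂ] Module.finBasis ℂ H i)

/-- `∑ᵢ [Ŝ⁻¹(ξⁱ) ⊗ 1] ⊗ [ε ⊗ fᵢ]` for dual bases `f`, `ξ` of `H`, `Ĥ`. -/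
def doubleRbar (A : QGData H) : A.DrinfeldDouble ⊗[ℂ] A.DrinfeldDouble :=
  ∑ i, A.toDouble (A.dual.antipodeInv ((Module.finBasis ℂ H).coord i) ⊗ₜ[ℂ] A.one) ⊗ₜ[ℂ]
    A.toDouble (A.counit ⊗ₜ[ℂ] Module.finBasis ℂ H i)

/-- The element `∑ hₖ ⊗ φₖ` of `H ⊗ Ĥ` as a functional on `Ĥ ⊗ H`:
`⟨h ⊗ φ, ψ ⊗ g⟩ = ⟨h, ψ⟩ ⟨g, φ⟩`. -/
def pairing (H : Type*) [AddCommGroup H] [Module ℂ H] :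
    H ⊗[ℂ] Module.Dual ℂ H →ₗ[ℂ] Module.Dual ℂ (Module.Dual ℂ H ⊗[ℂ] H) :=
  TensorProduct.dualDistrib ℂ (Module.Dual ℂ H) H ∘ₗ
    TensorProduct.map (Module.Dual.eval ℂ H) LinearMap.id

end General

noncomputable section CStar

/-- A finite-dimensional complex unital algebra `V` with product `mul` and antilinear map `st` is
a `C*`-algebra: `st` is an involutive anti-homomorphism and `x* x = 0` if and only if `x = 0`. -/
structure IsFinDimCStarAlgebra {V : Type*} [AddCommGroup V] [Module ℂ V]
    (mul : V →ₗ[ℂ] V →ₗ[ℂ] V) (one : V) (st : V →ₛₗ[starRingEnd ℂ] V) : Prop where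
  finite : FiniteDimensional ℂ V
  mul_assoc : ∀ x y z : V, mul (mul x y) z = mul x (mul y z)
  one_mul : ∀ x : V, mul one x = x
  mul_one : ∀ x : V, mul x one = x
  star_star : ∀ x : V, st (st x) = x
  star_mul : ∀ x y : V, st (mul x y) = mul (st y) (st x)
  star_mul_self_eq_zero_iff : ∀ x : V, mul (st x) x = 0 ↔ x = 0

variable {H : Type*} [AddCommGroup H] [Module ℂ H]

/-- `H` with the structure maps `A` and the involution `st` is a `C*`-quantum groupoid. -/
structure IsCStarQuantumGroupoid (A : QGData H) (st : H →ₛₗ[starRingEnd ℂ] H) : Prop where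
  isQuantumGroupoid : A.IsQuantumGroupoid
  isCStarAlgebra : IsFinDimCStarAlgebra A.mul A.one st
  /-- `Δ ∘ * = (* ⊗ *) ∘ Δ` -/
  comul_star : ∀ h : H, A.comul (st h) = TensorProduct.map st st (A.comul h)

/-- The involution of the dual: `⟨φ*, h⟩` is the complex conjugate of `⟨φ, S(h)*⟩`. -/
def dualStar (A : QGData H) (st : H →ₛₗ[starRingEnd ℂ] H) :
    Module.Dual ℂ H →ₛₗ[starRingEnd ℂ] Module.Dual ℂ H where
  toFun φ :=
    { toFun := fun h => starRingEnd ℂ (φ (st (A.antipode h)))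
      map_add' := fun g h => by simp
      map_smul' := fun c h => by simp }
  map_add' φ ψ := by ext h; simp
  map_smul' c φ := by ext h; simp

end CStar

end QGData

/-!
# The Drinfeld double of a `C*`-quantum groupoid

Computations take place in Sweedler's notation: `sw (Δ h) f` is the sum `f h₁ h₂`.

**Antipode.** Applying the involution to the axiom for `ε_t` shows that `h ↦ S(h*)*` behaves like an
inverse antipode, and it is one (`antipode_star_antipode_star`).

**The double.** On `Ĥᵒᵖ ⊗ H` the product is associative and respects `J` on both sides, because
pairing with the outer legs of a functional `ψ` only replaces it by the translate `ψ(S(h₁) · h₃)`,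
and products with the functionals `ε ↼ z` and `y ⇀ ε` are translates as well. Modulo `J`, every
class is a product `[φ ⊗ h] = κ(φ) ι(h)` with `ι(h) = [ε ⊗ h]` and `κ(φ) = [φ ⊗ 1]`, and all
structure maps are determined by their values on these products together with the exchange
relation `ι(h) κ(ψ) = κ(ψ(S(h₁) · h₃)) ι(h₂)`. These laws are collected in `IsDouble`, and the
axioms of a quantum groupoid are derived from them (`IsDouble.isQuantumGroupoid`). For the counit
of a triple product, the outer factors may be replaced by elements of the counital subalgebras
(`exists_source`, `exists_target`).

**The `R`-matrix.** It is the image under `κ ⊗ ι` of the canonical element of `Ĥ ⊗ H`. An element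
of `Ĥ ⊗ W` is a linear map from `H` to `W`, so each identity is checked by evaluating the first
leg. The coproducts of the legs are given by the products of `Ĥ` and `H`, and the intertwining
property is the exchange relation.

**Positivity.** In a finite-dimensional `C*`-algebra the left multiplication by a self-adjoint
element has real eigenvalues, so the regular trace `τ` satisfies `τ(x* x) > 0` for `x ≠ 0`. It
follows that tensor products of `C*`-algebras are `C*`-algebras. It also provides the Haar
projection `p`, the component of `1` orthogonal to `ker ε_t`. Pairing `φ* φ` with `p` then shows
that the dual of a `C*`-quantum groupoid is one (`dual_isCStar`).

The involution `κ(φ) ι(h) ↦ ι(h*) κ(φ♯)` makes the double a quantum groupoid with involution. Its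
dual embeds into `H ⊗ Ĥ` as the annihilator of `J`, compatibly with products and involutions, and
inherits properness from there. The double is the dual of its dual, so `dual_isCStar` applies once
more and the double is a `C*`-quantum groupoid too (`IsStarQuantumGroupoid.isCStar_of_dual`).
-/

namespace QGData

set_option linter.unusedSectionVars false

/-! ### Sweedler sums -/

/-- Linearity of an unbundled map, as a predicate that `fun_prop` can prove. -/
@[fun_prop]
structure Lin {V W : Type*} [AddCommMonoid V] [Module ℂ V] [AddCommMonoid W] [Module ℂ W]
    (f : V → W) : Prop where
  add : ∀ x y, f (x + y) = f x + f y
  smul : ∀ (c : ℂ) x, f (c • x) = c • f x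

noncomputable section Sweedler

variable {U V W X Y Z : Type*} [AddCommMonoid U] [Module ℂ U] [AddCommMonoid V] [Module ℂ V]
  [AddCommMonoid W] [Module ℂ W] [AddCommMonoid X] [Module ℂ X] [AddCommMonoid Y] [Module ℂ Y]
  [AddCommMonoid Z] [Module ℂ Z]

namespace Lin

@[fun_prop]
theorem id : Lin (fun x : V => x) := ⟨fun _ _ => rfl, fun _ _ => rfl⟩

@[fun_prop]
theorem comp {f : V → W} {g : U → V} (hf : Lin f) (hg : Lin g) : Lin (fun x => f (g x)) :=
  ⟨fun x y => by rw [hg.add, hf.add], fun c x => by rw [hg.smul, hf.smul]⟩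

@[fun_prop]
theorem map (L : V →ₗ[ℂ] W) : Lin (fun x => L x) := ⟨L.map_add, L.map_smul⟩

@[fun_prop]
theorem equiv (L : V ≃ₗ[ℂ] W) : Lin (fun x => L x) := ⟨L.map_add, L.map_smul⟩

@[fun_prop]
theorem apply (f : X → (V →ₗ[ℂ] W)) (hf : Lin f) (y : V) : Lin (fun x => (f x) y) :=
  ⟨fun x y => by simp [hf.add], fun c x => by simp [hf.smul]⟩

@[fun_prop]
theorem linearMap_comp {f : X → (V →ₗ[ℂ] W)} (hf : Lin f) (L : U →ₗ[ℂ] V) :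
    Lin (fun x => f x ∘ₗ L) :=
  ⟨fun x y => by rw [hf.add, LinearMap.add_comp], fun c x => by rw [hf.smul, LinearMap.smul_comp]⟩

@[fun_prop]
theorem tmul_left {f : X → V} (hf : Lin f) (w : W) : Lin (fun x => f x ⊗ₜ[ℂ] w) :=
  ⟨fun x y => by rw [hf.add, TensorProduct.add_tmul],
    fun c x => by rw [hf.smul, TensorProduct.smul_tmul']⟩

@[fun_prop]
theorem tmul_right {f : X → W} (hf : Lin f) (v : V) : Lin (fun x => v ⊗ₜ[ℂ] f x) :=
  ⟨fun x y => by rw [hf.add, TensorProduct.tmul_add],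
    fun c x => by rw [hf.smul, TensorProduct.tmul_smul]⟩

@[fun_prop]
theorem smul_left {f : X → ℂ} (hf : Lin f) (w : W) : Lin (fun x => f x • w) :=
  ⟨fun x y => by rw [hf.add, add_smul], fun c x => by rw [hf.smul, smul_assoc]⟩

@[fun_prop]
theorem smul_right {f : X → W} (hf : Lin f) (c : ℂ) : Lin (fun x => c • f x) :=
  ⟨fun x y => by rw [hf.add, smul_add], fun d x => by rw [hf.smul, smul_comm]⟩

@[fun_prop]
theorem mul_left {f : X → ℂ} (hf : Lin f) (w : ℂ) : Lin (fun x => f x * w) :=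
  ⟨fun x y => by rw [hf.add, add_mul], fun c x => by rw [hf.smul, smul_mul_assoc]⟩

@[fun_prop]
theorem mul_right {f : X → ℂ} (hf : Lin f) (c : ℂ) : Lin (fun x => c * f x) :=
  ⟨fun x y => by rw [hf.add, mul_add], fun d x => by rw [hf.smul, mul_smul_comm]⟩

/-- The bundled form of an unbundled linear map. -/
def toMap {f : V → W} (hf : Lin f) : V →ₗ[ℂ] W where
  toFun := f
  map_add' := hf.add
  map_smul' := hf.smul

end Lin

/-- `sw t f` is `∑ f aᵢ bᵢ` for a chosen decomposition `t = ∑ aᵢ ⊗ bᵢ`. For bilinear `f` it does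
not depend on the decomposition; `sw (Δ h) f` is `f h₁ h₂` in Sweedler's notation. -/
def sw (t : V ⊗[ℂ] W) (f : V → W → U) : U :=
  ∑ p ∈ (TensorProduct.exists_finset t).choose, f p.1 p.2

theorem lift_eq_sw (t : V ⊗[ℂ] W) (f : V →ₗ[ℂ] W →ₗ[ℂ] U) :
    TensorProduct.lift f t = sw t (fun a b => f a b) := by
  conv_lhs => rw [(TensorProduct.exists_finset t).choose_spec]
  simp [sw]

/-- For bilinear `f` the sum is the value at `t` of the induced linear map, hence independent of the
decomposition. -/
theorem sw_eq_lift (t : V ⊗[ℂ] W) {f : V → W → U} (hl : ∀ b, Lin fun a => f a b)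
    (hr : ∀ a, Lin fun b => f a b) :
    sw t f = TensorProduct.lift (LinearMap.mk₂ ℂ f (fun _ _ b => (hl b).add _ _)
      (fun _ _ b => (hl b).smul _ _) (fun a _ _ => (hr a).add _ _)
      (fun _ a _ => (hr a).smul _ _)) t := by
  rw [lift_eq_sw]; rfl

@[fun_prop]
theorem Lin.sw_left {f : V → W → U} (hl : ∀ b, Lin fun a => f a b) (hr : ∀ a, Lin fun b => f a b)
    {g : X → V ⊗[ℂ] W} (hg : Lin g) : Lin (fun x => sw (g x) f) := by
  simp only [sw_eq_lift _ hl hr]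
  fun_prop

@[fun_prop]
theorem Lin.sw_right {f : X → V → W → U} (t : V ⊗[ℂ] W) (hf : ∀ a b, Lin fun x => f x a b) :
    Lin (fun x => sw t (f x)) :=
  ⟨fun x y => by simp [sw, (hf _ _).add, Finset.sum_add_distrib],
    fun c x => by simp [sw, (hf _ _).smul, Finset.smul_sum]⟩

/-! Sums move out of every linear operation. -/

theorem map_sw (L : U →ₗ[ℂ] X) (t : V ⊗[ℂ] W) (f : V → W → U) :
    L (sw t f) = sw t fun a b => L (f a b) := map_sum _ _ _

theorem equiv_sw (L : U ≃ₗ[ℂ] X) (t : V ⊗[ℂ] W) (f : V → W → U) :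
    L (sw t f) = sw t fun a b => L (f a b) := map_sum _ _ _

theorem Lin.map_sw {g : U → X} (hg : Lin g) (t : V ⊗[ℂ] W) (f : V → W → U) :
    g (sw t f) = sw t fun a b => g (f a b) := QGData.map_sw hg.toMap t f

theorem sw_of_smul (c : ℂ) (t : V ⊗[ℂ] W) (f : V → W → U)
    (hl : ∀ b, Lin fun a => f a b) (hr : ∀ a, Lin fun b => f a b) :
    sw (c • t) f = c • sw t f := by simp [sw_eq_lift _ hl hr]

theorem sw_apply (t : V ⊗[ℂ] W) (f : V → W → (X →ₗ[ℂ] Y)) (x : X) :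
    (sw t f) x = sw t fun a b => f a b x := by simp [sw]

theorem tmul_sw (x : X) (t : V ⊗[ℂ] W) (f : V → W → U) :
    x ⊗ₜ[ℂ] sw t f = sw t fun a b => x ⊗ₜ[ℂ] f a b := by simp [sw, TensorProduct.tmul_sum]

theorem sw_tmul (x : X) (t : V ⊗[ℂ] W) (f : V → W → U) :
    sw t f ⊗ₜ[ℂ] x = sw t fun a b => f a b ⊗ₜ[ℂ] x := by simp [sw, TensorProduct.sum_tmul]

theorem smul_sw (c : ℂ) (t : V ⊗[ℂ] W) (f : V → W → U) :
    c • sw t f = sw t fun a b => c • f a b := by simp [sw, Finset.smul_sum]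

theorem sw_smul (x : X) (t : V ⊗[ℂ] W) (f : V → W → ℂ) :
    sw t f • x = sw t fun a b => f a b • x := by simp [sw, Finset.sum_smul]

theorem mul_sw (c : ℂ) (t : V ⊗[ℂ] W) (f : V → W → ℂ) :
    c * sw t f = sw t fun a b => c * f a b := by simp [sw, Finset.mul_sum]

theorem sw_mul (c : ℂ) (t : V ⊗[ℂ] W) (f : V → W → ℂ) :
    sw t f * c = sw t fun a b => f a b * c := by simp [sw, Finset.sum_mul]

theorem sw_sw_comm (t : V ⊗[ℂ] W) (s : X ⊗[ℂ] Y) (f : V → W → X → Y → U) :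
    (sw t fun a b => sw s fun c d => f a b c d) = sw s fun c d => sw t fun a b => f a b c d :=
  Finset.sum_comm

theorem sw_sw_sw_comm (t : V ⊗[ℂ] W) (s : X ⊗[ℂ] Y) {V' W' : Type*} [AddCommMonoid V']
    [Module ℂ V'] [AddCommMonoid W'] [Module ℂ W'] (t' : V' ⊗[ℂ] W')
    (f : V → W → X → Y → V' → W' → U) :
    (sw t fun a b => sw s fun c d => sw t' fun a' b' => f a b c d a' b') =
      sw t' fun a' b' => sw t fun a b => sw s fun c d => f a b c d a' b' := by
  simp only [sw_sw_comm s t', sw_sw_comm t t']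

theorem sw_sw_comm_sw_sw (t : V ⊗[ℂ] W) (s : X ⊗[ℂ] Y) {V' W' X' Y' : Type*} [AddCommMonoid V']
    [Module ℂ V'] [AddCommMonoid W'] [Module ℂ W'] [AddCommMonoid X'] [Module ℂ X']
    [AddCommMonoid Y'] [Module ℂ Y'] (t' : V' ⊗[ℂ] W') (s' : X' ⊗[ℂ] Y')
    (f : V → W → X → Y → V' → W' → X' → Y' → U) :
    (sw t fun a b => sw s fun c d => sw t' fun a' b' => sw s' fun c' d' => f a b c d a' b' c' d') =
      sw t' fun a' b' => sw s' fun c' d' => sw t fun a b => sw s fun c d =>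
        f a b c d a' b' c' d' := by
  simp only [sw_sw_comm s t', sw_sw_comm t t', sw_sw_comm s s', sw_sw_comm t s']

theorem sw_congr {t : V ⊗[ℂ] W} {f g : V → W → U} (h : ∀ a b, f a b = g a b) :
    sw t f = sw t g := by
  simp only [h, sw]

theorem sw_of_tmul (a : V) (b : W) (f : V → W → U) (hl : ∀ b, Lin fun a => f a b)
    (hr : ∀ a, Lin fun b => f a b) : sw (a ⊗ₜ[ℂ] b) f = f a b := by
  rw [sw_eq_lift _ hl hr]; rfl

theorem sw_self (t : V ⊗[ℂ] W) : (sw t fun a b => a ⊗ₜ[ℂ] b) = t :=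
  (TensorProduct.exists_finset t).choose_spec.symm

theorem map_eq_sw (u : V →ₗ[ℂ] X) (v : W →ₗ[ℂ] Y) (t : V ⊗[ℂ] W) :
    TensorProduct.map u v t = sw t fun a b => u a ⊗ₜ[ℂ] v b := by
  conv_lhs => rw [← sw_self t, map_sw]
  rfl

theorem sw_of_sw (t : V ⊗[ℂ] W) (g : V → W → X ⊗[ℂ] Y) (f : X → Y → U)
    (hl : ∀ b, Lin fun a => f a b) (hr : ∀ a, Lin fun b => f a b) :
    sw (sw t g) f = sw t fun a b => sw (g a b) f := by
  simp only [sw_eq_lift _ hl hr]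
  rw [map_sw]

/-- Reassociation of a threefold sum. -/
theorem sw_of_assoc (t : (V ⊗[ℂ] W) ⊗[ℂ] X) (f : V → W → X → U)
    (h1 : ∀ b c, Lin fun a => f a b c) (h2 : ∀ a c, Lin fun b => f a b c)
    (h3 : ∀ a b, Lin fun c => f a b c) :
    (sw (TensorProduct.assoc ℂ V W X t) fun a s => sw s fun b c => f a b c) =
      sw t fun s c => sw s fun a b => f a b c := by
  conv_lhs => rw [← sw_self t, equiv_sw, sw_of_sw _ _ _ (by fun_prop) (by fun_prop)]
  refine sw_congr fun s c => ?_
  conv_lhs => rw [← sw_self s, sw_tmul, equiv_sw, sw_of_sw _ _ _ (by fun_prop) (by fun_prop)]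
  simp (disch := fun_prop) only [TensorProduct.assoc_tmul, sw_of_tmul]

theorem sw_of_map (u : V →ₗ[ℂ] X) (v : W →ₗ[ℂ] Y) (t : V ⊗[ℂ] W) (f : X → Y → U)
    (hl : ∀ b, Lin fun a => f a b) (hr : ∀ a, Lin fun b => f a b) :
    sw (TensorProduct.map u v t) f = sw t fun a b => f (u a) (v b) := by
  rw [map_eq_sw, sw_of_sw _ _ _ hl hr]
  simp only [sw_of_tmul _ _ _ hl hr]

theorem sw_of_comm (t : V ⊗[ℂ] W) (f : W → V → U)
    (hl : ∀ b, Lin fun a => f a b) (hr : ∀ a, Lin fun b => f a b) :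
    sw (TensorProduct.comm ℂ V W t) f = sw t fun a b => f b a := by
  conv_lhs => rw [← sw_self t, ← LinearEquiv.coe_coe, map_sw]
  rw [sw_of_sw _ _ _ hl hr]
  simp [sw_of_tmul _ _ _ hl hr]

theorem map₂_eq_sw (B : V →ₗ[ℂ] X →ₗ[ℂ] U) (C : W →ₗ[ℂ] Y →ₗ[ℂ] Z) (s : V ⊗[ℂ] W)
    (t : X ⊗[ℂ] Y) :
    TensorProduct.map₂ B C s t =
      sw s fun a b => sw t fun c d => B a c ⊗ₜ[ℂ] C b d := by
  conv_lhs => rw [← sw_self s, map_sw, sw_apply]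
  simp only [TensorProduct.map₂_apply_tmul, map_eq_sw]

theorem sw_of_map₂ (B : V →ₗ[ℂ] X →ₗ[ℂ] U) (C : W →ₗ[ℂ] Y →ₗ[ℂ] Z) (s : V ⊗[ℂ] W)
    (t : X ⊗[ℂ] Y) {T : Type*} [AddCommMonoid T] [Module ℂ T] (f : U → Z → T)
    (hl : ∀ b, Lin fun a => f a b) (hr : ∀ a, Lin fun b => f a b) :
    sw (TensorProduct.map₂ B C s t) f = sw s fun a b => sw t fun c d => f (B a c) (C b d) := by
  simp only [map₂_eq_sw, sw_of_sw _ _ _ hl hr, sw_of_tmul _ _ _ hl hr]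

/-- A conjugate-linear map applied to both legs. -/
theorem map_star_eq_sw (u : V →ₛₗ[starRingEnd ℂ] X) (v : W →ₛₗ[starRingEnd ℂ] Y) (t : V ⊗[ℂ] W) :
    TensorProduct.map u v t = sw t fun a b => u a ⊗ₜ[ℂ] v b := by
  conv_lhs => rw [(TensorProduct.exists_finset t).choose_spec]
  simp [sw]

theorem sw_of_map_star (u : V →ₛₗ[starRingEnd ℂ] X) (v : W →ₛₗ[starRingEnd ℂ] Y) (t : V ⊗[ℂ] W)
    (f : X → Y → U) (hl : ∀ b, Lin fun a => f a b) (hr : ∀ a, Lin fun b => f a b) :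
    sw (TensorProduct.map u v t) f = sw t fun a b => f (u a) (v b) := by
  rw [map_star_eq_sw, sw_of_sw _ _ _ hl hr]
  simp only [sw_of_tmul _ _ _ hl hr]

theorem star_sw (u : U →ₛₗ[starRingEnd ℂ] X) (t : V ⊗[ℂ] W) (f : V → W → U) :
    u (sw t f) = sw t fun a b => u (f a b) := map_sum _ _ _

theorem conj_sw (t : V ⊗[ℂ] W) (f : V → W → ℂ) :
    (starRingEnd ℂ) (sw t f) = sw t fun a b => (starRingEnd ℂ) (f a b) := map_sum _ _ _

end Sweedler

noncomputable section WeakHopf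

variable {H : Type*} [AddCommGroup H] [Module ℂ H] {A : QGData H}
  {U : Type*} [AddCommMonoid U] [Module ℂ U]

local notation:70 a:70 " ⬝ " b:71 => QGData.mul A a b
local notation "S" => QGData.antipode A
local notation "Si" => QGData.antipodeInv A
local notation "Δ" => QGData.comul A
local notation "ε" => QGData.counit A
local notation "𝟙" => QGData.one A

/-! ### The axioms in Sweedler's notation -/

theorem epsT_eq (h : H) : A.epsT h = sw (Δ h) fun a b => a ⬝ S b := by
  simp only [epsT, LinearMap.comp_apply, map_eq_sw, map_sw]
  rfl

theorem epsS_eq (h : H) : A.epsS h = sw (Δ h) fun a b => S a ⬝ b := by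
  simp only [epsS, LinearMap.comp_apply, map_eq_sw, map_sw]
  rfl

theorem mulThree_assoc_tmul (s t : H ⊗[ℂ] H) (x y : H) :
    A.mulThree (TensorProduct.assoc ℂ H H H (s ⊗ₜ[ℂ] x)) (y ⊗ₜ[ℂ] t) =
      sw s fun a b => sw t fun c d => (a ⬝ y) ⊗ₜ[ℂ] ((b ⬝ c) ⊗ₜ[ℂ] (x ⬝ d)) := by
  conv_lhs => rw [← sw_self s, sw_tmul, equiv_sw, map_sw, sw_apply]
  refine sw_congr fun a b => ?_
  rw [TensorProduct.assoc_tmul, mulThree, TensorProduct.map₂_apply_tmul, TensorProduct.map_tmul,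
    mulTwo, TensorProduct.map₂_apply_tmul, map_eq_sw, tmul_sw]

theorem mulThree_tmul_assoc (s t : H ⊗[ℂ] H) (x y : H) :
    A.mulThree (y ⊗ₜ[ℂ] t) (TensorProduct.assoc ℂ H H H (s ⊗ₜ[ℂ] x)) =
      sw s fun a b => sw t fun c d => (y ⬝ a) ⊗ₜ[ℂ] ((c ⬝ b) ⊗ₜ[ℂ] (d ⬝ x)) := by
  conv_lhs => rw [← sw_self s, sw_tmul, equiv_sw, map_sw]
  refine sw_congr fun a b => ?_
  rw [TensorProduct.assoc_tmul, mulThree, TensorProduct.map₂_apply_tmul, TensorProduct.map_tmul,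
    mulTwo]
  conv_lhs => rw [← sw_self t, map_sw, sw_apply, tmul_sw]
  rfl

namespace IsQuantumGroupoid

variable (hA : A.IsQuantumGroupoid)
include hA

theorem sw_assoc (h : H) (f : H → H → H → U) (h1 : ∀ b c, Lin fun a => f a b c)
    (h2 : ∀ a c, Lin fun b => f a b c) (h3 : ∀ a b, Lin fun c => f a b c) :
    (sw (Δ h) fun a b => sw (Δ a) fun c d => f c d b) =
      sw (Δ h) fun a b => sw (Δ b) fun c d => f a c d := by
  have := congrArg (fun t => sw t fun a s => sw s fun b c => f a b c) (hA.coassoc h)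
  rw [sw_of_assoc _ _ h1 h2 h3, sw_of_map _ _ _ _ (by fun_prop) (by fun_prop),
    sw_of_map _ _ _ _ (by fun_prop) (by fun_prop)] at this
  exact this

end IsQuantumGroupoid

namespace IsQuantumGroupoid

variable (hA : A.IsQuantumGroupoid)
include hA

theorem sw_counit_left (h : H) (f : H → U) (hf : Lin f) :
    (sw (Δ h) fun a b => ε a • f b) = f h := by
  conv_rhs => rw [← hA.counit_left h]
  rw [map_eq_sw, ← LinearEquiv.coe_coe, map_sw]
  change _ = hf.toMap _
  rw [map_sw]
  refine sw_congr fun a b => ?_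
  simp [Lin.toMap]

theorem sw_counit_right (h : H) (f : H → U) (hf : Lin f) :
    (sw (Δ h) fun a b => ε b • f a) = f h := by
  conv_rhs => rw [← hA.counit_right h]
  rw [map_eq_sw, ← LinearEquiv.coe_coe, map_sw]
  change _ = hf.toMap _
  rw [map_sw]
  refine sw_congr fun a b => ?_
  simp [Lin.toMap]

theorem sw_comul_mul (g h : H) (f : H → H → U) (hl : ∀ b, Lin fun a => f a b)
    (hr : ∀ a, Lin fun b => f a b) :
    sw (Δ (g ⬝ h)) f = sw (Δ g) fun a b => sw (Δ h) fun c d => f (a ⬝ c) (b ⬝ d) := by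
  rw [hA.comul_mul, mulTwo, sw_of_map₂ _ _ _ _ _ hl hr]

/-- `Δ(1) Δ(h) = Δ(h)`. -/
theorem sw_one_mul (h : H) (f : H → H → U) (hl : ∀ b, Lin fun a => f a b)
    (hr : ∀ a, Lin fun b => f a b) :
    (sw (Δ 𝟙) fun a b => sw (Δ h) fun c d => f (a ⬝ c) (b ⬝ d)) = sw (Δ h) f := by
  rw [← hA.sw_comul_mul _ _ _ hl hr, hA.one_mul]

/-- `Δ(h) Δ(1) = Δ(h)`. -/
theorem sw_mul_one (h : H) (f : H → H → U) (hl : ∀ b, Lin fun a => f a b)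
    (hr : ∀ a, Lin fun b => f a b) :
    (sw (Δ h) fun a b => sw (Δ 𝟙) fun c d => f (a ⬝ c) (b ⬝ d)) = sw (Δ h) f := by
  rw [← hA.sw_comul_mul _ _ _ hl hr, hA.mul_one]

/-- `1₁ ⊗ Δ(1₂) = 1₁ ⊗ 1₂ 1'₁ ⊗ 1'₂`. -/
theorem sw_one_left (f : H → H → H → U) (h1 : ∀ b c, Lin fun a => f a b c)
    (h2 : ∀ a c, Lin fun b => f a b c) (h3 : ∀ a b, Lin fun c => f a b c) :
    (sw (Δ 𝟙) fun a b => sw (Δ b) fun c d => f a c d) =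
      sw (Δ 𝟙) fun a b => sw (Δ 𝟙) fun c d => f a (b ⬝ c) d := by
  have := congrArg (fun t => sw t fun a s => sw s fun b c => f a b c)
    ((hA.coassoc 𝟙).symm.trans hA.comul_one_left)
  rw [mulThree_assoc_tmul, sw_of_map _ _ _ _ (by fun_prop) (by fun_prop)] at this
  simpa (disch := fun_prop) only [sw_of_sw, sw_of_tmul, hA.one_mul, hA.mul_one,
    LinearMap.id_apply] using this

/-- `1₁ ⊗ Δ(1₂) = 1₁ ⊗ 1'₁ 1₂ ⊗ 1'₂`. -/
theorem sw_one_right (f : H → H → H → U) (h1 : ∀ b c, Lin fun a => f a b c)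
    (h2 : ∀ a c, Lin fun b => f a b c) (h3 : ∀ a b, Lin fun c => f a b c) :
    (sw (Δ 𝟙) fun a b => sw (Δ b) fun c d => f a c d) =
      sw (Δ 𝟙) fun a b => sw (Δ 𝟙) fun c d => f a (c ⬝ b) d := by
  have := congrArg (fun t => sw t fun a s => sw s fun b c => f a b c)
    ((hA.coassoc 𝟙).symm.trans hA.comul_one_right)
  rw [mulThree_tmul_assoc, sw_of_map _ _ _ _ (by fun_prop) (by fun_prop)] at this
  simpa (disch := fun_prop) only [sw_of_sw, sw_of_tmul, hA.one_mul, hA.mul_one,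
    LinearMap.id_apply] using this

theorem sw_counit_mul_left (f g h : H) :
    (sw (Δ g) fun a b => ε (f ⬝ a) * ε (b ⬝ h)) = ε (f ⬝ g ⬝ h) := by
  rw [hA.counit_mul_left, map_eq_sw, ← LinearEquiv.coe_coe, map_sw]
  rfl

theorem sw_counit_mul_right (f g h : H) :
    (sw (Δ g) fun a b => ε (f ⬝ b) * ε (a ⬝ h)) = ε (f ⬝ g ⬝ h) := by
  rw [hA.counit_mul_right, comulOp, LinearMap.comp_apply, LinearEquiv.coe_coe, map_eq_sw,
    ← LinearEquiv.coe_coe, map_sw, sw_of_comm _ _ (by fun_prop) (by fun_prop)]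
  rfl

theorem sw_comul_antipode (h : H) (f : H → H → U) (hl : ∀ b, Lin fun a => f a b)
    (hr : ∀ a, Lin fun b => f a b) :
    sw (Δ (S h)) f = sw (Δ h) fun a b => f (S b) (S a) := by
  rw [hA.comul_antipode, sw_of_map _ _ _ _ hl hr, comulOp]
  exact sw_of_comm _ _ (by fun_prop) (by fun_prop)

/-- `ε_t(h) = ε(1₁ h) 1₂`. -/
theorem epsT_eq' (h : H) : A.epsT h = sw (Δ 𝟙) fun a b => ε (a ⬝ h) • b := by
  simp only [epsT, LinearMap.comp_apply, hA.antipode_target, mulTwo]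
  conv_lhs => rw [← sw_self (Δ 𝟙)]
  simp [map_sw, sw_apply, hA.mul_one, ← LinearEquiv.coe_coe]

/-- `ε_s(h) = 1₁ ε(h 1₂)`. -/
theorem epsS_eq' (h : H) : A.epsS h = sw (Δ 𝟙) fun a b => ε (h ⬝ b) • a := by
  simp only [epsS, LinearMap.comp_apply, hA.antipode_source, mulTwo]
  conv_lhs => rw [← sw_self (Δ 𝟙)]
  simp [map_sw, hA.one_mul, ← LinearEquiv.coe_coe]

/-- `h₁ ⊗ ε_t(h₂) = 1₁ h ⊗ 1₂`. -/
theorem sw_epsT_right (h : H) (f : H → H → U) (hl : ∀ b, Lin fun a => f a b := by fun_prop)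
    (hr : ∀ a, Lin fun b => f a b := by fun_prop) :
    (sw (Δ h) fun a b => f a (A.epsT b)) = sw (Δ 𝟙) fun a b => f (a ⬝ h) b := by
  calc (sw (Δ h) fun a b => f a (A.epsT b))
      = sw (Δ 𝟙) fun p q => sw (Δ h) fun a b => f (p ⬝ a) (A.epsT (q ⬝ b)) :=
        (hA.sw_one_mul h (fun a b => f a (A.epsT b)) (by fun_prop) (by fun_prop)).symm
    _ = sw (Δ 𝟙) fun p q => sw (Δ 𝟙) fun c d => sw (Δ h) fun a b =>
          ε ((c ⬝ q) ⬝ b) • f (p ⬝ a) d := by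
        refine sw_congr fun p q => ?_
        rw [sw_sw_comm]
        refine sw_congr fun a b => ?_
        rw [hA.epsT_eq']
        change (hr (p ⬝ a)).toMap _ = _
        rw [map_sw]
        refine sw_congr fun c d => ?_
        rw [map_smul, hA.mul_assoc]; rfl
    _ = sw (Δ 𝟙) fun p r => sw (Δ r) fun x d => sw (Δ h) fun a b =>
          ε (x ⬝ b) • f (p ⬝ a) d :=
        (hA.sw_one_right (fun p x d => sw (Δ h) fun a b => ε (x ⬝ b) • f (p ⬝ a) d)
          (by fun_prop) (by fun_prop) (by fun_prop)).symm
    _ = sw (Δ 𝟙) fun r d => sw (Δ r) fun p x => sw (Δ h) fun a b =>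
          ε (x ⬝ b) • f (p ⬝ a) d :=
        (hA.sw_assoc _ (fun p x d => sw (Δ h) fun a b => ε (x ⬝ b) • f (p ⬝ a) d)
          (by fun_prop) (by fun_prop) (by fun_prop)).symm
    _ = _ := by
        refine sw_congr fun r d => ?_
        rw [← hA.sw_comul_mul r h (fun u v => ε v • f u d) (by fun_prop) (by fun_prop),
          hA.sw_counit_right _ _ (hl d)]

/-- `ε_s(h₁) ⊗ h₂ = 1₁ ⊗ h 1₂`. -/
theorem sw_epsS_left (h : H) (f : H → H → U) (hl : ∀ b, Lin fun a => f a b := by fun_prop)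
    (hr : ∀ a, Lin fun b => f a b := by fun_prop) :
    (sw (Δ h) fun a b => f (A.epsS a) b) = sw (Δ 𝟙) fun a b => f a (h ⬝ b) := by
  calc (sw (Δ h) fun a b => f (A.epsS a) b)
      = sw (Δ h) fun a b => sw (Δ 𝟙) fun p q => f (A.epsS (a ⬝ p)) (b ⬝ q) :=
        (hA.sw_mul_one h (fun a b => f (A.epsS a) b) (by fun_prop) (by fun_prop)).symm
    _ = sw (Δ 𝟙) fun c d => sw (Δ 𝟙) fun p q => sw (Δ h) fun a b =>
          ε (a ⬝ (p ⬝ d)) • f c (b ⬝ q) := by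
        rw [sw_sw_comm, sw_sw_comm (Δ 𝟙) (Δ 𝟙)]
        refine sw_congr fun p q => ?_
        rw [sw_sw_comm]
        refine sw_congr fun a b => ?_
        rw [hA.epsS_eq']
        change (hl (b ⬝ q)).toMap _ = _
        rw [map_sw]
        refine sw_congr fun c d => ?_
        rw [map_smul, hA.mul_assoc]; rfl
    _ = sw (Δ 𝟙) fun c r => sw (Δ r) fun x q => sw (Δ h) fun a b =>
          ε (a ⬝ x) • f c (b ⬝ q) :=
        (hA.sw_one_right (fun c x q => sw (Δ h) fun a b => ε (a ⬝ x) • f c (b ⬝ q))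
          (by fun_prop) (by fun_prop) (by fun_prop)).symm
    _ = _ := by
        refine sw_congr fun c r => ?_
        rw [sw_sw_comm, ← hA.sw_comul_mul h r (fun u v => ε u • f c v) (by fun_prop) (by fun_prop),
          hA.sw_counit_left _ _ (hr c)]

end IsQuantumGroupoid

/-! ### The counital subalgebras -/

namespace IsQuantumGroupoid

variable (hA : A.IsQuantumGroupoid)
include hA

theorem lin_epsT (h : H) {g : H → U} (hg : Lin g) :
    g (A.epsT h) = sw (Δ 𝟙) fun a b => ε (a ⬝ h) • g b := by
  simp only [hA.epsT_eq', hg.map_sw, hg.smul]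

theorem lin_epsS (h : H) {g : H → U} (hg : Lin g) :
    g (A.epsS h) = sw (Δ 𝟙) fun a b => ε (h ⬝ b) • g a := by
  simp only [hA.epsS_eq', hg.map_sw, hg.smul]

/-- `Δ(z) = z 1₁ ⊗ 1₂` for `z` in the target subalgebra. -/
theorem sw_comul_target {z : H} (hz : z ∈ A.targetSub) (f : H → H → U)
    (hl : ∀ b, Lin fun a => f a b) (hr : ∀ a, Lin fun b => f a b) :
    sw (Δ z) f = sw (Δ 𝟙) fun c d => f (z ⬝ c) d := by
  obtain ⟨h, rfl⟩ := hz
  rw [hA.lin_epsT h (g := fun z => sw (Δ z) f) (by fun_prop)]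
  simp only [smul_sw]
  rw [hA.sw_one_left (fun a c d => ε (a ⬝ h) • f c d) (by fun_prop) (by fun_prop) (by fun_prop),
    sw_sw_comm]
  refine sw_congr fun c d => ?_
  rw [hA.lin_epsT h (g := fun z => f (z ⬝ c) d) (by fun_prop)]

/-- `Δ(z) = 1₁ z ⊗ 1₂` for `z` in the target subalgebra. -/
theorem sw_comul_target' {z : H} (hz : z ∈ A.targetSub) (f : H → H → U)
    (hl : ∀ b, Lin fun a => f a b) (hr : ∀ a, Lin fun b => f a b) :
    sw (Δ z) f = sw (Δ 𝟙) fun c d => f (c ⬝ z) d := by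
  obtain ⟨h, rfl⟩ := hz
  rw [hA.lin_epsT h (g := fun z => sw (Δ z) f) (by fun_prop)]
  simp only [smul_sw]
  rw [hA.sw_one_right (fun a c d => ε (a ⬝ h) • f c d) (by fun_prop) (by fun_prop) (by fun_prop),
    sw_sw_comm]
  refine sw_congr fun c d => ?_
  rw [hA.lin_epsT h (g := fun z => f (c ⬝ z) d) (by fun_prop)]

/-- `Δ(y) = 1₁ ⊗ y 1₂` for `y` in the source subalgebra. -/
theorem sw_comul_source {y : H} (hy : y ∈ A.sourceSub) (f : H → H → U)
    (hl : ∀ b, Lin fun a => f a b) (hr : ∀ a, Lin fun b => f a b) :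
    sw (Δ y) f = sw (Δ 𝟙) fun c d => f c (y ⬝ d) := by
  obtain ⟨h, rfl⟩ := hy
  rw [hA.lin_epsS h (g := fun z => sw (Δ z) f) (by fun_prop)]
  simp only [smul_sw]
  rw [hA.sw_assoc 𝟙 (fun c d b => ε (h ⬝ b) • f c d) (by fun_prop) (by fun_prop) (by fun_prop),
    hA.sw_one_right (fun c d b => ε (h ⬝ b) • f c d) (by fun_prop) (by fun_prop) (by fun_prop)]
  refine sw_congr fun c d => ?_
  rw [hA.lin_epsS h (g := fun z => f c (z ⬝ d)) (by fun_prop)]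

/-- `Δ(y) = 1₁ ⊗ 1₂ y` for `y` in the source subalgebra. -/
theorem sw_comul_source' {y : H} (hy : y ∈ A.sourceSub) (f : H → H → U)
    (hl : ∀ b, Lin fun a => f a b) (hr : ∀ a, Lin fun b => f a b) :
    sw (Δ y) f = sw (Δ 𝟙) fun c d => f c (d ⬝ y) := by
  obtain ⟨h, rfl⟩ := hy
  rw [hA.lin_epsS h (g := fun z => sw (Δ z) f) (by fun_prop)]
  simp only [smul_sw]
  rw [hA.sw_assoc 𝟙 (fun c d b => ε (h ⬝ b) • f c d) (by fun_prop) (by fun_prop) (by fun_prop),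
    hA.sw_one_left (fun c d b => ε (h ⬝ b) • f c d) (by fun_prop) (by fun_prop) (by fun_prop)]
  refine sw_congr fun c d => ?_
  rw [hA.lin_epsS h (g := fun z => f c (d ⬝ z)) (by fun_prop)]

/-- `Δ(zx) = z x₁ ⊗ x₂` for `z` in the target subalgebra. -/
theorem sw_target_mul {z : H} (hz : z ∈ A.targetSub) (x : H) (f : H → H → U)
    (hl : ∀ b, Lin fun a => f a b) (hr : ∀ a, Lin fun b => f a b) :
    sw (Δ (z ⬝ x)) f = sw (Δ x) fun a b => f (z ⬝ a) b := by
  rw [hA.sw_comul_mul _ _ _ hl hr, hA.sw_comul_target hz _ (by fun_prop) (by fun_prop)]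
  simp only [hA.mul_assoc]
  exact hA.sw_one_mul x (fun a b => f (z ⬝ a) b) (by fun_prop) (by fun_prop)

/-- `Δ(xz) = x₁ z ⊗ x₂` for `z` in the target subalgebra. -/
theorem sw_mul_target {z : H} (hz : z ∈ A.targetSub) (x : H) (f : H → H → U)
    (hl : ∀ b, Lin fun a => f a b) (hr : ∀ a, Lin fun b => f a b) :
    sw (Δ (x ⬝ z)) f = sw (Δ x) fun a b => f (a ⬝ z) b := by
  rw [hA.sw_comul_mul _ _ _ hl hr, sw_sw_comm,
    hA.sw_comul_target' hz _ (by fun_prop) (by fun_prop), sw_sw_comm]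
  simp only [← hA.mul_assoc]
  exact hA.sw_mul_one x (fun a b => f (a ⬝ z) b) (by fun_prop) (by fun_prop)

/-- `Δ(yx) = x₁ ⊗ y x₂` for `y` in the source subalgebra. -/
theorem sw_source_mul {y : H} (hy : y ∈ A.sourceSub) (x : H) (f : H → H → U)
    (hl : ∀ b, Lin fun a => f a b) (hr : ∀ a, Lin fun b => f a b) :
    sw (Δ (y ⬝ x)) f = sw (Δ x) fun a b => f a (y ⬝ b) := by
  rw [hA.sw_comul_mul _ _ _ hl hr, hA.sw_comul_source hy _ (by fun_prop) (by fun_prop)]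
  simp only [hA.mul_assoc]
  exact hA.sw_one_mul x (fun a b => f a (y ⬝ b)) (by fun_prop) (by fun_prop)

/-- `Δ(xy) = x₁ ⊗ x₂ y` for `y` in the source subalgebra. -/
theorem sw_mul_source {y : H} (hy : y ∈ A.sourceSub) (x : H) (f : H → H → U)
    (hl : ∀ b, Lin fun a => f a b) (hr : ∀ a, Lin fun b => f a b) :
    sw (Δ (x ⬝ y)) f = sw (Δ x) fun a b => f a (b ⬝ y) := by
  rw [hA.sw_comul_mul _ _ _ hl hr, sw_sw_comm,
    hA.sw_comul_source' hy _ (by fun_prop) (by fun_prop), sw_sw_comm]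
  simp only [← hA.mul_assoc]
  exact hA.sw_mul_one x (fun a b => f a (b ⬝ y)) (by fun_prop) (by fun_prop)

/-- The two counital subalgebras commute. -/
theorem target_comm_source {z y : H} (hz : z ∈ A.targetSub) (hy : y ∈ A.sourceSub) :
    z ⬝ y = y ⬝ z := by
  obtain ⟨h, rfl⟩ := hz
  obtain ⟨g, rfl⟩ := hy
  have hl := hA.sw_one_left (fun a c d => ε (a ⬝ h) • ε (g ⬝ d) • c)
    (by fun_prop) (by fun_prop) (by fun_prop)
  have hr := hA.sw_one_right (fun a c d => ε (a ⬝ h) • ε (g ⬝ d) • c)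
    (by fun_prop) (by fun_prop) (by fun_prop)
  rw [hA.lin_epsT h (g := fun z => z ⬝ A.epsS g) (by fun_prop),
    hA.lin_epsT h (g := fun z => A.epsS g ⬝ z) (by fun_prop)]
  refine Eq.trans ?_ ((hl.symm.trans hr).trans ?_) <;> refine sw_congr fun a b => ?_
  · rw [hA.lin_epsS g (g := fun y => b ⬝ y) (by fun_prop), smul_sw]
  · rw [hA.lin_epsS g (g := fun y => y ⬝ b) (by fun_prop), smul_sw]

theorem epsT_mem (h : H) : A.epsT h ∈ A.targetSub := ⟨h, rfl⟩

theorem epsS_mem (h : H) : A.epsS h ∈ A.sourceSub := ⟨h, rfl⟩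

theorem epsT_target {z : H} (hz : z ∈ A.targetSub) : A.epsT z = z := by
  rw [hA.epsT_eq', ← hA.sw_comul_target' hz (fun a b => ε a • b) (by fun_prop) (by fun_prop),
    hA.sw_counit_left z (fun x => x) (by fun_prop)]

theorem epsS_source {y : H} (hy : y ∈ A.sourceSub) : A.epsS y = y := by
  rw [hA.epsS_eq', ← hA.sw_comul_source hy (fun a b => ε b • a) (by fun_prop) (by fun_prop),
    hA.sw_counit_right y (fun x => x) (by fun_prop)]

theorem one_mem_target : 𝟙 ∈ A.targetSub := by
  refine ⟨𝟙, ?_⟩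
  rw [hA.epsT_eq']
  simp only [hA.mul_one]
  exact hA.sw_counit_left 𝟙 (fun x => x) (by fun_prop)

theorem one_mem_source : 𝟙 ∈ A.sourceSub := by
  refine ⟨𝟙, ?_⟩
  rw [hA.epsS_eq']
  simp only [hA.one_mul]
  exact hA.sw_counit_right 𝟙 (fun x => x) (by fun_prop)

/-- `1₁ S(1₂) = 1`. -/
theorem one_mul_antipode : (sw (Δ 𝟙) fun a b => a ⬝ S b) = 𝟙 :=
  (epsT_eq _).symm.trans (hA.epsT_target hA.one_mem_target)

/-- `S(1₁) 1₂ = 1`. -/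
theorem antipode_one_mul : (sw (Δ 𝟙) fun a b => S a ⬝ b) = 𝟙 :=
  (epsS_eq _).symm.trans (hA.epsS_source hA.one_mem_source)

theorem epsT_target_mul {z : H} (hz : z ∈ A.targetSub) (h : H) :
    A.epsT (z ⬝ h) = z ⬝ A.epsT h := by
  rw [epsT_eq, hA.sw_target_mul hz _ _ (by fun_prop) (by fun_prop), epsT_eq, map_sw]
  simp only [hA.mul_assoc]

theorem epsT_source_mul {y : H} (hy : y ∈ A.sourceSub) (h : H) :
    A.epsT (y ⬝ h) = A.epsT h ⬝ S y := by
  rw [epsT_eq, hA.sw_source_mul hy _ _ (by fun_prop) (by fun_prop), epsT_eq, map_sw, sw_apply]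
  simp only [hA.mul_assoc, hA.antipode_mul]

theorem epsS_mul_source {y : H} (hy : y ∈ A.sourceSub) (h : H) :
    A.epsS (h ⬝ y) = A.epsS h ⬝ y := by
  rw [epsS_eq, hA.sw_mul_source hy _ _ (by fun_prop) (by fun_prop), epsS_eq, map_sw, sw_apply]
  simp only [hA.mul_assoc]

theorem epsS_mul_target {z : H} (hz : z ∈ A.targetSub) (h : H) :
    A.epsS (h ⬝ z) = S z ⬝ A.epsS h := by
  rw [epsS_eq, hA.sw_mul_target hz _ _ (by fun_prop) (by fun_prop), epsS_eq, map_sw]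
  simp only [hA.mul_assoc, hA.antipode_mul]

theorem antipode_of_source {y : H} (hy : y ∈ A.sourceSub) : S y = A.epsT y := by
  have := hA.epsT_source_mul hy 𝟙
  rwa [hA.mul_one, hA.epsT_target hA.one_mem_target, hA.one_mul, eq_comm] at this

theorem antipode_of_target {z : H} (hz : z ∈ A.targetSub) : S z = A.epsS z := by
  have := hA.epsS_mul_target hz 𝟙
  rwa [hA.one_mul, hA.epsS_source hA.one_mem_source, hA.mul_one, eq_comm] at this

theorem antipode_source_mem {y : H} (hy : y ∈ A.sourceSub) : S y ∈ A.targetSub :=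
  hA.antipode_of_source hy ▸ hA.epsT_mem y

theorem antipode_target_mem {z : H} (hz : z ∈ A.targetSub) : S z ∈ A.sourceSub :=
  hA.antipode_of_target hz ▸ hA.epsS_mem z

/-- `Δ(1)` lies in the tensor product of the source and the target subalgebra. -/
theorem sw_one_split (f : H → H → U) (hl : ∀ b, Lin fun a => f a b := by fun_prop)
    (hr : ∀ a, Lin fun b => f a b := by fun_prop) :
    (sw (Δ 𝟙) fun a b => f (A.epsS a) (A.epsT b)) = sw (Δ 𝟙) f := by
  rw [hA.sw_epsT_right 𝟙 (fun a b => f (A.epsS a) b)]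
  simp only [hA.mul_one]
  rw [hA.sw_epsS_left 𝟙 f hl hr]
  simp only [hA.one_mul]

/-- An identity between functions of `1₁ ⊗ 1₂` may be checked on elements of the source and the
target subalgebra. -/
theorem sw_one_congr {f g : H → H → U} (h : ∀ a ∈ A.sourceSub, ∀ b ∈ A.targetSub, f a b = g a b)
    (hfl : ∀ b, Lin fun a => f a b := by fun_prop) (hfr : ∀ a, Lin fun b => f a b := by fun_prop)
    (hgl : ∀ b, Lin fun a => g a b := by fun_prop) (hgr : ∀ a, Lin fun b => g a b := by fun_prop) :
    sw (Δ 𝟙) f = sw (Δ 𝟙) g := by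
  rw [← hA.sw_one_split f hfl hfr, ← hA.sw_one_split g hgl hgr]
  exact sw_congr fun a b => h _ (hA.epsS_mem a) _ (hA.epsT_mem b)

/-- `x₁ y ⊗ x₂ = x₁ ⊗ x₂ S(y)` for `y` in the source subalgebra. -/
theorem sw_source_move {y : H} (hy : y ∈ A.sourceSub) (x : H) (f : H → H → U)
    (hl : ∀ b, Lin fun a => f a b := by fun_prop) (hr : ∀ a, Lin fun b => f a b := by fun_prop) :
    (sw (Δ x) fun a b => f (a ⬝ y) b) = sw (Δ x) fun a b => f a (b ⬝ S y) := by
  have key (g : H → H → U) (hl : ∀ b, Lin fun a => g a b) (hr : ∀ a, Lin fun b => g a b) :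
      (sw (Δ 𝟙) fun a b => g (a ⬝ y) b) = sw (Δ 𝟙) fun a b => g a (b ⬝ S y) := by
    rw [← hA.sw_epsT_right y g hl hr, hA.sw_comul_source' hy _ (by fun_prop) (by fun_prop)]
    refine hA.sw_one_congr fun a _ b hb => ?_
    rw [hA.epsT_target_mul hb, hA.antipode_of_source hy]
  rw [← hA.sw_mul_one x _ (by fun_prop) (by fun_prop),
    ← hA.sw_mul_one x (fun a b => f a (b ⬝ S y)) (by fun_prop) (by fun_prop)]
  simp only [hA.mul_assoc]
  exact sw_congr fun a b => key (fun c d => f (a ⬝ c) (b ⬝ d)) (by fun_prop) (by fun_prop)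

/-- `S(z) x₁ ⊗ x₂ = x₁ ⊗ z x₂` for `z` in the target subalgebra. -/
theorem sw_target_move {z : H} (hz : z ∈ A.targetSub) (x : H) (f : H → H → U)
    (hl : ∀ b, Lin fun a => f a b := by fun_prop) (hr : ∀ a, Lin fun b => f a b := by fun_prop) :
    (sw (Δ x) fun a b => f (S z ⬝ a) b) = sw (Δ x) fun a b => f a (z ⬝ b) := by
  have key (g : H → H → U) (hl : ∀ b, Lin fun a => g a b) (hr : ∀ a, Lin fun b => g a b) :
      (sw (Δ 𝟙) fun a b => g (S z ⬝ a) b) = sw (Δ 𝟙) fun a b => g a (z ⬝ b) := by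
    rw [← hA.sw_epsS_left z g hl hr, hA.sw_comul_target' hz _ (by fun_prop) (by fun_prop)]
    refine hA.sw_one_congr fun a ha b hb => ?_
    rw [hA.epsS_mul_target hz, hA.epsS_source ha]
  rw [← hA.sw_one_mul x _ (by fun_prop) (by fun_prop),
    ← hA.sw_one_mul x (fun a b => f a (z ⬝ b)) (by fun_prop) (by fun_prop)]
  simp only [← hA.mul_assoc]
  rw [sw_sw_comm, sw_sw_comm _ (Δ x)]
  exact sw_congr fun a b => key (fun c d => f (c ⬝ a) (d ⬝ b)) (by fun_prop) (by fun_prop)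

/-- `ε(z x₁) x₂ = z x` for `z` in the target subalgebra. -/
theorem sw_counit_target_left {z : H} (hz : z ∈ A.targetSub) (x : H) (f : H → U) (hf : Lin f) :
    (sw (Δ x) fun a b => ε (z ⬝ a) • f b) = f (z ⬝ x) := by
  rw [← hA.sw_target_mul hz x (fun a b => ε a • f b) (by fun_prop) (by fun_prop),
    hA.sw_counit_left _ _ hf]

/-- `x₁ ε(z x₂) = S(z) x` for `z` in the target subalgebra. -/
theorem sw_counit_target_right {z : H} (hz : z ∈ A.targetSub) (x : H) (f : H → U) (hf : Lin f) :
    (sw (Δ x) fun a b => ε (z ⬝ b) • f a) = f (S z ⬝ x) := by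
  rw [← hA.sw_target_move hz x (fun a b => ε b • f a),
    hA.sw_counit_right _ (fun a => f (S z ⬝ a)) (by fun_prop)]

/-- `x₁ ε(x₂ y) = x y` for `y` in the source subalgebra. -/
theorem sw_counit_source_right {y : H} (hy : y ∈ A.sourceSub) (x : H) (f : H → U) (hf : Lin f) :
    (sw (Δ x) fun a b => ε (b ⬝ y) • f a) = f (x ⬝ y) := by
  rw [← hA.sw_mul_source hy x (fun a b => ε b • f a) (by fun_prop) (by fun_prop),
    hA.sw_counit_right _ _ hf]

/-- `ε(x₁ y) x₂ = x S(y)` for `y` in the source subalgebra. -/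
theorem sw_counit_source_left {y : H} (hy : y ∈ A.sourceSub) (x : H) (f : H → U) (hf : Lin f) :
    (sw (Δ x) fun a b => ε (a ⬝ y) • f b) = f (x ⬝ S y) := by
  rw [hA.sw_source_move hy x (fun a b => ε a • f b),
    hA.sw_counit_left _ (fun a => f (a ⬝ S y)) (by fun_prop)]

/-- `ε_t(h₁) ⊗ h₂ = S(1₁) ⊗ 1₂ h`. -/
theorem sw_epsT_left (h : H) (f : H → H → U) (hl : ∀ b, Lin fun a => f a b := by fun_prop)
    (hr : ∀ a, Lin fun b => f a b := by fun_prop) :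
    (sw (Δ h) fun a b => f (A.epsT a) b) = sw (Δ 𝟙) fun a b => f (S a) (b ⬝ h) := by
  have key (p : H) (g : H → U) (hg : Lin g) :
      (sw (Δ h) fun a b => ε (p ⬝ a) • g b) = sw (Δ 𝟙) fun c d => ε (p ⬝ c) • g (d ⬝ h) := by
    calc (sw (Δ h) fun a b => ε (p ⬝ a) • g b)
        = sw (Δ 𝟙) fun c d => sw (Δ h) fun a b => (ε (p ⬝ c) * ε (d ⬝ a)) • g b := by
          rw [sw_sw_comm]
          refine sw_congr fun a b => ?_
          rw [← sw_smul, hA.sw_counit_mul_left, hA.mul_one]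
      _ = _ := by
          refine hA.sw_one_congr fun c _ d hd => ?_
          simp only [mul_smul]
          rw [← smul_sw, hA.sw_counit_target_left hd _ _ hg]
  calc (sw (Δ h) fun a b => f (A.epsT a) b)
      = sw (Δ 𝟙) fun p q => sw (Δ h) fun a b => ε (p ⬝ a) • f q b := by
        rw [sw_sw_comm]
        exact sw_congr fun a b => hA.lin_epsT a (hl b)
    _ = sw (Δ 𝟙) fun p q => sw (Δ 𝟙) fun c d => ε (p ⬝ c) • f q (d ⬝ h) :=
        sw_congr fun p q => key p (f q) (hr q)
    _ = sw (Δ 𝟙) fun c d => f (A.epsT c) (d ⬝ h) := by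
        rw [sw_sw_comm]
        exact sw_congr fun c d => (hA.lin_epsT c (hl (d ⬝ h))).symm
    _ = _ := hA.sw_one_congr fun c hc d _ => by rw [hA.antipode_of_source hc]

/-- `h₁ ⊗ ε_s(h₂) = h 1₁ ⊗ S(1₂)`. -/
theorem sw_epsS_right (h : H) (f : H → H → U) (hl : ∀ b, Lin fun a => f a b := by fun_prop)
    (hr : ∀ a, Lin fun b => f a b := by fun_prop) :
    (sw (Δ h) fun a b => f a (A.epsS b)) = sw (Δ 𝟙) fun a b => f (h ⬝ a) (S b) := by
  have key (q : H) (g : H → U) (hg : Lin g) :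
      (sw (Δ h) fun a b => ε (b ⬝ q) • g a) = sw (Δ 𝟙) fun c d => ε (d ⬝ q) • g (h ⬝ c) := by
    calc (sw (Δ h) fun a b => ε (b ⬝ q) • g a)
        = sw (Δ 𝟙) fun c d => sw (Δ h) fun a b => (ε (d ⬝ q) * ε (b ⬝ c)) • g a := by
          rw [sw_sw_comm]
          refine sw_congr fun a b => ?_
          simp only [mul_comm (ε (_ ⬝ q))]
          rw [← sw_smul, hA.sw_counit_mul_left, hA.mul_one]
      _ = _ := by
          refine hA.sw_one_congr fun c hc d _ => ?_
          simp only [mul_smul]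
          rw [← smul_sw, hA.sw_counit_source_right hc _ _ hg]
  calc (sw (Δ h) fun a b => f a (A.epsS b))
      = sw (Δ 𝟙) fun p q => sw (Δ h) fun a b => ε (b ⬝ q) • f a p := by
        rw [sw_sw_comm]
        exact sw_congr fun a b => hA.lin_epsS b (hr a)
    _ = sw (Δ 𝟙) fun p q => sw (Δ 𝟙) fun c d => ε (d ⬝ q) • f (h ⬝ c) p :=
        sw_congr fun p q => key q (fun a => f a p) (hl p)
    _ = sw (Δ 𝟙) fun c d => f (h ⬝ c) (A.epsS d) := by
        rw [sw_sw_comm]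
        exact sw_congr fun c d => (hA.lin_epsS d (hr (h ⬝ c))).symm
    _ = _ := hA.sw_one_congr fun c _ d hd => by rw [hA.antipode_of_target hd]

theorem counit_mul_epsT (x y : H) : ε (x ⬝ A.epsT y) = ε (x ⬝ y) := by
  rw [hA.lin_epsT y (g := fun z => ε (x ⬝ z)) (by fun_prop), ← hA.mul_one x,
    ← hA.sw_counit_mul_right, hA.mul_one]
  exact sw_congr fun a b => by rw [smul_eq_mul, mul_comm]

theorem counit_epsS_mul (x y : H) : ε (A.epsS x ⬝ y) = ε (x ⬝ y) := by
  rw [hA.lin_epsS x (g := fun z => ε (z ⬝ y)) (by fun_prop), ← hA.mul_one x,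
    ← hA.sw_counit_mul_right, hA.mul_one]
  exact sw_congr fun a b => by rw [smul_eq_mul]

theorem epsT_mul_epsT (x y : H) : A.epsT (x ⬝ A.epsT y) = A.epsT (x ⬝ y) := by
  rw [hA.epsT_eq' (x ⬝ A.epsT y), hA.epsT_eq' (x ⬝ y)]
  simp only [← hA.mul_assoc, hA.counit_mul_epsT]

theorem epsS_antipode (h : H) : A.epsS (S h) = S (A.epsT h) := by
  rw [epsS_eq, hA.sw_comul_antipode _ _ (by fun_prop) (by fun_prop), epsT_eq, map_sw]
  simp only [hA.antipode_mul]

theorem epsT_antipode (h : H) : A.epsT (S h) = S (A.epsS h) := by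
  rw [epsT_eq, hA.sw_comul_antipode _ _ (by fun_prop) (by fun_prop), epsS_eq, map_sw]
  simp only [hA.antipode_mul]

end IsQuantumGroupoid

/-! ### Involutions and the inverse of the antipode -/

/-- A quantum groupoid with a compatible involution, not assumed to be proper. -/
structure IsStarQuantumGroupoid (A : QGData H) (st : H →ₛₗ[starRingEnd ℂ] H) : Prop where
  isQuantumGroupoid : A.IsQuantumGroupoid
  star_star : ∀ x : H, st (st x) = x
  star_mul : ∀ x y : H, st (A.mul x y) = A.mul (st y) (st x)
  comul_star : ∀ h : H, A.comul (st h) = TensorProduct.map st st (A.comul h)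

theorem IsCStarQuantumGroupoid.isStar {st : H →ₛₗ[starRingEnd ℂ] H}
    (h : A.IsCStarQuantumGroupoid st) : A.IsStarQuantumGroupoid st :=
  ⟨h.isQuantumGroupoid, h.isCStarAlgebra.star_star, h.isCStarAlgebra.star_mul, h.comul_star⟩

theorem antipodeInv_eq {L : H →ₗ[ℂ] H} (h₁ : ∀ x, L (S x) = x) (h₂ : ∀ x, S (L x) = x) :
    A.antipodeInv = L :=
  Ring.inverse_unit (M₀ := Module.End ℂ H)
    ⟨A.antipode, L, LinearMap.ext h₂, LinearMap.ext h₁⟩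

namespace IsStarQuantumGroupoid

variable {st : H →ₛₗ[starRingEnd ℂ] H} (hS : A.IsStarQuantumGroupoid st)
include hS

theorem sw_comul_star (h : H) (f : H → H → U) (hl : ∀ b, Lin fun a => f a b)
    (hr : ∀ a, Lin fun b => f a b) :
    sw (Δ (st h)) f = sw (Δ h) fun a b => f (st a) (st b) := by
  rw [hS.comul_star, sw_of_map_star _ _ _ _ hl hr]

theorem star_one : st 𝟙 = 𝟙 := by
  have := hS.star_mul 𝟙 (st 𝟙)
  rw [hS.isQuantumGroupoid.one_mul, hS.star_star, hS.isQuantumGroupoid.one_mul] at this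
  exact this.symm

theorem counit_star (h : H) : ε (st h) = starRingEnd ℂ (ε h) := by
  have hA := hS.isQuantumGroupoid
  have h1 : (sw (Δ h) fun a b => starRingEnd ℂ (ε (st a)) • b) = h := by
    have := hA.sw_counit_left (st h) (fun x => x) (by fun_prop)
    rw [hS.sw_comul_star _ _ (by fun_prop) (by fun_prop)] at this
    have := congrArg st this
    rw [star_sw, hS.star_star] at this
    simpa [hS.star_star] using this
  have h2 : ε h = starRingEnd ℂ (ε (st h)) := by
    conv_lhs => rw [← h1, map_sw]
    conv_rhs => rw [← hA.sw_counit_right h (fun x => x) (by fun_prop), star_sw, map_sw, conj_sw]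
    refine sw_congr fun a b => ?_
    simp [mul_comm]
  rw [h2, Complex.conj_conj]

/-- `h ↦ S(h*)*`, the inverse of the antipode. -/
def starAntipodeStar (st : H →ₛₗ[starRingEnd ℂ] H) (A : QGData H) : H →ₗ[ℂ] H :=
  st ∘ₛₗ (A.antipode ∘ₛₗ st)

/-- The adjoint of `h₁ S(h₂) = ε(1₁ h) 1₂`. -/
theorem sw_starAntipodeStar_mul (h : H) :
    (sw (Δ h) fun a b => st (S (st b)) ⬝ a) = sw (Δ 𝟙) fun a b => ε (h ⬝ a) • b := by
  have hA := hS.isQuantumGroupoid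
  have := congrArg st ((epsT_eq (A := A) (st h)).symm.trans (hA.epsT_eq' (st h)))
  rw [hS.sw_comul_star _ _ (by fun_prop) (by fun_prop), ← hS.star_one,
    hS.sw_comul_star _ _ (by fun_prop) (by fun_prop), star_sw, star_sw] at this
  simpa [hS.star_mul, hS.star_star, ← hS.counit_star] using this

/-- The map `S' : h ↦ S(h*)*` is a right inverse of `S`: the sum `h₁ S(h₂) S(S'(h₃))` is
`ε_t(h₁) S(S'(h₂)) = S(S'(h))` when bracketed to the left, and `h₁ S(S'(h₃) h₂) = h` when
bracketed to the right. -/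
theorem antipode_star_antipode_star (h : H) : S (st (S (st h))) = h := by
  have hA := hS.isQuantumGroupoid
  set L : H →ₗ[ℂ] H := starAntipodeStar st A with hL
  have hL' (x : H) : st (S (st x)) = L x := rfl
  have hmul (x y : H) : S (L (x ⬝ y)) = S (L x) ⬝ S (L y) := by
    simp [hL, starAntipodeStar, hS.star_mul, hA.antipode_mul]
  have hLmul := hS.sw_starAntipodeStar_mul
  simp only [hL'] at hLmul ⊢
  have key := hA.sw_assoc h (fun a b c => a ⬝ S b ⬝ S (L c)) (by fun_prop) (by fun_prop)
    (by fun_prop)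
  have h1 : (sw (Δ h) fun a b => sw (Δ a) fun c d => c ⬝ S d ⬝ S (L b)) = S (L h) := by
    calc _ = sw (Δ h) fun a b => A.epsT a ⬝ S (L b) := by
          refine sw_congr fun a b => ?_
          rw [epsT_eq, map_sw, sw_apply]
      _ = S (sw (Δ 𝟙) fun a b => L b ⬝ a) ⬝ S (L h) := by
          rw [hA.sw_epsT_left h (fun a b => a ⬝ S (L b)), map_sw, map_sw, sw_apply]
          refine sw_congr fun a b => ?_
          rw [hmul, hA.antipode_mul, hA.mul_assoc]
      _ = _ := by
          rw [hLmul]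
          simp only [hA.one_mul]
          rw [hA.sw_counit_left 𝟙 (fun x => x) (by fun_prop), hA.antipode_one, hA.one_mul]
  have h2 : (sw (Δ h) fun a b => sw (Δ b) fun c d => a ⬝ S c ⬝ S (L d)) = h := by
    calc _ = sw (Δ h) fun a b => sw (Δ 𝟙) fun p q => ε (b ⬝ p) • (a ⬝ S q) := by
          refine sw_congr fun a b => ?_
          simp only [hA.mul_assoc, ← hA.antipode_mul]
          rw [← map_sw, ← map_sw, hLmul]
          simp [map_sw]
      _ = sw (Δ 𝟙) fun p q => (h ⬝ p) ⬝ S q := by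
          rw [sw_sw_comm]
          refine hA.sw_one_congr fun p hp q _ => ?_
          exact hA.sw_counit_source_right hp h (fun a => a ⬝ S q) (by fun_prop)
      _ = h := by
          simp only [hA.mul_assoc]
          rw [← map_sw, hA.one_mul_antipode, hA.mul_one]
  exact (h1.symm.trans key).trans h2

theorem antipode_star_antipode (h : H) : S (st (S h)) = st h := by
  have := hS.antipode_star_antipode_star (st h)
  rwa [hS.star_star] at this

theorem antipodeInv_apply (h : H) : Si h = st (S (st h)) := by
  have : A.antipodeInv = starAntipodeStar st A := antipodeInv_eq
    (fun x => show st (S (st (S x))) = x by rw [hS.antipode_star_antipode, hS.star_star])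
    hS.antipode_star_antipode_star
  rw [this]; rfl

theorem antipode_antipodeInv (h : H) : S (Si h) = h := by
  rw [hS.antipodeInv_apply, hS.antipode_star_antipode_star]

theorem antipodeInv_antipode (h : H) : Si (S h) = h := by
  rw [hS.antipodeInv_apply, hS.antipode_star_antipode, hS.star_star]

theorem antipode_bijective : Function.Bijective S :=
  Function.bijective_iff_has_inverse.2 ⟨Si, hS.antipodeInv_antipode, hS.antipode_antipodeInv⟩

theorem antipodeInv_star (h : H) : Si (st h) = st (S h) := by
  rw [hS.antipodeInv_apply, hS.star_star]

theorem antipodeInv_mul (x y : H) : Si (x ⬝ y) = Si y ⬝ Si x := by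
  apply hS.antipode_bijective.1
  rw [hS.isQuantumGroupoid.antipode_mul]
  simp only [hS.antipode_antipodeInv]

theorem antipodeInv_one : Si 𝟙 = 𝟙 := by
  rw [← hS.isQuantumGroupoid.antipode_one, hS.antipodeInv_antipode,
    hS.isQuantumGroupoid.antipode_one]

theorem counit_antipodeInv (x : H) : ε (Si x) = ε x := by
  rw [← hS.isQuantumGroupoid.counit_antipode, hS.antipode_antipodeInv]

theorem sw_comul_antipodeInv (h : H) (f : H → H → U) (hl : ∀ b, Lin fun a => f a b)
    (hr : ∀ a, Lin fun b => f a b) :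
    sw (Δ (Si h)) f = sw (Δ h) fun a b => f (Si b) (Si a) := by
  conv_rhs => rw [← hS.antipode_antipodeInv h]
  rw [hS.isQuantumGroupoid.sw_comul_antipode _ _ (by fun_prop) (by fun_prop)]
  simp only [hS.antipodeInv_antipode]

/-- The target subalgebra consists of the `z` with `Δ(z) = 1₁ z ⊗ 1₂`; applying the involution to
`Δ(z) = z 1₁ ⊗ 1₂` shows that `z*` has this property. -/
theorem star_target_mem {z : H} (hz : z ∈ A.targetSub) : st z ∈ A.targetSub := by
  have hA := hS.isQuantumGroupoid
  refine ⟨st z, ?_⟩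
  have h1 : Δ (st z) = sw (Δ 𝟙) fun a b => (a ⬝ st z) ⊗ₜ[ℂ] b := by
    have hz' := hA.sw_comul_target hz (fun a b => a ⊗ₜ[ℂ] b) (by fun_prop) (by fun_prop)
    rw [hS.comul_star, ← sw_self (Δ z), hz', star_sw]
    simp only [TensorProduct.map_tmul, hS.star_mul]
    rw [← hS.sw_comul_star 𝟙 (fun a b => (a ⬝ st z) ⊗ₜ[ℂ] b) (by fun_prop) (by fun_prop),
      hS.star_one]
  have h2 := hA.sw_counit_left (st z) (fun x => x) (by fun_prop)
  rw [h1, sw_of_sw _ _ _ (by fun_prop) (by fun_prop)] at h2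
  simp (disch := fun_prop) only [sw_of_tmul] at h2
  rwa [← hA.epsT_eq'] at h2

theorem star_source_mem {y : H} (hy : y ∈ A.sourceSub) : st y ∈ A.sourceSub := by
  have hA := hS.isQuantumGroupoid
  refine ⟨st y, ?_⟩
  have h1 : Δ (st y) = sw (Δ 𝟙) fun a b => a ⊗ₜ[ℂ] (st y ⬝ b) := by
    have hy' := hA.sw_comul_source' hy (fun a b => a ⊗ₜ[ℂ] b) (by fun_prop) (by fun_prop)
    rw [hS.comul_star, ← sw_self (Δ y), hy', star_sw]
    simp only [TensorProduct.map_tmul, hS.star_mul]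
    rw [← hS.sw_comul_star 𝟙 (fun a b => a ⊗ₜ[ℂ] (st y ⬝ b)) (by fun_prop) (by fun_prop),
      hS.star_one]
  have h2 := hA.sw_counit_right (st y) (fun x => x) (by fun_prop)
  rw [h1, sw_of_sw _ _ _ (by fun_prop) (by fun_prop)] at h2
  simp (disch := fun_prop) only [sw_of_tmul] at h2
  rwa [← hA.epsS_eq'] at h2

theorem antipodeInv_target_mem {z : H} (hz : z ∈ A.targetSub) : Si z ∈ A.sourceSub := by
  rw [hS.antipodeInv_apply]
  exact hS.star_source_mem (hS.isQuantumGroupoid.antipode_target_mem (hS.star_target_mem hz))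

/-- `S⁻¹(h₂) h₁ = ε(h 1₁) 1₂`. -/
theorem sw_antipodeInv_mul (h : H) :
    (sw (Δ h) fun a b => Si b ⬝ a) = sw (Δ 𝟙) fun a b => ε (h ⬝ a) • b := by
  simp only [hS.antipodeInv_apply, hS.sw_starAntipodeStar_mul]

/-- `S⁻¹(h₂) h₁ = S⁻¹(ε_s(h))`. -/
theorem sw_antipodeInv_mul' (h : H) : (sw (Δ h) fun a b => Si b ⬝ a) = Si (A.epsS h) := by
  rw [epsS_eq, map_sw]
  simp only [hS.antipodeInv_mul, hS.antipodeInv_antipode]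

/-- `h₂ S⁻¹(h₁) = S⁻¹(ε_t(h))`. -/
theorem sw_mul_antipodeInv' (h : H) : (sw (Δ h) fun a b => b ⬝ Si a) = Si (A.epsT h) := by
  rw [epsT_eq, map_sw]
  simp only [hS.antipodeInv_mul, hS.antipodeInv_antipode]

/-- `h₂ S⁻¹(h₁) = 1₁ ε(1₂ h)`. -/
theorem sw_mul_antipodeInv (h : H) :
    (sw (Δ h) fun a b => b ⬝ Si a) = sw (Δ 𝟙) fun a b => ε (b ⬝ h) • a := by
  have hA := hS.isQuantumGroupoid
  have h1 : (sw (Δ 𝟙) fun a b => ε (b ⬝ h) • a) = S (sw (Δ 𝟙) fun a b => ε (Si h ⬝ a) • b) := by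
    conv_lhs => rw [← hA.antipode_one, hA.sw_comul_antipode _ _ (by fun_prop) (by fun_prop)]
    rw [map_sw]
    refine sw_congr fun a b => ?_
    rw [map_smul, ← hA.counit_antipode (Si h ⬝ a), hA.antipode_mul, hS.antipode_antipodeInv]
  rw [h1, ← hS.sw_antipodeInv_mul, hS.sw_antipodeInv_mul', hS.sw_mul_antipodeInv',
    hS.antipode_antipodeInv]
  apply hS.antipode_bijective.1
  rw [hS.antipode_antipodeInv, ← hA.epsT_antipode, hS.antipode_antipodeInv]

/-- `S⁻¹(1₂) 1₁ = 1`. -/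
theorem antipodeInv_one_mul : (sw (Δ 𝟙) fun a b => Si b ⬝ a) = 𝟙 := by
  rw [hS.sw_antipodeInv_mul', hS.isQuantumGroupoid.epsS_source
    hS.isQuantumGroupoid.one_mem_source, hS.antipodeInv_one]

/-- `h₁ ⊗ h₂ z = h₁ S⁻¹(z) ⊗ h₂` for `z` in the target subalgebra. -/
theorem sw_mul_target_move {z : H} (hz : z ∈ A.targetSub) (x : H) (f : H → H → U)
    (hl : ∀ b, Lin fun a => f a b := by fun_prop) (hr : ∀ a, Lin fun b => f a b := by fun_prop) :
    (sw (Δ x) fun a b => f a (b ⬝ z)) = sw (Δ x) fun a b => f (a ⬝ Si z) b := by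
  rw [hS.isQuantumGroupoid.sw_source_move (hS.antipodeInv_target_mem hz) x f hl hr]
  simp only [hS.antipode_antipodeInv]

end IsStarQuantumGroupoid

end WeakHopf

noncomputable section Dual

variable {H : Type*} [AddCommGroup H] [Module ℂ H] [FiniteDimensional ℂ H] {A : QGData H}
  {U : Type*} [AddCommMonoid U] [Module ℂ U]

local notation:70 a:70 " ⬝ " b:71 => QGData.mul A a b
local notation:70 a:70 " ⋆ " b:71 => QGData.mul (QGData.dual A) a b
local notation "S" => QGData.antipode A
local notation "Δ" => QGData.comul A
local notation "Δ'" => QGData.comul (QGData.dual A)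
local notation "ε" => QGData.counit A
local notation "𝟙" => QGData.one A

/-! ### The dual quantum groupoid -/

/-- A tensor with a dual space as first factor is determined by evaluating that factor. -/
theorem dual_tmul_ext {t t' : Module.Dual ℂ H ⊗[ℂ] U}
    (h : ∀ x, (sw t fun p u => p x • u) = sw t' fun p u => p x • u) : t = t' := by
  apply (dualTensorHomEquiv ℂ H U).injective
  ext x
  have key (s : Module.Dual ℂ H ⊗[ℂ] U) :
      dualTensorHomEquiv ℂ H U s x = sw s fun p u => p x • u := by
    conv_lhs => rw [← sw_self s, ← LinearEquiv.coe_coe, map_sw, sw_apply]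
    simp
  rw [key, key, h]

theorem dual_tmul_dual_ext {t t' : Module.Dual ℂ H ⊗[ℂ] Module.Dual ℂ H}
    (h : ∀ x y, (sw t fun p q => p x * q y) = sw t' fun p q => p x * q y) : t = t' :=
  dual_tmul_ext fun x => LinearMap.ext fun y => by
    simpa [sw_apply] using h x y

theorem dual_tmul_dual_tmul_dual_ext
    {t t' : Module.Dual ℂ H ⊗[ℂ] (Module.Dual ℂ H ⊗[ℂ] Module.Dual ℂ H)}
    (h : ∀ x y z, (sw t fun p s => sw s fun q r => p x * (q y * r z)) =
      sw t' fun p s => sw s fun q r => p x * (q y * r z)) : t = t' :=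
  dual_tmul_ext fun x => dual_tmul_dual_ext fun y z => by
    have := h x y z
    rw [sw_of_sw _ _ _ (by fun_prop) (by fun_prop), sw_of_sw _ _ _ (by fun_prop) (by fun_prop)]
    simpa (disch := fun_prop) only [sw_of_smul, smul_sw, smul_eq_mul, ← mul_sw] using this

theorem dual_mul_apply (φ ψ : Module.Dual ℂ H) (h : H) :
    (φ ⋆ ψ) h = sw (Δ h) fun a b => φ a * ψ b := by
  change TensorProduct.dualDistrib ℂ H H (φ ⊗ₜ ψ) (Δ h) = _
  conv_lhs => rw [← sw_self (Δ h), map_sw]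
  simp

theorem dual_one : A.dual.one = ε := rfl

theorem dual_counit_apply (φ : Module.Dual ℂ H) : A.dual.counit φ = φ 𝟙 := rfl

theorem dual_antipode_apply (φ : Module.Dual ℂ H) (h : H) : A.dual.antipode φ h = φ (S h) := rfl

/-- The coproduct of `Ĥ` is determined by `⟨x ⊗ y, Δ̂(φ)⟩ = φ(xy)`. -/
theorem sw_dual_comul (φ : Module.Dual ℂ H) (x y : H) :
    (sw (Δ' φ) fun p q => p x * q y) = φ (x ⬝ y) := by
  have h : TensorProduct.dualDistrib ℂ H H (Δ' φ) (x ⊗ₜ y) = φ (x ⬝ y) := by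
    change TensorProduct.dualDistribEquiv ℂ H H
      ((TensorProduct.dualDistribEquiv ℂ H H).symm _) _ = _
    rw [LinearEquiv.apply_symm_apply]
    rfl
  rw [← h]
  conv_rhs => rw [← sw_self (Δ' φ), map_sw, sw_apply]
  simp

theorem sw_dual_comul_smul (φ : Module.Dual ℂ H) (x : H) :
    (sw (Δ' φ) fun p q => p x • q) = φ ∘ₗ A.mul x := by
  ext y
  rw [sw_apply]
  exact sw_dual_comul φ x y

theorem sw_dual_comul_smul' (φ : Module.Dual ℂ H) (y : H) :
    (sw (Δ' φ) fun p q => q y • p) = φ ∘ₗ A.mul.flip y := by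
  ext x
  rw [sw_apply, LinearMap.comp_apply, LinearMap.flip_apply, ← sw_dual_comul]
  exact sw_congr fun a b => by simp [mul_comm]

theorem dual_one_mul (hA : A.IsQuantumGroupoid) (ψ : Module.Dual ℂ H) : A.dual.one ⋆ ψ = ψ := by
  ext h
  rw [dual_mul_apply, dual_one]
  exact hA.sw_counit_left h (fun x => ψ x) (by fun_prop)

theorem dual_mul_one (hA : A.IsQuantumGroupoid) (ψ : Module.Dual ℂ H) : ψ ⋆ A.dual.one = ψ := by
  ext h
  rw [dual_mul_apply, dual_one, ← hA.sw_counit_right h (fun x => ψ x) (by fun_prop)]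
  exact sw_congr fun a b => mul_comm _ _

theorem dual_mul_assoc (hA : A.IsQuantumGroupoid) (φ ψ χ : Module.Dual ℂ H) :
    (φ ⋆ ψ) ⋆ χ = φ ⋆ (ψ ⋆ χ) := by
  ext h
  simp only [dual_mul_apply, sw_mul, mul_sw, mul_assoc]
  exact hA.sw_assoc h (fun a b c => φ a * (ψ b * χ c)) (by fun_prop) (by fun_prop) (by fun_prop)

/-- Evaluated on elements of `H`, each axiom of `Ĥ` becomes an axiom of `H`; the axioms on `Δ(1)`
and those on the counit of a triple product change places. -/
theorem dual_isQuantumGroupoid (hA : A.IsQuantumGroupoid) : A.dual.IsQuantumGroupoid where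
  finite := inferInstance
  mul_assoc := dual_mul_assoc hA
  one_mul := dual_one_mul hA
  mul_one := dual_mul_one hA
  coassoc φ := by
    refine dual_tmul_dual_tmul_dual_ext fun x y z => ?_
    rw [sw_of_assoc _ _ (by fun_prop) (by fun_prop) (by fun_prop),
      sw_of_map _ _ _ _ (by fun_prop) (by fun_prop), sw_of_map _ _ _ _ (by fun_prop) (by fun_prop)]
    simp only [LinearMap.id_apply, ← mul_assoc, ← sw_mul, sw_dual_comul]
    simp only [mul_assoc, ← mul_sw, sw_dual_comul, hA.mul_assoc]
  counit_left φ := by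
    rw [map_eq_sw, ← LinearEquiv.coe_coe, map_sw]
    refine (sw_dual_comul_smul φ 𝟙).trans ?_
    ext x; simp [hA.one_mul]
  counit_right φ := by
    rw [map_eq_sw, ← LinearEquiv.coe_coe, map_sw]
    refine (sw_dual_comul_smul' φ 𝟙).trans ?_
    ext x; simp [hA.mul_one]
  comul_mul φ ψ := by
    refine dual_tmul_dual_ext fun x y => ?_
    rw [sw_dual_comul, dual_mul_apply, hA.sw_comul_mul _ _ _ (by fun_prop) (by fun_prop), mulTwo,
      sw_of_map₂ _ _ _ _ _ (by fun_prop) (by fun_prop)]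
    simp only [dual_mul_apply, sw_mul, mul_sw]
    rw [sw_sw_comm_sw_sw, sw_sw_comm (Δ y) (Δ x)]
    refine sw_congr fun a b => ?_
    refine sw_congr fun c d => ?_
    simp only [← sw_dual_comul, sw_mul, mul_sw]
    rw [sw_sw_comm]
    refine sw_congr fun p q => ?_
    refine sw_congr fun r s => ?_
    ring
  comul_one_left := by
    refine dual_tmul_dual_tmul_dual_ext fun x y z => ?_
    rw [sw_of_assoc _ _ (by fun_prop) (by fun_prop) (by fun_prop),
      sw_of_map _ _ _ _ (by fun_prop) (by fun_prop), mulThree_assoc_tmul]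
    simp (disch := fun_prop) only [sw_of_sw, sw_of_tmul, dual_one_mul hA, dual_mul_one hA]
    simp only [LinearMap.id_apply, ← mul_assoc, ← sw_mul, sw_dual_comul, dual_one]
    simp only [dual_mul_apply, mul_sw, sw_mul]
    rw [← hA.sw_counit_mul_left]
    simp only [← sw_dual_comul ε, mul_sw, sw_mul]
    rw [sw_sw_sw_comm]
    refine sw_congr fun a b => ?_
    rw [sw_sw_comm]
    refine sw_congr fun p q => ?_
    refine sw_congr fun r s => ?_
    ring
  comul_one_right := by
    refine dual_tmul_dual_tmul_dual_ext fun x y z => ?_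
    rw [sw_of_assoc _ _ (by fun_prop) (by fun_prop) (by fun_prop),
      sw_of_map _ _ _ _ (by fun_prop) (by fun_prop), mulThree_tmul_assoc]
    simp (disch := fun_prop) only [sw_of_sw, sw_of_tmul, dual_one_mul hA, dual_mul_one hA]
    simp only [LinearMap.id_apply, ← mul_assoc, ← sw_mul, sw_dual_comul, dual_one]
    simp only [dual_mul_apply, mul_sw, sw_mul]
    rw [← hA.sw_counit_mul_right]
    simp only [← sw_dual_comul ε, mul_sw, sw_mul]
    conv_rhs => enter [2, p, q]; rw [sw_sw_comm]
    rw [sw_sw_comm (Δ' ε) (Δ y)]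
    refine sw_congr fun a b => ?_
    rw [sw_sw_comm]
    refine sw_congr fun p q => ?_
    refine sw_congr fun r s => ?_
    ring
  counit_mul_left φ ψ χ := by
    rw [map_eq_sw, equiv_sw, dual_mul_assoc hA, dual_counit_apply]
    change _ = sw (Δ' ψ) fun p q => (φ ⋆ p) 𝟙 * (q ⋆ χ) 𝟙
    simp only [dual_mul_apply, mul_sw, sw_mul]
    rw [hA.sw_one_left (fun a b c => φ a * (ψ b * χ c)) (by fun_prop) (by fun_prop) (by fun_prop)]
    simp only [← sw_dual_comul, mul_sw, sw_mul]
    conv_rhs => enter [2, p, q]; rw [sw_sw_comm]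
    rw [sw_sw_comm (Δ' ψ) (Δ 𝟙)]
    refine sw_congr fun a b => ?_
    rw [sw_sw_comm (Δ' ψ) (Δ 𝟙)]
    refine sw_congr fun p q => ?_
    refine sw_congr fun r s => ?_
    ring
  counit_mul_right φ ψ χ := by
    rw [map_eq_sw, equiv_sw, dual_mul_assoc hA, dual_counit_apply, comulOp, LinearMap.comp_apply,
      LinearEquiv.coe_coe, sw_of_comm _ _ (by fun_prop) (by fun_prop)]
    change _ = sw (Δ' ψ) fun p q => (φ ⋆ q) 𝟙 * (p ⋆ χ) 𝟙
    simp only [dual_mul_apply, mul_sw, sw_mul]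
    rw [hA.sw_one_right (fun a b c => φ a * (ψ b * χ c)) (by fun_prop) (by fun_prop) (by fun_prop)]
    simp only [← sw_dual_comul, mul_sw, sw_mul]
    conv_rhs => enter [2, p, q]; rw [sw_sw_comm]
    rw [sw_sw_comm (Δ' ψ) (Δ 𝟙)]
    refine sw_congr fun a b => ?_
    rw [sw_sw_comm (Δ' ψ) (Δ 𝟙)]
    refine sw_congr fun p q => ?_
    refine sw_congr fun r s => ?_
    ring
  antipode_mul φ ψ := by
    ext h
    simp only [dual_antipode_apply, dual_mul_apply]
    rw [hA.sw_comul_antipode _ _ (by fun_prop) (by fun_prop)]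
    simp only [mul_comm]
  antipode_one := LinearMap.ext fun h => hA.counit_antipode h
  comul_antipode φ := by
    refine dual_tmul_dual_ext fun x y => ?_
    rw [sw_dual_comul, dual_antipode_apply, hA.antipode_mul,
      sw_of_map _ _ _ _ (by fun_prop) (by fun_prop), comulOp, LinearMap.comp_apply,
      LinearEquiv.coe_coe, sw_of_comm _ _ (by fun_prop) (by fun_prop), ← sw_dual_comul]
    simp only [dual_antipode_apply, mul_comm]
  counit_antipode φ := by
    rw [dual_counit_apply, dual_antipode_apply, hA.antipode_one, dual_counit_apply]
  antipode_target φ := by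
    rw [map_eq_sw, map_sw, map_eq_sw, equiv_sw, mulTwo,
      sw_of_map₂ _ _ _ _ _ (by fun_prop) (by fun_prop)]
    ext x
    simp only [TensorProduct.lift.tmul, TensorProduct.lid_tmul, LinearMap.id_apply]
    simp (disch := fun_prop) only [sw_of_tmul]
    simp only [sw_apply, LinearMap.smul_apply, dual_mul_one hA, dual_counit_apply, dual_mul_apply,
      dual_antipode_apply, smul_eq_mul, sw_mul]
    rw [sw_sw_comm, sw_sw_comm (Δ' A.dual.one)]
    simp only [sw_dual_comul]
    rw [← map_sw φ, ← epsT_eq, hA.epsT_eq', map_sw]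
    refine sw_congr fun a b => ?_
    rw [map_smul, dual_one, ← sw_dual_comul, smul_eq_mul, sw_mul]
    refine sw_congr fun r s => ?_
    ring
  antipode_source φ := by
    rw [map_eq_sw, map_sw, map_eq_sw, equiv_sw, mulTwo, map₂_eq_sw,
      sw_of_tmul _ _ _ (by fun_prop) (by fun_prop), sw_of_sw _ _ _ (by fun_prop) (by fun_prop)]
    ext x
    simp only [TensorProduct.lift.tmul, TensorProduct.rid_tmul, LinearMap.id_apply]
    simp (disch := fun_prop) only [sw_of_tmul]
    simp only [sw_apply, LinearMap.smul_apply, dual_one_mul hA, dual_counit_apply, dual_mul_apply,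
      dual_antipode_apply, smul_eq_mul, sw_mul]
    rw [sw_sw_comm, sw_sw_comm (Δ' A.dual.one)]
    simp only [sw_dual_comul]
    rw [← map_sw φ, ← epsS_eq, hA.epsS_eq', map_sw]
    refine sw_congr fun a b => ?_
    rw [map_smul, dual_one, ← sw_dual_comul, smul_eq_mul, sw_mul]
    refine sw_congr fun r s => ?_
    ring

theorem dualStar_apply (st : H →ₛₗ[starRingEnd ℂ] H) (φ : Module.Dual ℂ H) (h : H) :
    A.dualStar st φ h = starRingEnd ℂ (φ (st (S h))) := rfl

theorem dual_isStar {st : H →ₛₗ[starRingEnd ℂ] H} (hS : A.IsStarQuantumGroupoid st) :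
    A.dual.IsStarQuantumGroupoid (A.dualStar st) where
  isQuantumGroupoid := dual_isQuantumGroupoid hS.isQuantumGroupoid
  star_star φ := by
    ext h
    simp [dualStar_apply, hS.antipode_star_antipode, hS.star_star]
  star_mul φ ψ := by
    ext h
    simp only [dualStar_apply, dual_mul_apply]
    -- `Δ(S h) = S h₂ ⊗ S h₁`, tested on functionals composed with `S⁻¹`
    have h1 := hS.isQuantumGroupoid.sw_comul_antipode h
      (fun a b => A.dualStar st φ (A.antipodeInv a) * A.dualStar st ψ (A.antipodeInv b))
      (by fun_prop) (by fun_prop)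
    simp only [hS.antipodeInv_antipode, dualStar_apply, hS.antipode_antipodeInv] at h1
    rw [hS.sw_comul_star _ _ (by fun_prop) (by fun_prop), conj_sw]
    simp only [map_mul, h1]
    exact sw_congr fun a b => mul_comm _ _
  comul_star φ := by
    refine dual_tmul_dual_ext fun x y => ?_
    rw [sw_dual_comul, sw_of_map_star _ _ _ _ (by fun_prop) (by fun_prop)]
    simp only [dualStar_apply, ← map_mul, ← conj_sw, sw_dual_comul]
    rw [hS.isQuantumGroupoid.antipode_mul, hS.star_mul]

end Dual

noncomputable section RegularTrace

/-! ### The regular trace of a finite-dimensional `C*`-algebra -/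

variable {V : Type*} [AddCommGroup V] [Module ℂ V] {mul : V →ₗ[ℂ] V →ₗ[ℂ] V} {one : V}
  {st : V →ₛₗ[starRingEnd ℂ] V}

/-- The trace of the left regular representation. -/
def regTrace (mul : V →ₗ[ℂ] V →ₗ[ℂ] V) : V →ₗ[ℂ] ℂ := LinearMap.trace ℂ V ∘ₗ mul

local notation:70 a:70 " ⬝ " b:71 => mul a b
local notation "τ" => regTrace mul

theorem exists_eigenvector_of_mem_roots [FiniteDimensional ℂ V] (f : Module.End ℂ V) {μ : ℂ}
    (hμ : μ ∈ f.charpoly.roots) : ∃ v, v ≠ 0 ∧ f v = μ • v := by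
  have : f.HasEigenvalue μ := by
    rw [Module.End.hasEigenvalue_iff_isRoot_charpoly]
    exact (Polynomial.mem_roots'.1 hμ).2
  obtain ⟨v, hv⟩ := this.exists_hasEigenvector
  exact ⟨v, hv.2, hv.apply_eq_smul⟩

theorem trace_eq_sum_roots [FiniteDimensional ℂ V] (f : Module.End ℂ V) :
    LinearMap.trace ℂ V f = f.charpoly.roots.sum :=
  Module.End.trace_eq_sum_roots_charpoly_of_splits (IsAlgClosed.splits _)

namespace IsFinDimCStarAlgebra

variable (hV : IsFinDimCStarAlgebra mul one st)
include hV

theorem star_one : st one = one := by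
  have := hV.star_mul one (st one)
  rw [hV.one_mul, hV.star_star, hV.one_mul] at this
  exact this.symm

theorem mul_eq_comp (x y : V) : mul (x ⬝ y) = mul x * mul y :=
  LinearMap.ext fun z => hV.mul_assoc x y z

theorem regTrace_mul_comm (x y : V) : τ (x ⬝ y) = τ (y ⬝ x) := by
  simp only [regTrace, LinearMap.comp_apply, hV.mul_eq_comp]
  exact LinearMap.trace_mul_comm ℂ _ _

/-- The eigenvalues of left multiplication by a self-adjoint element are real. -/
theorem conj_eigenvalue {a : V} (ha : st a = a) {μ : ℂ} {v : V} (hv : v ≠ 0) (h : a ⬝ v = μ • v) :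
    starRingEnd ℂ μ = μ := by
  have h1 : st v ⬝ (a ⬝ v) = μ • (st v ⬝ v) := by rw [h, map_smul]
  have h2 := congrArg st h1
  rw [hV.star_mul, hV.star_mul, hV.star_star, ha, hV.mul_assoc, h1, map_smulₛₗ, hV.star_mul,
    hV.star_star] at h2
  by_contra hne
  have h3 : (μ - starRingEnd ℂ μ) • (st v ⬝ v) = 0 := by rw [sub_smul, h2, sub_self]
  rcases smul_eq_zero.1 h3 with h4 | h4
  · exact hne (sub_eq_zero.1 h4).symm
  · exact hv ((hV.star_mul_self_eq_zero_iff v).1 h4)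

theorem conj_regTrace_of_selfAdjoint {a : V} (ha : st a = a) : starRingEnd ℂ (τ a) = τ a := by
  have := hV.finite
  change starRingEnd ℂ (LinearMap.trace ℂ V (mul a)) = LinearMap.trace ℂ V (mul a)
  rw [trace_eq_sum_roots, map_multiset_sum]
  congr 1
  conv_rhs => rw [← Multiset.map_id (Polynomial.roots _)]
  refine Multiset.map_congr rfl fun μ hμ => ?_
  obtain ⟨v, hv, h⟩ := exists_eigenvector_of_mem_roots _ hμ
  exact hV.conj_eigenvalue ha hv h

/-- A nilpotent self-adjoint element vanishes: `b² = b* b = 0` forces `b = 0`, which halves the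
exponent. -/
theorem eq_zero_of_pow_eq_zero {a : V} (ha : st a = a) {n : ℕ} (h : mul a ^ n = 0) : a = 0 := by
  have key : ∀ k (b : V), st b = b → mul b ^ 2 ^ k = 0 → b = 0 := by
    intro k
    induction k with
    | zero =>
      intro b _ h
      rw [pow_zero, pow_one] at h
      rw [← hV.mul_one b, h, LinearMap.zero_apply]
    | succ k ih =>
      intro b hb h
      have := ih (b ⬝ b) (by rw [hV.star_mul, hb])
        (by rwa [hV.mul_eq_comp, ← pow_two, ← pow_mul, ← pow_succ'])
      refine (hV.star_mul_self_eq_zero_iff b).1 ?_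
      rwa [hb]
  exact key n a ha (pow_eq_zero_of_le n.lt_two_pow_self.le h)

/-- The trace of `a²` is the sum of the squares of the real eigenvalues of `a`. -/
theorem regTrace_sq_of_selfAdjoint {a : V} (ha : st a = a) (h0 : a ≠ 0) : 0 < (τ (a ⬝ a)).re := by
  have := hV.finite
  have hpos : ∀ ν ∈ (mul (a ⬝ a)).charpoly.roots, ∃ r : ℝ, 0 ≤ r ∧ (r : ℂ) = ν := by
    intro ν hν
    obtain ⟨v, hv, h⟩ := exists_eigenvector_of_mem_roots _ hν
    obtain ⟨s, hs⟩ := IsAlgClosed.exists_pow_nat_eq ν (n := 2) two_pos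
    rw [hV.mul_assoc] at h
    -- `a² - s² = (a + s)(a - s)`, so one of `s`, `-s` is an eigenvalue of `a`
    have hreal : starRingEnd ℂ s = s := by
      by_cases h0 : a ⬝ v = s • v
      · exact hV.conj_eigenvalue ha hv h0
      · have h1 : a ⬝ (a ⬝ v - s • v) = (-s) • (a ⬝ v - s • v) := by
          rw [map_sub, map_smul, h, ← hs]
          module
        have := hV.conj_eigenvalue ha (sub_ne_zero.2 h0) h1
        simpa using this
    obtain ⟨r, rfl⟩ := Complex.conj_eq_iff_real.1 hreal
    exact ⟨r ^ 2, sq_nonneg r, by rw [← hs]; push_cast; rfl⟩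
  choose! r hr hrν using hpos
  have htr : τ (a ⬝ a) = (((mul (a ⬝ a)).charpoly.roots.map r).sum : ℝ) := by
    change LinearMap.trace ℂ V (mul (a ⬝ a)) = _
    rw [trace_eq_sum_roots, ← Complex.ofRealHom_eq_coe, map_multiset_sum, Multiset.map_map]
    congr 1
    conv_lhs => rw [← Multiset.map_id (Polynomial.roots _)]
    exact Multiset.map_congr rfl fun μ hμ => (hrν μ hμ).symm
  rw [htr, Complex.ofReal_re]
  refine lt_of_le_of_ne (Multiset.sum_nonneg fun x hx => ?_) fun h => h0 ?_
  · obtain ⟨ν, hν, rfl⟩ := Multiset.mem_map.1 hx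
    exact hr ν hν
  -- if the trace vanishes, then so do all eigenvalues, and `a` is nilpotent
  have hz : ∀ ν ∈ (mul (a ⬝ a)).charpoly.roots, ν = 0 := by
    intro ν hν
    have := Multiset.all_zero_of_le_zero_le_of_sum_eq_zero
      (s := (mul (a ⬝ a)).charpoly.roots.map r) (fun x hx => by
        obtain ⟨ν, hν, rfl⟩ := Multiset.mem_map.1 hx
        exact hr ν hν) h.symm _ (Multiset.mem_map_of_mem r hν)
    rw [← hrν ν hν, this, Complex.ofReal_zero]
  have hX : (mul (a ⬝ a)).charpoly = Polynomial.X ^ Module.finrank ℂ V := by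
    rw [(IsAlgClosed.splits (mul (a ⬝ a)).charpoly).eq_prod_roots_of_monic
      (LinearMap.charpoly_monic _), Multiset.eq_replicate_card.2 hz, Multiset.map_replicate,
      Multiset.prod_replicate,
      ← (IsAlgClosed.splits (mul (a ⬝ a)).charpoly).natDegree_eq_card_roots,
      LinearMap.charpoly_natDegree]
    simp
  obtain ⟨n, hn⟩ := (LinearMap.isNilpotent_iff_charpoly _).2 hX
  exact hV.eq_zero_of_pow_eq_zero ha (n := 2 * n) (by rwa [pow_mul, pow_two, ← hV.mul_eq_comp])

theorem conj_regTrace (x : V) : starRingEnd ℂ (τ x) = τ (st x) := by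
  have h1 := hV.conj_regTrace_of_selfAdjoint (a := x + st x) (by
    rw [map_add, hV.star_star, add_comm])
  have h2 := hV.conj_regTrace_of_selfAdjoint (a := Complex.I • (x - st x)) (by
    rw [map_smulₛₗ, map_sub, hV.star_star, Complex.conj_I, neg_smul, ← smul_neg, neg_sub])
  simp only [map_add, map_smul, map_sub, smul_eq_mul, map_mul, Complex.conj_I] at h1 h2
  have h3 := mul_left_cancel₀ Complex.I_ne_zero ((by linear_combination h2 :
    Complex.I * (starRingEnd ℂ (τ (st x)) - starRingEnd ℂ (τ x)) =
      Complex.I * (τ x - τ (st x))))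
  linear_combination (h1 - h3) / 2

/-- If `x = a + i b` with `a`, `b` self-adjoint, then `τ(x* x) = τ(a²) + τ(b²)`. -/
theorem regTrace_star_mul_self_pos {x : V} (hx : x ≠ 0) : 0 < (τ (st x ⬝ x)).re := by
  obtain ⟨a, ha⟩ : ∃ a, a = (2⁻¹ : ℂ) • (x + st x) := ⟨_, rfl⟩
  obtain ⟨b, hb⟩ : ∃ b, b = (2⁻¹ : ℂ) • (Complex.I • (st x - x)) := ⟨_, rfl⟩
  have sa : st a = a := by
    rw [ha, map_smulₛₗ, map_add, hV.star_star, add_comm, map_inv₀, Complex.conj_ofNat]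
  have sb : st b = b := by
    rw [hb, map_smulₛₗ, map_smulₛₗ, map_sub, hV.star_star, Complex.conj_I, neg_smul, ← smul_neg,
      neg_sub, map_inv₀, Complex.conj_ofNat]
  have hxab : x = a + Complex.I • b := by
    rw [ha, hb]
    simp only [smul_add, smul_sub, smul_smul]
    have : Complex.I * (2⁻¹ * Complex.I) = -2⁻¹ := by
      linear_combination 2⁻¹ * Complex.I_mul_I
    rw [this]
    module
  have hsx : st x = a - Complex.I • b := by
    rw [hxab, map_add, map_smulₛₗ, sa, sb, Complex.conj_I, neg_smul, sub_eq_add_neg]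
  have key : τ (st x ⬝ x) = τ (a ⬝ a) + τ (b ⬝ b) := by
    rw [hsx, hxab]
    simp only [map_add, map_sub, LinearMap.sub_apply, map_smul, LinearMap.smul_apply, smul_eq_mul]
    rw [hV.regTrace_mul_comm b a]
    linear_combination (-(τ (b ⬝ b))) * Complex.I_mul_I
  have hnn {c : V} (hc : st c = c) : 0 ≤ (τ (c ⬝ c)).re := by
    by_cases h : c = 0
    · simp [h]
    · exact (hV.regTrace_sq_of_selfAdjoint hc h).le
  rw [key, Complex.add_re]
  by_cases h : a = 0
  · have hb0 : b ≠ 0 := fun hb0 => hx (by rw [hxab, h, hb0]; simp)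
    exact add_pos_of_nonneg_of_pos (hnn sa) (hV.regTrace_sq_of_selfAdjoint sb hb0)
  · exact add_pos_of_pos_of_nonneg (hV.regTrace_sq_of_selfAdjoint sa h) (hnn sb)

/-- The inner product `⟨x, y⟩ = τ(x* y)`. -/
abbrev innerCore : InnerProductSpace.Core ℂ V where
  inner x y := τ (st x ⬝ y)
  conj_inner_symm x y := by rw [hV.conj_regTrace, hV.star_mul, hV.star_star]
  re_inner_nonneg x := by
    by_cases h : x = 0
    · simp [h]
    · exact (hV.regTrace_star_mul_self_pos h).le
  add_left x y z := by simp
  smul_left x y r := by simp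
  definite x h := by
    by_contra hx
    have := hV.regTrace_star_mul_self_pos hx
    rw [h] at this
    simp at this

/-- An orthonormal basis for the inner product `τ(x* y)`. -/
theorem exists_basis : ∃ (n : ℕ) (b : Fin n → V),
    (∀ i j, τ (st (b i) ⬝ b j) = if i = j then 1 else 0) ∧
      ∀ x, ∑ i, τ (st (b i) ⬝ x) • b i = x := by
  have := hV.finite
  let : NormedAddCommGroup V :=
    @InnerProductSpace.Core.toNormedAddCommGroup ℂ V _ _ _ hV.innerCore
  let : InnerProductSpace ℂ V := InnerProductSpace.ofCore hV.innerCore.toCore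
  let b := stdOrthonormalBasis ℂ V
  exact ⟨_, b, fun i j => orthonormal_iff_ite.1 b.orthonormal i j, fun x => b.sum_repr' x⟩

theorem exists_orthogonal_decomposition (K : Submodule ℂ V) (x : V) :
    ∃ k ∈ K, ∃ p, (∀ u ∈ K, τ (st u ⬝ p) = 0) ∧ x = k + p := by
  have := hV.finite
  let : NormedAddCommGroup V :=
    @InnerProductSpace.Core.toNormedAddCommGroup ℂ V _ _ _ hV.innerCore
  let : InnerProductSpace ℂ V := InnerProductSpace.ofCore hV.innerCore.toCore
  obtain ⟨k, hk, p, hp, h⟩ := K.exists_add_mem_mem_orthogonal x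
  exact ⟨k, hk, p, fun u hu => hp u hu, h⟩

end IsFinDimCStarAlgebra

end RegularTrace

noncomputable section HaarProjection

/-! ### Tensor products of `C*`-algebras -/

/-- If `x = ∑ bᵢ ⊗ wᵢ` for an orthonormal basis `b` of the first factor, then
`(τ ⊗ τ)(x* x) = ∑ τ(wᵢ* wᵢ)`, so `x* x = 0` forces every `wᵢ` to vanish. -/
theorem IsFinDimCStarAlgebra.tmul {V W : Type*} [AddCommGroup V] [Module ℂ V] [AddCommGroup W]
    [Module ℂ W] {mul : V →ₗ[ℂ] V →ₗ[ℂ] V} {one : V} {st : V →ₛₗ[starRingEnd ℂ] V}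
    {mul' : W →ₗ[ℂ] W →ₗ[ℂ] W} {one' : W} {st' : W →ₛₗ[starRingEnd ℂ] W}
    (hV : IsFinDimCStarAlgebra mul one st) (hW : IsFinDimCStarAlgebra mul' one' st') :
    IsFinDimCStarAlgebra (TensorProduct.map₂ mul mul') (one ⊗ₜ[ℂ] one')
      (TensorProduct.map st st') where
  finite := by
    have := hV.finite
    have := hW.finite
    infer_instance
  mul_assoc x y z := by
    rw [← sw_self x, ← sw_self y, ← sw_self z]
    simp only [map_sw, sw_apply, TensorProduct.map₂_apply_tmul, TensorProduct.map_tmul,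
      hV.mul_assoc, hW.mul_assoc]
  one_mul x := by
    conv_lhs => rw [← sw_self x]
    rw [map_sw]
    conv_rhs => rw [← sw_self x]
    simp only [TensorProduct.map₂_apply_tmul, TensorProduct.map_tmul, hV.one_mul, hW.one_mul]
  mul_one x := by
    conv_lhs => rw [← sw_self x]
    rw [map_sw, sw_apply]
    conv_rhs => rw [← sw_self x]
    simp only [TensorProduct.map₂_apply_tmul, TensorProduct.map_tmul, hV.mul_one, hW.mul_one]
  star_star x := by
    conv_lhs => rw [← sw_self x]
    rw [star_sw, star_sw]
    conv_rhs => rw [← sw_self x]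
    simp only [TensorProduct.map_tmul, hV.star_star, hW.star_star]
  star_mul x y := by
    rw [← sw_self x, ← sw_self y]
    simp only [map_sw, star_sw, sw_apply, TensorProduct.map₂_apply_tmul, TensorProduct.map_tmul,
      hV.star_mul, hW.star_mul]
    rw [sw_sw_comm]
  star_mul_self_eq_zero_iff x := by
    refine ⟨fun h => ?_, fun h => by rw [h]; simp⟩
    obtain ⟨n, b, hb, hsum⟩ := hV.exists_basis
    obtain ⟨w, hw⟩ : ∃ w : Fin n → W, x = ∑ i, b i ⊗ₜ[ℂ] w i := by
      refine ⟨fun i => sw x fun p q => regTrace mul (mul (st (b i)) p) • q, ?_⟩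
      conv_lhs => rw [← sw_self x]
      simp only [tmul_sw]
      unfold sw
      rw [Finset.sum_comm]
      refine Finset.sum_congr rfl fun p _ => ?_
      change p.1 ⊗ₜ[ℂ] p.2 = ∑ i, b i ⊗ₜ[ℂ] (regTrace mul (mul (st (b i)) p.1) • p.2)
      conv_lhs => rw [← hsum p.1]
      rw [TensorProduct.sum_tmul]
      exact Finset.sum_congr rfl fun i _ => TensorProduct.smul_tmul _ _ _
    have key : ∑ i, regTrace mul' (mul' (st' (w i)) (w i)) = 0 := by
      have := congrArg ((TensorProduct.lid ℂ ℂ).toLinearMap ∘ₗ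
        TensorProduct.map (regTrace mul) (regTrace mul')) h
      rw [map_zero, hw] at this
      simpa [map_sum, LinearMap.sum_apply, hb] using this
    have hzero (i : Fin n) : w i = 0 := by
      by_contra hi
      have hnn (j : Fin n) : 0 ≤ (regTrace mul' (mul' (st' (w j)) (w j))).re := by
        by_cases hj : w j = 0
        · simp [hj]
        · exact (hW.regTrace_star_mul_self_pos hj).le
      have := congrArg Complex.re key
      rw [Complex.re_sum, Complex.zero_re,
        Finset.sum_eq_zero_iff_of_nonneg fun j _ => hnn j] at this
      exact (hW.regTrace_star_mul_self_pos hi).ne' (this i (Finset.mem_univ i))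
    simp [hw, hzero]

/-! ### The Haar projection and the dual `C*`-quantum groupoid -/

variable {H : Type*} [AddCommGroup H] [Module ℂ H] {A : QGData H} {st : H →ₛₗ[starRingEnd ℂ] H}
  {U : Type*} [AddCommMonoid U] [Module ℂ U]

local notation:70 a:70 " ⬝ " b:71 => QGData.mul A a b
local notation "S" => QGData.antipode A
local notation "Si" => QGData.antipodeInv A
local notation "Δ" => QGData.comul A
local notation "ε" => QGData.counit A
local notation "𝟙" => QGData.one A
local notation "τ" => regTrace (QGData.mul A)

/-- The trace form `τ(xy)` is nondegenerate. -/
theorem IsFinDimCStarAlgebra.eq_zero_of_regTrace {V : Type*} [AddCommGroup V] [Module ℂ V]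
    {mul : V →ₗ[ℂ] V →ₗ[ℂ] V} {one : V} {st : V →ₛₗ[starRingEnd ℂ] V}
    (hV : IsFinDimCStarAlgebra mul one st) {y : V} (h : ∀ x, regTrace mul (mul x y) = 0) :
    y = 0 := by
  by_contra hy
  have := hV.regTrace_star_mul_self_pos hy
  rw [h, Complex.zero_re] at this
  exact this.false

/-- The regular trace is invariant under the algebra automorphism `S²`. -/
theorem IsStarQuantumGroupoid.regTrace_antipode_antipode (hS : A.IsStarQuantumGroupoid st) (x : H) :
    τ (S (S x)) = τ x := by
  let e : H ≃ₗ[ℂ] H := LinearEquiv.ofBijective (S ∘ₗ S)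
    (hS.antipode_bijective.comp hS.antipode_bijective)
  have h : A.mul (S (S x)) = e.conj (A.mul x) := by
    ext y
    obtain ⟨z, rfl⟩ := e.surjective y
    rw [LinearEquiv.conj_apply_apply, LinearEquiv.symm_apply_apply]
    change S (S x) ⬝ S (S z) = S (S (x ⬝ z))
    rw [hS.isQuantumGroupoid.antipode_mul, hS.isQuantumGroupoid.antipode_mul]
  change LinearMap.trace ℂ H (A.mul (S (S x))) = LinearMap.trace ℂ H (A.mul x)
  rw [h, LinearMap.trace_conj']

/-- A left integral that is also a self-adjoint projection, normalised by `ε_t(p) = 1`: the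
component of `1` orthogonal to the left ideal `ker ε_t`. -/
theorem IsCStarQuantumGroupoid.exists_haar (hC : A.IsCStarQuantumGroupoid st) :
    ∃ p, st p = p ∧ A.epsT p = 𝟙 ∧ ∀ h, h ⬝ p = A.epsT h ⬝ p := by
  have hA := hC.isQuantumGroupoid
  have hV := hC.isCStarAlgebra
  obtain ⟨k, hk, p, hp, hkp⟩ := hV.exists_orthogonal_decomposition (LinearMap.ker A.epsT) 𝟙
  have hpu (u : H) (hu : A.epsT u = 0) : p ⬝ st u = 0 := by
    refine hV.eq_zero_of_regTrace fun x => ?_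
    have := hp (st x ⬝ u) (by
      rw [LinearMap.mem_ker, ← hA.epsT_mul_epsT, hu, map_zero, map_zero])
    rwa [hV.star_mul, hV.star_star, hA.mul_assoc, hV.regTrace_mul_comm, hA.mul_assoc] at this
  have hpp : p = p ⬝ st p := by
    conv_lhs => rw [← hA.mul_one p, ← hV.star_one, hkp, map_add, map_add, hpu k hk, zero_add]
  have hps : st p = p := by
    conv_lhs => rw [hpp, hV.star_mul, hV.star_star]
    exact hpp.symm
  refine ⟨p, hps, ?_, fun h => ?_⟩
  · rw [← sub_eq_of_eq_add' hkp, map_sub, hk, sub_zero, hA.epsT_target hA.one_mem_target]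
  · have := congrArg st (hpu (h - A.epsT h) (by
      rw [map_sub, hA.epsT_target (hA.epsT_mem h), sub_self]))
    rw [hV.star_mul, hV.star_star, hps, map_zero, map_sub, LinearMap.sub_apply] at this
    exact sub_eq_zero.1 this

/-- `p₁ ⊗ h p₂ = S(h) p₁ ⊗ p₂` for a left integral `p`. -/
theorem IsQuantumGroupoid.sw_integral (hA : A.IsQuantumGroupoid) {p : H}
    (hp : ∀ h, h ⬝ p = A.epsT h ⬝ p) (h : H) (f : H → H → U)
    (hl : ∀ b, Lin fun a => f a b := by fun_prop) (hr : ∀ a, Lin fun b => f a b := by fun_prop) :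
    (sw (Δ p) fun a b => f a (h ⬝ b)) = sw (Δ p) fun a b => f (S h ⬝ a) b := by
  calc (sw (Δ p) fun a b => f a (h ⬝ b))
      = sw (Δ 𝟙) fun c d => sw (Δ p) fun a b => f (c ⬝ a) (h ⬝ d ⬝ b) := by
        simp only [hA.mul_assoc]
        exact (hA.sw_one_mul p (fun a b => f a (h ⬝ b)) (by fun_prop) (by fun_prop)).symm
    _ = sw (Δ h) fun c d => sw (Δ p) fun a b => f (A.epsS c ⬝ a) (d ⬝ b) :=
        (hA.sw_epsS_left h (fun c d => sw (Δ p) fun a b => f (c ⬝ a) (d ⬝ b))).symm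
    _ = sw (Δ h) fun c d => sw (Δ d) fun d e => sw (Δ p) fun a b => f (S c ⬝ d ⬝ a) (e ⬝ b) := by
        rw [← hA.sw_assoc h (fun c d e => sw (Δ p) fun a b => f (S c ⬝ d ⬝ a) (e ⬝ b))
          (by fun_prop) (by fun_prop) (by fun_prop)]
        refine sw_congr fun c d => ?_
        rw [epsS_eq, (show Lin fun u => sw (Δ p) fun a b => f (u ⬝ a) (d ⬝ b) by
          fun_prop).map_sw]
    _ = sw (Δ h) fun c d => sw (Δ p) fun a b => f (S c ⬝ (A.epsT d ⬝ a)) b := by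
        refine sw_congr fun c d => ?_
        rw [← hA.sw_target_mul (hA.epsT_mem d) p (fun a b => f (S c ⬝ a) b) (by fun_prop)
          (by fun_prop), ← hp d,
          hA.sw_comul_mul _ _ (fun a b => f (S c ⬝ a) b) (by fun_prop) (by fun_prop)]
        simp only [hA.mul_assoc]
    _ = sw (Δ 𝟙) fun c d => sw (Δ p) fun a b => f (S (c ⬝ h) ⬝ (d ⬝ a)) b :=
        hA.sw_epsT_right h (fun c d => sw (Δ p) fun a b => f (S c ⬝ (d ⬝ a)) b)
    _ = _ := by
        simp only [hA.antipode_mul, ← hA.mul_assoc]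
        rw [sw_sw_comm]
        refine sw_congr fun a b => ?_
        conv_rhs => rw [← hA.mul_one (S h), ← hA.antipode_one_mul]
        rw [(show Lin fun u => f (S h ⬝ u ⬝ a) b by fun_prop).map_sw]
        simp only [hA.mul_assoc]

/-- `S(p₁) ⊗ p₂ g = g S(p₁) ⊗ p₂` for a self-adjoint left integral `p`. -/
theorem IsStarQuantumGroupoid.sw_integral_mul (hS : A.IsStarQuantumGroupoid st) {p : H}
    (hp : ∀ h, h ⬝ p = A.epsT h ⬝ p) (hps : st p = p) (g : H) (f : H → H → U)
    (hl : ∀ b, Lin fun a => f a b := by fun_prop) (hr : ∀ a, Lin fun b => f a b := by fun_prop) :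
    (sw (Δ p) fun a b => f (S a) (b ⬝ g)) = sw (Δ p) fun a b => f (g ⬝ S a) b := by
  have hA := hS.isQuantumGroupoid
  -- the adjoint of `sw_integral`, in the form of an identity of tensors
  have h1 : (sw (Δ p) fun a b => a ⊗ₜ[ℂ] (st g ⬝ b)) =
      sw (Δ p) fun a b => (S (st g) ⬝ a) ⊗ₜ[ℂ] b :=
    hA.sw_integral hp (st g) (fun a b => a ⊗ₜ[ℂ] b)
  have h2 := congrArg (fun t => sw (TensorProduct.map st st t) fun a b => f (S a) b) h1
  simp (disch := fun_prop) only [star_sw, sw_of_sw, TensorProduct.map_tmul, sw_of_tmul, hS.star_mul,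
    hS.star_star, ← hS.antipodeInv_apply, hA.antipode_mul, hS.antipode_antipodeInv] at h2
  rw [← hS.sw_comul_star p (fun a b => f (S a) (b ⬝ g)) (by fun_prop) (by fun_prop),
    ← hS.sw_comul_star p (fun a b => f (g ⬝ S a) b) (by fun_prop) (by fun_prop), hps] at h2
  exact h2

variable [FiniteDimensional ℂ H]

/-- The involution of the dual is proper. Let `p` be the Haar projection and `g = τ(S(p₁)) p₂`,
and write `φ = τ(y ·)`. Then `⟨p, φ* φ⟩ = τ(g y* y)`. For an orthonormal basis `b` one has
`∑ bᵢ* g bᵢ = 1`, so this number is the sum of the `τ(g y* bᵢ* g bᵢ y) = τ(v♭ v)` with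
`v = g bᵢ y` and the transported involution `v♭ = S⁻¹(S(v)*)`. All of these are nonnegative, hence
they vanish, and `y = 0`. -/
theorem IsCStarQuantumGroupoid.dual_star_mul_self (hC : A.IsCStarQuantumGroupoid st)
    {φ : Module.Dual ℂ H} (hφ : A.dual.mul (A.dualStar st φ) φ = 0) : φ = 0 := by
  have hA := hC.isQuantumGroupoid
  have hV := hC.isCStarAlgebra
  have hS := hC.isStar
  obtain ⟨p, hps, hpt, hp⟩ := hC.exists_haar
  obtain ⟨n, b, hb, hsum⟩ := hV.exists_basis
  obtain ⟨g, hg⟩ : ∃ g, g = sw (Δ p) fun a c => τ (S a) • c := ⟨_, rfl⟩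
  have htr (x y : H) : τ (x ⬝ y) = τ (y ⬝ x) := hV.regTrace_mul_comm x y
  have hgx (x : H) : (sw (Δ p) fun a c => τ (x ⬝ S a) • c) = g ⬝ x := by
    rw [← hS.sw_integral_mul hp hps x (fun a c => τ a • c), hg, map_sw, sw_apply]
    simp
  have hxg (x : H) : x ⬝ g = g ⬝ S (S x) := by
    have := hA.sw_integral hp x (fun a c => τ (S a) • c)
    rw [← hgx, hg, map_sw]
    simp only [map_smul]
    rw [this]
    simp only [hA.antipode_mul, htr (S (S x))]
  have hgs : st g = g := by
    rw [hg, star_sw]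
    simp only [map_smulₛₗ, hV.conj_regTrace, ← hS.antipodeInv_star]
    rw [← hS.sw_comul_star p (fun a c => τ (Si a) • c) (by fun_prop) (by fun_prop), hps]
    refine sw_congr fun a c => ?_
    rw [← hS.regTrace_antipode_antipode (Si a), hS.antipode_antipodeInv]
  -- the adjoint of `ε_t(p) = 1`
  have hp1 : (sw (Δ p) fun a c => S a ⬝ c) = 𝟙 := by
    have h1 := congrArg st hpt
    rw [hS.star_one, hA.epsT_eq', star_sw] at h1
    simp only [map_smulₛₗ, ← hS.counit_star, hS.star_mul, hps] at h1
    rw [← hS.sw_comul_star 𝟙 (fun a c => ε (p ⬝ a) • c) (by fun_prop) (by fun_prop), hS.star_one,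
      ← hS.sw_antipodeInv_mul] at h1
    have h2 := congrArg S h1
    rw [map_sw, hA.antipode_one] at h2
    simpa only [hA.antipode_mul, hS.antipode_antipodeInv] using h2
  -- expand `S(p₁)` in the orthonormal basis
  have hsg : ∑ i, st (b i) ⬝ (g ⬝ b i) = 𝟙 := by
    rw [← hp1]
    simp only [← hgx, map_sw, map_smul]
    simp only [sw]
    rw [Finset.sum_comm]
    refine Finset.sum_congr rfl fun q _ => ?_
    have := congrArg st (hsum (st (S q.1)))
    rw [map_sum, hS.star_star] at this
    conv_rhs => rw [← this]
    rw [map_sum, LinearMap.sum_apply]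
    refine Finset.sum_congr rfl fun i _ => ?_
    rw [map_smulₛₗ, hV.conj_regTrace, hS.star_mul, hS.star_star, hS.star_star, htr, map_smul,
      LinearMap.smul_apply]
  -- the involution transported along the anti-automorphism `S`
  let sh : H →ₛₗ[starRingEnd ℂ] H := A.antipodeInv.comp (st.comp A.antipode)
  have hsh (x : H) : sh x = Si (st (S x)) := rfl
  have hW : IsFinDimCStarAlgebra A.mul A.one sh :=
    { finite := hV.finite
      mul_assoc := hV.mul_assoc
      one_mul := hV.one_mul
      mul_one := hV.mul_one
      star_star := fun x => by
        rw [hsh, hsh, hS.antipode_antipodeInv, hS.star_star, hS.antipodeInv_antipode]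
      star_mul := fun x y => by
        rw [hsh, hsh, hsh, hA.antipode_mul, hS.star_mul, hS.antipodeInv_mul]
      star_mul_self_eq_zero_iff := fun x => by
        refine ⟨fun h => ?_, fun h => by rw [h, map_zero]⟩
        have h2 := congrArg S h
        rw [hsh, hA.antipode_mul, hS.antipode_antipodeInv, map_zero, ← hS.star_star (S x)] at h2
        rw [hS.star_star (st _)] at h2
        have h3 := (hV.star_mul_self_eq_zero_iff _).1 h2
        rw [← hS.antipodeInv_antipode x, ← hS.star_star (S x), h3, map_zero, map_zero] }
  have hshg (x : H) : sh x ⬝ g = g ⬝ st x := by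
    have := congrArg st (hxg x)
    rw [hS.star_mul, hS.star_mul, hgs] at this
    rw [hsh, hS.antipodeInv_star, this]
  have hgw (w : H) : sh (g ⬝ w) ⬝ (g ⬝ w) = g ⬝ (st w ⬝ (g ⬝ w)) := by
    rw [hW.star_mul, ← hA.mul_assoc, hA.mul_assoc _ _ g, hshg, hgs, ← hA.mul_assoc, hshg]
    simp only [hA.mul_assoc]
  obtain ⟨y, hy⟩ : ∃ y, ∀ x, φ x = τ (y ⬝ x) := by
    refine ⟨∑ i, φ (b i) • st (b i), fun x => ?_⟩
    conv_lhs => rw [← hsum x]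
    simp only [map_sum, map_smul, LinearMap.sum_apply, LinearMap.smul_apply, smul_eq_mul, mul_comm]
  have h0 : τ (g ⬝ (st y ⬝ y)) = 0 := by
    have h1 : _ = (0 : ℂ) := LinearMap.congr_fun hφ p
    rw [dual_mul_apply] at h1
    simp only [dualStar_apply, hy, hV.conj_regTrace, hS.star_mul, hS.star_star] at h1
    rw [← hA.mul_assoc, htr, ← hgx, map_sw, map_sw, ← h1]
    simp only [map_smul, smul_eq_mul, htr (st y)]
  have hpos (x : H) : 0 ≤ (τ (sh x ⬝ x)).re := by
    by_cases hx : x = 0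
    · simp [hx]
    · exact (hW.regTrace_star_mul_self_pos hx).le
  have hsum0 : ∑ i, (τ (sh (g ⬝ (b i ⬝ y)) ⬝ (g ⬝ (b i ⬝ y)))).re = 0 := by
    have h1 : g ⬝ (st y ⬝ y) = ∑ i, sh (g ⬝ (b i ⬝ y)) ⬝ (g ⬝ (b i ⬝ y)) := by
      have h2 : st y ⬝ ((∑ i, st (b i) ⬝ (g ⬝ b i)) ⬝ y) = st y ⬝ y := by rw [hsg, hA.one_mul]
      rw [← h2, map_sum, LinearMap.sum_apply, map_sum, map_sum]
      refine Finset.sum_congr rfl fun i _ => ?_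
      rw [hgw, hS.star_mul]
      simp only [hA.mul_assoc]
    rw [← Complex.re_sum, ← map_sum, ← h1, h0, Complex.zero_re]
  have hzero (i : Fin n) : g ⬝ (b i ⬝ y) = 0 := by
    by_contra hi
    rw [Finset.sum_eq_zero_iff_of_nonneg fun i _ => hpos _] at hsum0
    exact (hW.regTrace_star_mul_self_pos hi).ne' (hsum0 i (Finset.mem_univ i))
  have hy0 : y = 0 := by
    rw [← hA.one_mul y, ← hsg, map_sum, LinearMap.sum_apply]
    exact Finset.sum_eq_zero fun i _ => by rw [hA.mul_assoc, hA.mul_assoc, hzero, map_zero]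
  ext x
  rw [hy, hy0]
  simp

/-- The dual of a `C*`-quantum groupoid is a `C*`-quantum groupoid. -/
theorem dual_isCStar (hC : A.IsCStarQuantumGroupoid st) :
    A.dual.IsCStarQuantumGroupoid (A.dualStar st) where
  isQuantumGroupoid := dual_isQuantumGroupoid hC.isQuantumGroupoid
  isCStarAlgebra :=
    { finite := inferInstance
      mul_assoc := dual_mul_assoc hC.isQuantumGroupoid
      one_mul := dual_one_mul hC.isQuantumGroupoid
      mul_one := dual_mul_one hC.isQuantumGroupoid
      star_star := (dual_isStar hC.isStar).star_star
      star_mul := (dual_isStar hC.isStar).star_mul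
      star_mul_self_eq_zero_iff := fun φ =>
        ⟨hC.dual_star_mul_self, fun h => by rw [h, map_zero]⟩ }
  comul_star := (dual_isStar hC.isStar).comul_star

end HaarProjection

noncomputable section Translates

variable {H : Type*} [AddCommGroup H] [Module ℂ H] {A : QGData H}
  {U : Type*} [AddCommMonoid U] [Module ℂ U]

local notation:70 a:70 " ⬝ " b:71 => QGData.mul A a b
local notation:70 a:70 " ⋆ " b:71 => QGData.mul (QGData.dual A) a b
local notation "S" => QGData.antipode A
local notation "Si" => QGData.antipodeInv A
local notation "Δ" => QGData.comul A
local notation "Δ'" => QGData.comul (QGData.dual A)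
local notation "ε" => QGData.counit A
local notation "𝟙" => QGData.one A

/-! ### Translates of functionals -/

/-- `twist a c φ` is the functional `x ↦ φ(a x c)`. -/
def twist (A : QGData H) : H →ₗ[ℂ] H →ₗ[ℂ] Module.Dual ℂ H →ₗ[ℂ] Module.Dual ℂ H :=
  LinearMap.mk₂ ℂ (fun a c => (A.mul a ∘ₗ A.mul.flip c).dualMap)
    (fun a b c => by ext φ x; simp) (fun r a c => by ext φ x; simp)
    (fun a b c => by ext φ x; simp) (fun r a c => by ext φ x; simp)

theorem twist_apply (a c : H) (φ : Module.Dual ℂ H) (x : H) :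
    A.twist a c φ x = φ (a ⬝ (x ⬝ c)) := rfl

/-- The functional `x ↦ ε(z x)`, which is `ε ↼ z`. -/
def counitL (A : QGData H) : H →ₗ[ℂ] Module.Dual ℂ H := A.mul.compr₂ A.counit

/-- The functional `x ↦ ε(x y)`, which is `y ⇀ ε`. -/
def counitR (A : QGData H) : H →ₗ[ℂ] Module.Dual ℂ H := A.mul.flip.compr₂ A.counit

theorem counitL_apply (z x : H) : A.counitL z x = ε (z ⬝ x) := rfl

theorem counitR_apply (y x : H) : A.counitR y x = ε (x ⬝ y) := rfl

namespace IsQuantumGroupoid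
variable (hA : A.IsQuantumGroupoid)
include hA

theorem twist_twist (a c a' c' : H) (φ : Module.Dual ℂ H) :
    A.twist a c (A.twist a' c' φ) = A.twist (a' ⬝ a) (c ⬝ c') φ := by
  ext x
  simp only [twist_apply, hA.mul_assoc]

theorem twist_one (φ : Module.Dual ℂ H) : A.twist 𝟙 𝟙 φ = φ := by
  ext x
  rw [twist_apply, hA.mul_one, hA.one_mul]

/-- The fivefold coproduct, bracketed symmetrically about its middle factor. -/
theorem sw_assoc₅ (h : H) (f : H → H → H → H → H → U)
    (h1 : ∀ b c d e, Lin fun a => f a b c d e) (h2 : ∀ a c d e, Lin fun b => f a b c d e)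
    (h3 : ∀ a b d e, Lin fun c => f a b c d e) (h4 : ∀ a b c e, Lin fun d => f a b c d e)
    (h5 : ∀ a b c d, Lin fun e => f a b c d e) :
    (sw (Δ h) fun a t => sw (Δ t) fun b c => sw (Δ b) fun b₁ u => sw (Δ u) fun b₂ b₃ =>
      f a b₁ b₂ b₃ c) =
    sw (Δ h) fun a t => sw (Δ t) fun b c => sw (Δ a) fun a₁ a₂ => sw (Δ c) fun c₁ c₂ =>
      f a₁ a₂ b c₁ c₂ := by
  have e1 : (sw (Δ h) fun a t => sw (Δ t) fun b c => sw (Δ b) fun b₁ u => sw (Δ u) fun b₂ b₃ =>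
      f a b₁ b₂ b₃ c) = sw (Δ h) fun a t => sw (Δ t) fun b₁ s => sw (Δ s) fun b₂ w =>
      sw (Δ w) fun b₃ c => f a b₁ b₂ b₃ c := by
    refine sw_congr fun a t => ?_
    rw [hA.sw_assoc t (fun b₁ u c => sw (Δ u) fun b₂ b₃ => f a b₁ b₂ b₃ c)
      (by fun_prop) (by fun_prop) (by fun_prop)]
    refine sw_congr fun b₁ s => ?_
    exact hA.sw_assoc s (fun b₂ b₃ c => f a b₁ b₂ b₃ c) (by fun_prop) (by fun_prop) (by fun_prop)
  rw [e1, ← hA.sw_assoc h (fun a b₁ s => sw (Δ s) fun b₂ w =>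
      sw (Δ w) fun b₃ c => f a b₁ b₂ b₃ c) (by fun_prop) (by fun_prop) (by fun_prop)]
  refine sw_congr fun a t => ?_
  rw [sw_sw_comm]

/-- Fourfold coproduct: splitting the outer and the inner legs. -/
theorem sw_assoc₄ (h : H) (f : H → H → H → H → U)
    (h1 : ∀ b c d, Lin fun a => f a b c d) (h2 : ∀ a c d, Lin fun b => f a b c d)
    (h3 : ∀ a b d, Lin fun c => f a b c d) (h4 : ∀ a b c, Lin fun d => f a b c d) :
    (sw (Δ h) fun a t => sw (Δ t) fun b c => sw (Δ b) fun b₁ b₂ => f a b₁ b₂ c) =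
    sw (Δ h) fun u v => sw (Δ u) fun a b => sw (Δ v) fun c d => f a b c d := by
  rw [hA.sw_assoc h (fun a b v => sw (Δ v) fun c d => f a b c d) (by fun_prop) (by fun_prop)
    (by fun_prop)]
  refine sw_congr fun a t => ?_
  exact hA.sw_assoc t (fun b₁ b₂ c => f a b₁ b₂ c) (by fun_prop) (by fun_prop) (by fun_prop)

/-- `ε_t(h₁) h₂ = h`. -/
theorem sw_epsT_mul (h : H) (f : H → U) (hf : Lin f) :
    (sw (Δ h) fun a b => f (A.epsT a ⬝ b)) = f h := by
  rw [hA.sw_epsT_left h (fun a b => f (a ⬝ b))]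
  simp only [← hA.mul_assoc]
  rw [← (show Lin fun u => f (u ⬝ h) by fun_prop).map_sw, hA.antipode_one_mul, hA.one_mul]

theorem counit_antipode_target_mul {z : H} (hz : z ∈ A.targetSub) (x : H) :
    ε (S z ⬝ x) = ε (z ⬝ x) := by
  have h := hA.sw_target_move hz x (fun a b => ε a • ε b)
  rw [hA.sw_counit_left x (fun b => ε (z ⬝ b)) (by fun_prop)] at h
  rw [← h]
  exact (hA.sw_counit_right x (fun a => ε (S z ⬝ a)) (by fun_prop)).symm.trans
    (sw_congr fun a b => by rw [smul_eq_mul, smul_eq_mul, mul_comm])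

/-- `ε_t(h g) = h₁ ε_t(g) S(h₂)`. -/
theorem epsT_mul (h g : H) : A.epsT (h ⬝ g) = sw (Δ h) fun a b => a ⬝ A.epsT g ⬝ S b := by
  rw [epsT_eq, hA.sw_comul_mul _ _ _ (by fun_prop) (by fun_prop)]
  refine sw_congr fun a b => ?_
  rw [epsT_eq, map_sw, (show Lin fun u => u ⬝ S b by fun_prop).map_sw]
  simp only [hA.antipode_mul, hA.mul_assoc]

end IsQuantumGroupoid

/-- `S⁻¹(ε_t(h₂)) h₁ = h`. -/
theorem IsStarQuantumGroupoid.sw_antipodeInv_epsT_mul {st : H →ₛₗ[starRingEnd ℂ] H}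
    (hS : A.IsStarQuantumGroupoid st) (h : H) (f : H → U) (hf : Lin f) :
    (sw (Δ h) fun a b => f (Si (A.epsT b) ⬝ a)) = f h := by
  have hA := hS.isQuantumGroupoid
  rw [hA.sw_epsT_right h (fun a b => f (Si b ⬝ a))]
  simp only [← hA.mul_assoc]
  rw [← (show Lin fun u => f (u ⬝ h) by fun_prop).map_sw, hS.antipodeInv_one_mul, hA.one_mul]

variable [FiniteDimensional ℂ H]

theorem arrowR_counit (z : H) : A.arrowR ε z = A.counitL z := by
  rw [arrowR, map_eq_sw, equiv_sw]
  exact sw_dual_comul_smul ε z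

theorem arrowL_counit (y : H) : A.arrowL y ε = A.counitR y := by
  rw [arrowL, map_eq_sw, equiv_sw]
  exact sw_dual_comul_smul' ε y

/-- `Δ̂(φ(a · c)) = φ₁(a ·) ⊗ φ₂(· c)`. -/
theorem sw_dual_comul_twist (φ : Module.Dual ℂ H) (a c : H)
    (f : Module.Dual ℂ H → Module.Dual ℂ H → U)
    (hl : ∀ b, Lin fun a => f a b) (hr : ∀ a, Lin fun b => f a b) (hA : A.IsQuantumGroupoid) :
    sw (Δ' (A.twist a c φ)) f = sw (Δ' φ) fun p q => f (A.twist a 𝟙 p) (A.twist 𝟙 c q) := by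
  rw [← sw_of_map (A.twist a 𝟙) (A.twist 𝟙 c) _ _ hl hr]
  congr 1
  refine dual_tmul_dual_ext fun x y => ?_
  rw [sw_dual_comul, sw_of_map _ _ _ _ (by fun_prop) (by fun_prop)]
  simp only [twist_apply, hA.mul_one, hA.one_mul]
  rw [sw_dual_comul, hA.mul_assoc, hA.mul_assoc]

/-- `(φψ)(a · c) = φ(a₁ · c₁) ψ(a₂ · c₂)`. -/
theorem twist_mul (hA : A.IsQuantumGroupoid) (a c : H) (φ ψ : Module.Dual ℂ H) :
    A.twist a c (φ ⋆ ψ) =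
      sw (Δ a) fun a₁ a₂ => sw (Δ c) fun c₁ c₂ => A.twist a₁ c₁ φ ⋆ A.twist a₂ c₂ ψ := by
  ext x
  rw [twist_apply, dual_mul_apply, hA.sw_comul_mul _ _ _ (by fun_prop) (by fun_prop), sw_apply]
  refine sw_congr fun a₁ a₂ => ?_
  rw [hA.sw_comul_mul _ _ _ (by fun_prop) (by fun_prop), sw_apply, sw_sw_comm]
  refine sw_congr fun c₁ c₂ => ?_
  rw [dual_mul_apply]
  rfl

variable (hA : A.IsQuantumGroupoid)
include hA

theorem counitL_mul {z : H} (hz : z ∈ A.targetSub) (φ : Module.Dual ℂ H) :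
    A.counitL z ⋆ φ = A.twist z 𝟙 φ := by
  ext x
  rw [dual_mul_apply, twist_apply, hA.mul_one]
  exact hA.sw_counit_target_left hz x φ (by fun_prop)

theorem counitR_mul {y : H} (hy : y ∈ A.sourceSub) (φ : Module.Dual ℂ H) :
    A.counitR y ⋆ φ = A.twist 𝟙 (S y) φ := by
  ext x
  rw [dual_mul_apply, twist_apply, hA.one_mul]
  exact hA.sw_counit_source_left hy x φ (by fun_prop)

theorem mul_counitL {z : H} (hz : z ∈ A.targetSub) (φ : Module.Dual ℂ H) :
    φ ⋆ A.counitL z = A.twist (S z) 𝟙 φ := by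
  ext x
  rw [dual_mul_apply, twist_apply, hA.mul_one, ← hA.sw_counit_target_right hz x φ (by fun_prop)]
  exact sw_congr fun a b => mul_comm _ _

theorem mul_counitR {y : H} (hy : y ∈ A.sourceSub) (φ : Module.Dual ℂ H) :
    φ ⋆ A.counitR y = A.twist 𝟙 y φ := by
  ext x
  rw [dual_mul_apply, twist_apply, hA.one_mul, ← hA.sw_counit_source_right hy x φ (by fun_prop)]
  exact sw_congr fun a b => mul_comm _ _

/-- `Δ̂(ε) = ε(· 1₁) ⊗ ε(1₂ ·)`. -/
theorem sw_dual_comul_counit (f : Module.Dual ℂ H → Module.Dual ℂ H → U)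
    (hl : ∀ b, Lin fun a => f a b) (hr : ∀ a, Lin fun b => f a b) :
    sw (Δ' ε) f = sw (Δ 𝟙) fun a b => f (A.counitR a) (A.counitL b) := by
  rw [← sw_of_map A.counitR A.counitL _ _ hl hr]
  congr 1
  refine dual_tmul_dual_ext fun x y => ?_
  rw [sw_dual_comul, sw_of_map _ _ _ _ (by fun_prop) (by fun_prop)]
  simp only [counitR_apply, counitL_apply]
  rw [hA.sw_counit_mul_left, hA.mul_one]

end Translates

noncomputable section Representatives

variable {H : Type*} [AddCommGroup H] [Module ℂ H] [FiniteDimensional ℂ H] {A : QGData H}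
  {U : Type*} [AddCommMonoid U] [Module ℂ U]

local notation:70 a:70 " ⬝ " b:71 => QGData.mul A a b
local notation:70 a:70 " ⋆ " b:71 => QGData.mul (QGData.dual A) a b
local notation "S" => QGData.antipode A
local notation "Si" => QGData.antipodeInv A
local notation "Δ" => QGData.comul A
local notation "Δ'" => QGData.comul (QGData.dual A)
local notation "ε" => QGData.counit A
local notation "𝟙" => QGData.one A

/-! ### The structure maps of the double on representatives -/

/-- `h ⊗ ψ ↦ h₂ ⊗ ψ(β(h₁) · γ(h₃))`: pairing with the outer legs of `ψ` translates `ψ`. -/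
theorem sandwich_tmul (β γ : H →ₗ[ℂ] H) (h : H) (ψ : Module.Dual ℂ H) :
    A.sandwich (Module.Dual.eval ℂ H ∘ₗ β) (Module.Dual.eval ℂ H ∘ₗ γ) (h ⊗ₜ[ℂ] ψ) =
      sw (Δ h) fun a t => sw (Δ t) fun b c => b ⊗ₜ[ℂ] A.twist (β a) (γ c) ψ := by
  have key (x y z : H) : (sw (Δ' ψ) fun p s => sw (Δ' s) fun q r =>
      p x • r y • (z ⊗ₜ[ℂ] q)) = z ⊗ₜ[ℂ] A.twist x y ψ := by
    have h1 : (sw (Δ' ψ) fun p s => p x • ((A.mul.flip y).dualMap s)) = A.twist x y ψ := by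
      have := congrArg (A.mul.flip y).dualMap (sw_dual_comul_smul (A := A) ψ x)
      rw [map_sw] at this
      simp only [map_smul] at this
      exact this
    rw [← h1, tmul_sw]
    refine sw_congr fun p s => ?_
    rw [TensorProduct.tmul_smul, ← smul_sw]
    congr 1
    have h2 : (A.mul.flip y).dualMap s = sw (Δ' s) fun q r => r y • q :=
      (sw_dual_comul_smul' s y).symm
    rw [h2, tmul_sw]
    simp only [TensorProduct.tmul_smul]
  simp only [sandwich, comulThree, LinearMap.comp_apply, TensorProduct.lift.tmul,
    LinearMap.compl₁₂_apply]
  rw [map₂_eq_sw, map_sw, sw_of_map _ _ _ _ (by fun_prop) (by fun_prop)]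
  refine sw_congr fun a t => ?_
  rw [map_sw, sw_of_map _ _ _ _ (by fun_prop) (by fun_prop)]
  simp only [map₂_eq_sw, tmul_sw, map_sw, LinearEquiv.coe_coe, LinearEquiv.trans_apply,
    TensorProduct.lid_tmul, TensorProduct.rid_tmul, map_smul, LinearMap.id_apply, ← key,
    LinearMap.comp_apply, Module.Dual.eval_apply, TensorProduct.mk_apply]
  rw [sw_sw_comm]

theorem preDouble_mul_tmul (φ ψ : Module.Dual ℂ H) (h g : H) :
    A.preDouble.mul (φ ⊗ₜ[ℂ] h) (ψ ⊗ₜ[ℂ] g) =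
      sw (Δ h) fun a t => sw (Δ t) fun b c =>
        (A.twist (S a) c ψ ⋆ φ) ⊗ₜ[ℂ] (b ⬝ g) := by
  have h1 := sandwich_tmul (A := A) A.antipode LinearMap.id h ψ
  rw [LinearMap.comp_id] at h1
  simp only [preDouble, TensorProduct.curry_apply, LinearMap.comp_apply, LinearEquiv.coe_coe,
    TensorProduct.tensorTensorTensorAssoc_tmul, TensorProduct.map_tmul, h1, LinearMap.id_apply]
  simp only [tmul_sw, sw_tmul, map_sw, equiv_sw, TensorProduct.tensorTensorTensorAssoc_symm_tmul,
    TensorProduct.lift.tmul, TensorProduct.map₂_apply_tmul, TensorProduct.map_tmul,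
    LinearMap.flip_apply]

theorem preDouble_comul_tmul (φ : Module.Dual ℂ H) (h : H) :
    A.preDouble.comul (φ ⊗ₜ[ℂ] h) =
      sw (Δ' φ) fun p q => sw (Δ h) fun a b => (p ⊗ₜ[ℂ] a) ⊗ₜ[ℂ] (q ⊗ₜ[ℂ] b) := by
  simp only [preDouble, LinearMap.comp_apply, LinearEquiv.coe_coe, TensorProduct.map_tmul]
  conv_lhs => rw [← sw_self (Δ' φ), ← sw_self (Δ h)]
  simp only [tmul_sw, sw_tmul, equiv_sw, TensorProduct.tensorTensorTensorComm_tmul]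
  rw [sw_sw_comm]

theorem preDouble_counit_tmul (φ : Module.Dual ℂ H) (h : H) :
    A.preDouble.counit (φ ⊗ₜ[ℂ] h) = φ (A.epsT h) := by
  simp [preDouble]

theorem preDouble_antipode_tmul (φ : Module.Dual ℂ H) (h : H) :
    A.preDouble.antipode (φ ⊗ₜ[ℂ] h) =
      sw (Δ h) fun a t => sw (Δ t) fun b c =>
        A.dual.antipodeInv (A.twist a (S c) φ) ⊗ₜ[ℂ] S b := by
  have h1 := sandwich_tmul (A := A) LinearMap.id A.antipode h φ
  rw [LinearMap.comp_id] at h1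
  simp only [preDouble, LinearMap.comp_apply, LinearEquiv.coe_coe, TensorProduct.comm_tmul, h1,
    map_sw, TensorProduct.map_tmul, LinearMap.id_apply]

/-! ### Compatibility of the structure maps with `J` -/

/-- A semilinear map kills `J` once it respects the generators, in which the products with `ε ↼ z`
and `y ⇀ ε` are written as the translates `φ(z ·)` and `φ(· S(y))`. -/
theorem doubleIdeal_le_ker (hA : A.IsQuantumGroupoid) {σ : ℂ →+* ℂ} {W : Type*} [AddCommGroup W]
    [Module ℂ W] (f : Module.Dual ℂ H ⊗[ℂ] H →ₛₗ[σ] W)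
    (h₁ : ∀ z ∈ A.targetSub, ∀ φ h, f (φ ⊗ₜ[ℂ] (z ⬝ h)) = f (A.twist z 𝟙 φ ⊗ₜ[ℂ] h))
    (h₂ : ∀ y ∈ A.sourceSub, ∀ φ h, f (φ ⊗ₜ[ℂ] (y ⬝ h)) = f (A.twist 𝟙 (S y) φ ⊗ₜ[ℂ] h)) :
    A.doubleIdeal ≤ LinearMap.ker f := by
  refine Submodule.span_le.2 ?_
  rintro x (⟨z, hz, φ, h, rfl⟩ | ⟨y, hy, φ, h, rfl⟩)
  · rw [SetLike.mem_coe, LinearMap.mem_ker, map_sub, h₁ z hz, arrowR_counit,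
      counitL_mul hA hz, sub_self]
  · rw [SetLike.mem_coe, LinearMap.mem_ker, map_sub, h₂ y hy, arrowL_counit,
      counitR_mul hA hy, sub_self]

theorem toDouble_target_mul (hA : A.IsQuantumGroupoid) {z : H} (hz : z ∈ A.targetSub)
    (φ : Module.Dual ℂ H) (h : H) :
    A.toDouble (φ ⊗ₜ[ℂ] (z ⬝ h)) = A.toDouble (A.twist z 𝟙 φ ⊗ₜ[ℂ] h) := by
  rw [← counitL_mul hA hz, ← arrowR_counit]
  exact (Submodule.Quotient.eq _).2 (Submodule.subset_span (Or.inl ⟨z, hz, φ, h, rfl⟩))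

theorem toDouble_source_mul (hA : A.IsQuantumGroupoid) {y : H} (hy : y ∈ A.sourceSub)
    (φ : Module.Dual ℂ H) (h : H) :
    A.toDouble (φ ⊗ₜ[ℂ] (y ⬝ h)) = A.toDouble (A.twist 𝟙 (S y) φ ⊗ₜ[ℂ] h) := by
  rw [← counitR_mul hA hy, ← arrowL_counit]
  exact (Submodule.Quotient.eq _).2 (Submodule.subset_span (Or.inr ⟨y, hy, φ, h, rfl⟩))

theorem preDouble_mul_target_left (hA : A.IsQuantumGroupoid) {z : H} (hz : z ∈ A.targetSub)
    (φ : Module.Dual ℂ H) (h : H) (x : Module.Dual ℂ H ⊗[ℂ] H) :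
    A.preDouble.mul (φ ⊗ₜ[ℂ] (z ⬝ h)) x = A.preDouble.mul (A.twist z 𝟙 φ ⊗ₜ[ℂ] h) x := by
  rw [← sw_self x, map_sw, map_sw]
  refine sw_congr fun ψ g => ?_
  rw [preDouble_mul_tmul, preDouble_mul_tmul,
    hA.sw_target_mul hz h _ (by fun_prop) (by fun_prop)]
  refine sw_congr fun a t => sw_congr fun b c => ?_
  rw [← counitL_mul hA hz, ← dual_mul_assoc hA, mul_counitL hA hz, hA.twist_twist, hA.one_mul,
    hA.antipode_mul]

theorem preDouble_mul_source_left (hA : A.IsQuantumGroupoid) {y : H} (hy : y ∈ A.sourceSub)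
    (φ : Module.Dual ℂ H) (h : H) (x : Module.Dual ℂ H ⊗[ℂ] H) :
    A.preDouble.mul (φ ⊗ₜ[ℂ] (y ⬝ h)) x = A.preDouble.mul (A.twist 𝟙 (S y) φ ⊗ₜ[ℂ] h) x := by
  rw [← sw_self x, map_sw, map_sw]
  refine sw_congr fun ψ g => ?_
  rw [preDouble_mul_tmul, preDouble_mul_tmul,
    hA.sw_source_mul hy h _ (by fun_prop) (by fun_prop)]
  refine sw_congr fun a t => ?_
  rw [hA.sw_source_mul hy t _ (by fun_prop) (by fun_prop)]
  refine sw_congr fun b c => ?_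
  rw [← counitR_mul hA hy, ← dual_mul_assoc hA, mul_counitR hA hy, hA.twist_twist, hA.mul_one]

theorem preDouble_mul_target_right {st : H →ₛₗ[starRingEnd ℂ] H}
    (hS : A.IsStarQuantumGroupoid st) {z : H} (hz : z ∈ A.targetSub)
    (φ : Module.Dual ℂ H) (h : H) (x : Module.Dual ℂ H ⊗[ℂ] H) :
    A.preDouble.mul x (φ ⊗ₜ[ℂ] (z ⬝ h)) = A.preDouble.mul x (A.twist z 𝟙 φ ⊗ₜ[ℂ] h) := by
  have hA := hS.isQuantumGroupoid
  rw [← sw_self x, map_sw, sw_apply, sw_apply]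
  refine sw_congr fun ψ g => ?_
  rw [preDouble_mul_tmul, preDouble_mul_tmul]
  simp only [hA.twist_twist, hA.mul_one]
  rw [← hA.sw_assoc g (fun a b c => (A.twist (S a) c φ ⋆ ψ) ⊗ₜ[ℂ] (b ⬝ (z ⬝ h))) (by fun_prop)
      (by fun_prop) (by fun_prop),
    ← hA.sw_assoc g (fun a b c => (A.twist (z ⬝ S a) c φ ⋆ ψ) ⊗ₜ[ℂ] (b ⬝ h)) (by fun_prop)
      (by fun_prop) (by fun_prop)]
  refine sw_congr fun u c => ?_
  simp only [← hA.mul_assoc]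
  rw [hS.sw_mul_target_move hz u (fun a b => (A.twist (S a) c φ ⋆ ψ) ⊗ₜ[ℂ] (b ⬝ h))]
  refine sw_congr fun a b => ?_
  rw [hA.antipode_mul, hS.antipode_antipodeInv]

theorem preDouble_mul_source_right (hA : A.IsQuantumGroupoid) {y : H} (hy : y ∈ A.sourceSub)
    (φ : Module.Dual ℂ H) (h : H) (x : Module.Dual ℂ H ⊗[ℂ] H) :
    A.preDouble.mul x (φ ⊗ₜ[ℂ] (y ⬝ h)) = A.preDouble.mul x (A.twist 𝟙 (S y) φ ⊗ₜ[ℂ] h) := by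
  rw [← sw_self x, map_sw, sw_apply, sw_apply]
  refine sw_congr fun ψ g => ?_
  rw [preDouble_mul_tmul, preDouble_mul_tmul]
  simp only [hA.twist_twist, hA.one_mul, ← hA.mul_assoc]
  refine sw_congr fun a t => ?_
  exact hA.sw_source_move hy t (fun b c => (A.twist (S a) c φ ⋆ ψ) ⊗ₜ[ℂ] (b ⬝ h))

/-- The product is associative on representatives, before any identification. -/
theorem preDouble_mul_assoc (hA : A.IsQuantumGroupoid) (x y z : Module.Dual ℂ H ⊗[ℂ] H) :
    A.preDouble.mul (A.preDouble.mul x y) z = A.preDouble.mul x (A.preDouble.mul y z) := by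
  rw [← sw_self x]
  simp only [map_sw, sw_apply]
  refine sw_congr fun φ h => ?_
  rw [← sw_self y]
  simp only [map_sw, sw_apply]
  refine sw_congr fun ψ g => ?_
  rw [← sw_self z]
  simp only [map_sw]
  refine sw_congr fun χ k => ?_
  -- both sides are sums over a fivefold coproduct of `h` and a threefold one of `g`
  let F (a b₁ b₂ b₃ c : H) := sw (Δ g) fun p s => sw (Δ s) fun q r =>
    (A.twist (S (b₁ ⬝ p)) (b₃ ⬝ r) χ ⋆ (A.twist (S a) c ψ ⋆ φ)) ⊗ₜ[ℂ] (b₂ ⬝ q ⬝ k)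
  trans sw (Δ h) fun a t => sw (Δ t) fun b c => sw (Δ b) fun b₁ u => sw (Δ u) fun b₂ b₃ =>
      F a b₁ b₂ b₃ c
  · simp only [preDouble_mul_tmul, map_sw, sw_apply]
    refine sw_congr fun a t => sw_congr fun b c => ?_
    rw [hA.sw_comul_mul _ _ _ (by fun_prop) (by fun_prop)]
    refine sw_congr fun b₁ u => ?_
    rw [sw_sw_comm]
    refine sw_congr fun p s => ?_
    rw [hA.sw_comul_mul _ _ _ (by fun_prop) (by fun_prop)]
  · rw [hA.sw_assoc₅ h F (by fun_prop) (by fun_prop) (by fun_prop) (by fun_prop) (by fun_prop)]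
    simp only [preDouble_mul_tmul, map_sw]
    simp only [sw_sw_comm _ (Δ h)]
    refine sw_congr fun a t => ?_
    simp only [sw_sw_comm _ (Δ t)]
    refine sw_congr fun b c => ?_
    simp only [twist_mul hA]
    simp (disch := fun_prop) only [hA.sw_comul_antipode]
    simp only [sw_apply, map_sw, sw_tmul, hA.twist_twist, dual_mul_assoc hA]
    simp only [sw_sw_comm _ (Δ a)]
    refine sw_congr fun a₁ a₂ => ?_
    simp only [sw_sw_comm _ (Δ c)]
    refine sw_congr fun c₁ c₂ => ?_
    simp only [F, hA.antipode_mul, hA.mul_assoc]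

theorem toDouble_comul_target (hA : A.IsQuantumGroupoid) {z : H} (hz : z ∈ A.targetSub)
    (φ : Module.Dual ℂ H) (h : H) :
    TensorProduct.map A.toDouble A.toDouble (A.preDouble.comul (φ ⊗ₜ[ℂ] (z ⬝ h))) =
      TensorProduct.map A.toDouble A.toDouble (A.preDouble.comul (A.twist z 𝟙 φ ⊗ₜ[ℂ] h)) := by
  rw [preDouble_comul_tmul, preDouble_comul_tmul,
    sw_dual_comul_twist (A := A) _ _ _ _ (by fun_prop) (by fun_prop) hA]
  simp only [map_sw, TensorProduct.map_tmul, hA.twist_one]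
  refine sw_congr fun p q => ?_
  rw [hA.sw_target_mul hz h _ (by fun_prop) (by fun_prop)]
  simp only [toDouble_target_mul hA hz]

theorem toDouble_comul_source (hA : A.IsQuantumGroupoid) {y : H} (hy : y ∈ A.sourceSub)
    (φ : Module.Dual ℂ H) (h : H) :
    TensorProduct.map A.toDouble A.toDouble (A.preDouble.comul (φ ⊗ₜ[ℂ] (y ⬝ h))) =
      TensorProduct.map A.toDouble A.toDouble (A.preDouble.comul (A.twist 𝟙 (S y) φ ⊗ₜ[ℂ] h)) := by
  rw [preDouble_comul_tmul, preDouble_comul_tmul,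
    sw_dual_comul_twist (A := A) _ _ _ _ (by fun_prop) (by fun_prop) hA]
  simp only [map_sw, TensorProduct.map_tmul, hA.twist_one]
  refine sw_congr fun p q => ?_
  rw [hA.sw_source_mul hy h _ (by fun_prop) (by fun_prop)]
  simp only [toDouble_source_mul hA hy]

theorem preDouble_antipode_target (hA : A.IsQuantumGroupoid) {z : H} (hz : z ∈ A.targetSub)
    (φ : Module.Dual ℂ H) (h : H) :
    A.preDouble.antipode (φ ⊗ₜ[ℂ] (z ⬝ h)) = A.preDouble.antipode (A.twist z 𝟙 φ ⊗ₜ[ℂ] h) := by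
  rw [preDouble_antipode_tmul, preDouble_antipode_tmul,
    hA.sw_target_mul hz h _ (by fun_prop) (by fun_prop)]
  simp only [hA.twist_twist, hA.mul_one]

theorem preDouble_antipode_source (hA : A.IsQuantumGroupoid) {y : H} (hy : y ∈ A.sourceSub)
    (φ : Module.Dual ℂ H) (h : H) :
    A.preDouble.antipode (φ ⊗ₜ[ℂ] (y ⬝ h)) =
      A.preDouble.antipode (A.twist 𝟙 (S y) φ ⊗ₜ[ℂ] h) := by
  rw [preDouble_antipode_tmul, preDouble_antipode_tmul,
    hA.sw_source_mul hy h _ (by fun_prop) (by fun_prop)]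
  refine sw_congr fun a t => ?_
  rw [hA.sw_source_mul hy t _ (by fun_prop) (by fun_prop)]
  simp only [hA.twist_twist, hA.one_mul, hA.antipode_mul]

theorem preDouble_counit_target (hA : A.IsQuantumGroupoid) {z : H} (hz : z ∈ A.targetSub)
    (φ : Module.Dual ℂ H) (h : H) :
    A.preDouble.counit (φ ⊗ₜ[ℂ] (z ⬝ h)) = A.preDouble.counit (A.twist z 𝟙 φ ⊗ₜ[ℂ] h) := by
  rw [preDouble_counit_tmul, preDouble_counit_tmul, hA.epsT_target_mul hz, twist_apply, hA.mul_one]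

theorem preDouble_counit_source (hA : A.IsQuantumGroupoid) {y : H} (hy : y ∈ A.sourceSub)
    (φ : Module.Dual ℂ H) (h : H) :
    A.preDouble.counit (φ ⊗ₜ[ℂ] (y ⬝ h)) = A.preDouble.counit (A.twist 𝟙 (S y) φ ⊗ₜ[ℂ] h) := by
  rw [preDouble_counit_tmul, preDouble_counit_tmul, hA.epsT_source_mul hy, twist_apply, hA.one_mul]

/-- The structure maps of the Drinfeld double exist. -/
theorem exists_descends {st : H →ₛₗ[starRingEnd ℂ] H} (hS : A.IsStarQuantumGroupoid st) :
    ∃ D : QGData A.DrinfeldDouble, A.preDouble.Descends A.toDouble D := by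
  have hA := hS.isQuantumGroupoid
  let B := A.preDouble.mul.compr₂ A.toDouble
  have hr : A.doubleIdeal ≤ LinearMap.ker B.flip := doubleIdeal_le_ker hA _
    (fun z hz φ h => LinearMap.ext fun x => congrArg A.toDouble
      (preDouble_mul_target_right hS hz φ h x))
    (fun y hy φ h => LinearMap.ext fun x => congrArg A.toDouble
      (preDouble_mul_source_right hA hy φ h x))
  let C := (A.doubleIdeal.liftQ B.flip hr).flip
  have hl : A.doubleIdeal ≤ LinearMap.ker C := doubleIdeal_le_ker hA _
    (fun z hz φ h => LinearMap.ext fun x => by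
      obtain ⟨x, rfl⟩ := A.doubleIdeal.mkQ_surjective x
      exact congrArg A.toDouble (preDouble_mul_target_left hA hz φ h x))
    (fun y hy φ h => LinearMap.ext fun x => by
      obtain ⟨x, rfl⟩ := A.doubleIdeal.mkQ_surjective x
      exact congrArg A.toDouble (preDouble_mul_source_left hA hy φ h x))
  have hc : A.doubleIdeal ≤ LinearMap.ker
      (TensorProduct.map A.toDouble A.toDouble ∘ₗ A.preDouble.comul) :=
    doubleIdeal_le_ker hA _ (fun z hz => toDouble_comul_target hA hz)
      (fun y hy => toDouble_comul_source hA hy)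
  have he : A.doubleIdeal ≤ LinearMap.ker A.preDouble.counit :=
    doubleIdeal_le_ker hA _ (fun z hz => preDouble_counit_target hA hz)
      (fun y hy => preDouble_counit_source hA hy)
  have ha : A.doubleIdeal ≤ LinearMap.ker (A.toDouble ∘ₗ A.preDouble.antipode) :=
    doubleIdeal_le_ker hA _
      (fun z hz φ h => congrArg A.toDouble (preDouble_antipode_target hA hz φ h))
      (fun y hy φ h => congrArg A.toDouble (preDouble_antipode_source hA hy φ h))
  exact ⟨{  mul := A.doubleIdeal.liftQ C hl
            one := A.toDouble A.preDouble.one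
            comul := A.doubleIdeal.liftQ _ hc
            counit := A.doubleIdeal.liftQ _ he
            antipode := A.doubleIdeal.liftQ _ ha },
    { mul := fun x y => rfl
      one := rfl
      comul := fun x => rfl
      counit := fun x => rfl
      antipode := fun x => rfl }⟩

/-! ### The two maps into the double -/

local notation "q" => QGData.toDouble A

theorem IsQuantumGroupoid.sw_antipode_one (hA : A.IsQuantumGroupoid) (f : H → U) (hf : Lin f) :
    (sw (Δ 𝟙) fun a b => f (S a ⬝ b)) = f 𝟙 := by
  rw [← hf.map_sw, hA.antipode_one_mul]

theorem dual_antipodeInv_apply {st : H →ₛₗ[starRingEnd ℂ] H} (hS : A.IsStarQuantumGroupoid st)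
    (φ : Module.Dual ℂ H) : A.dual.antipodeInv φ = φ ∘ₗ Si := by
  have : A.dual.antipodeInv = A.antipodeInv.dualMap := by
    refine antipodeInv_eq (fun φ => ?_) (fun φ => ?_)
    · ext x
      exact congrArg φ (hS.antipode_antipodeInv x)
    · ext x
      exact congrArg φ (hS.antipodeInv_antipode x)
  rw [this]
  rfl

theorem toDouble_mul_target_mul (hA : A.IsQuantumGroupoid) {z : H} (hz : z ∈ A.targetSub)
    (α φ : Module.Dual ℂ H) (h : H) :
    q ((α ⋆ φ) ⊗ₜ[ℂ] (z ⬝ h)) = q ((A.twist z 𝟙 α ⋆ φ) ⊗ₜ[ℂ] h) := by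
  rw [toDouble_target_mul hA hz, ← counitL_mul hA hz, ← dual_mul_assoc hA, counitL_mul hA hz]

theorem toDouble_mul_source_mul (hA : A.IsQuantumGroupoid) {y : H} (hy : y ∈ A.sourceSub)
    (α φ : Module.Dual ℂ H) (h : H) :
    q ((α ⋆ φ) ⊗ₜ[ℂ] (y ⬝ h)) = q ((A.twist 𝟙 (S y) α ⋆ φ) ⊗ₜ[ℂ] h) := by
  rw [toDouble_source_mul hA hy, ← counitR_mul hA hy, ← dual_mul_assoc hA, counitR_mul hA hy]

/-- `(φ ⊗ 1)(α ⊗ h)` and `α φ ⊗ h` have the same class. -/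
theorem toDouble_sw_one (hA : A.IsQuantumGroupoid) (α φ : Module.Dual ℂ H) (h : H) :
    (sw (Δ 𝟙) fun a t => sw (Δ t) fun b c =>
      q ((A.twist (S a) c α ⋆ φ) ⊗ₜ[ℂ] (b ⬝ h))) = q ((α ⋆ φ) ⊗ₜ[ℂ] h) := by
  rw [hA.sw_one_left (fun a b c => q ((A.twist (S a) c α ⋆ φ) ⊗ₜ[ℂ] (b ⬝ h)))
    (by fun_prop) (by fun_prop) (by fun_prop)]
  trans sw (Δ 𝟙) fun a b => sw (Δ 𝟙) fun c d => q ((A.twist (S a ⬝ b) (S c ⬝ d) α ⋆ φ) ⊗ₜ[ℂ] h)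
  · refine hA.sw_one_congr fun a _ b hb => hA.sw_one_congr fun c hc d _ => ?_
    rw [hA.mul_assoc, toDouble_mul_target_mul hA hb, toDouble_mul_source_mul hA hc,
      hA.twist_twist, hA.twist_twist, hA.mul_one, hA.mul_one]
  · refine (sw_congr fun a b => hA.sw_antipode_one
      (fun v => q ((A.twist (S a ⬝ b) v α ⋆ φ) ⊗ₜ[ℂ] h)) (by fun_prop)).trans ?_
    rw [hA.sw_antipode_one (fun u => q ((A.twist u 𝟙 α ⋆ φ) ⊗ₜ[ℂ] h)) (by fun_prop), hA.twist_one]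

/-- `(φ ⊗ h)(ε ⊗ g)` and `φ ⊗ h g` have the same class. -/
theorem toDouble_sw_counit (hA : A.IsQuantumGroupoid) (φ : Module.Dual ℂ H) (h g : H) :
    (sw (Δ h) fun a t => sw (Δ t) fun b c =>
      q ((A.twist (S a) c ε ⋆ φ) ⊗ₜ[ℂ] (b ⬝ g))) = q (φ ⊗ₜ[ℂ] (h ⬝ g)) := by
  have key (a c : H) : A.twist (S a) c ε = A.twist (S (A.epsT a)) (A.epsT c) ε := by
    ext x
    rw [twist_apply, twist_apply, ← hA.mul_assoc, ← hA.mul_assoc, hA.counit_mul_epsT,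
      ← hA.epsS_antipode, hA.mul_assoc, hA.mul_assoc, hA.counit_epsS_mul]
  refine (sw_congr fun a t => sw_congr fun b c => by rw [key]).trans ?_
  trans sw (Δ h) fun a t => sw (Δ 𝟙) fun c d =>
      q ((A.twist (S (A.epsT a)) d ε ⋆ φ) ⊗ₜ[ℂ] (c ⬝ t ⬝ g))
  · refine sw_congr fun a t => ?_
    exact hA.sw_epsT_right t
      (fun b c => q ((A.twist (S (A.epsT a)) c ε ⋆ φ) ⊗ₜ[ℂ] (b ⬝ g)))
  rw [hA.sw_epsT_left h (fun a t => sw (Δ 𝟙) fun c d =>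
    q ((A.twist (S a) d ε ⋆ φ) ⊗ₜ[ℂ] (c ⬝ t ⬝ g)))]
  trans sw (Δ 𝟙) fun a b => sw (Δ 𝟙) fun c d =>
      q ((A.twist (S a ⬝ b) (S c ⬝ d) ε ⋆ φ) ⊗ₜ[ℂ] (h ⬝ g))
  · refine hA.sw_one_congr fun a ha b hb => hA.sw_one_congr fun c hc d _ => ?_
    have h1 : A.twist (S (S a) ⬝ b) (S c ⬝ d) ε = A.twist (S a ⬝ b) (S c ⬝ d) ε := by
      ext x
      rw [twist_apply, twist_apply, hA.mul_assoc,
        hA.counit_antipode_target_mul (hA.antipode_source_mem ha), ← hA.mul_assoc]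
    rw [hA.mul_assoc, hA.mul_assoc, toDouble_mul_source_mul hA hc, toDouble_mul_target_mul hA hb,
      hA.twist_twist, hA.twist_twist, hA.one_mul, hA.one_mul, h1]
  · refine (sw_congr fun a b => hA.sw_antipode_one
      (fun v => q ((A.twist (S a ⬝ b) v ε ⋆ φ) ⊗ₜ[ℂ] (h ⬝ g))) (by fun_prop)).trans ?_
    rw [hA.sw_antipode_one (fun u => q ((A.twist u 𝟙 ε ⋆ φ) ⊗ₜ[ℂ] (h ⬝ g))) (by fun_prop),
      hA.twist_one]
    have := dual_one_mul hA φ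
    rw [dual_one] at this
    rw [this]

/-- The laws that determine the Drinfeld double `D` in terms of the two maps `ι h = [ε ⊗ h]` and
`κ φ = [φ ⊗ 1]`, for which `[φ ⊗ h] = κ(φ) ι(h)`. The map `ι` is multiplicative and `κ` is
anti-multiplicative for the product of `Ĥ`; both are compatible with the coproducts, and they
agree on the counital subalgebras. -/
structure IsDouble {V : Type*} [AddCommGroup V] [Module ℂ V] (A : QGData H) (D : QGData V)
    (ι : H →ₗ[ℂ] V) (κ : Module.Dual ℂ H →ₗ[ℂ] V) : Prop where
  finite : FiniteDimensional ℂ V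
  exists_tensor : ∀ x : V, ∃ t : Module.Dual ℂ H ⊗[ℂ] H, x = sw t fun φ h => D.mul (κ φ) (ι h)
  mul_assoc : ∀ x y z, D.mul (D.mul x y) z = D.mul x (D.mul y z)
  iota_one : ι A.one = D.one
  kappa_one : κ A.counit = D.one
  iota_mul : ∀ g h, ι (A.mul g h) = D.mul (ι g) (ι h)
  kappa_mul : ∀ φ ψ, κ (A.dual.mul φ ψ) = D.mul (κ ψ) (κ φ)
  exchange : ∀ h ψ, D.mul (ι h) (κ ψ) = sw (A.comul h) fun a t => sw (A.comul t) fun b c =>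
    D.mul (κ (A.twist (A.antipode a) c ψ)) (ι b)
  iota_target : ∀ z ∈ A.targetSub, ι z = κ (A.counitL z)
  iota_source : ∀ y ∈ A.sourceSub, ι y = κ (A.counitR y)
  comul_iota : ∀ h, D.comul (ι h) = sw (A.comul h) fun a b => ι a ⊗ₜ[ℂ] ι b
  comul_kappa : ∀ φ, D.comul (κ φ) = sw (A.dual.comul φ) fun α β => κ α ⊗ₜ[ℂ] κ β
  comul_kappa_iota : ∀ φ h, D.comul (D.mul (κ φ) (ι h)) =
    sw (A.dual.comul φ) fun α β => sw (A.comul h) fun a b =>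
      D.mul (κ α) (ι a) ⊗ₜ[ℂ] D.mul (κ β) (ι b)
  counit_kappa_iota : ∀ φ h, D.counit (D.mul (κ φ) (ι h)) = φ (A.epsT h)
  antipode_kappa_iota : ∀ φ h, D.antipode (D.mul (κ φ) (ι h)) =
    D.mul (ι (A.antipode h)) (κ (φ ∘ₗ A.antipodeInv))

/-- `h ↦ [ε ⊗ h]`. -/
def iota (A : QGData H) : H →ₗ[ℂ] A.DrinfeldDouble :=
  A.toDouble ∘ₗ TensorProduct.mk ℂ (Module.Dual ℂ H) H A.counit

/-- `φ ↦ [φ ⊗ 1]`. -/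
def kappa (A : QGData H) : Module.Dual ℂ H →ₗ[ℂ] A.DrinfeldDouble :=
  A.toDouble ∘ₗ (TensorProduct.mk ℂ (Module.Dual ℂ H) H).flip A.one

theorem iota_apply (h : H) : A.iota h = q (ε ⊗ₜ[ℂ] h) := rfl

theorem kappa_apply (φ : Module.Dual ℂ H) : A.kappa φ = q (φ ⊗ₜ[ℂ] 𝟙) := rfl

theorem toDouble_eq (hA : A.IsQuantumGroupoid) {D : QGData A.DrinfeldDouble}
    (hD : A.preDouble.Descends q D) (φ : Module.Dual ℂ H) (h : H) :
    q (φ ⊗ₜ[ℂ] h) = D.mul (A.kappa φ) (A.iota h) := by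
  have := dual_one_mul hA φ
  rw [dual_one] at this
  rw [kappa_apply, iota_apply, hD.mul, preDouble_mul_tmul]
  simp only [map_sw]
  rw [toDouble_sw_one hA, this]

theorem isDouble_drinfeldDouble {st : H →ₛₗ[starRingEnd ℂ] H} (hS : A.IsStarQuantumGroupoid st)
    {D : QGData A.DrinfeldDouble} (hD : A.preDouble.Descends q D) :
    A.IsDouble D A.iota A.kappa := by
  have hA := hS.isQuantumGroupoid
  have hq := toDouble_eq hA hD
  have he1 (φ : Module.Dual ℂ H) : ε ⋆ φ = φ := dual_one_mul hA φ
  have he2 (φ : Module.Dual ℂ H) : φ ⋆ ε = φ := dual_mul_one hA φ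
  have hcomul (φ : Module.Dual ℂ H) (h : H) : D.comul (q (φ ⊗ₜ[ℂ] h)) =
      sw (Δ' φ) fun α β => sw (Δ h) fun a b => q (α ⊗ₜ[ℂ] a) ⊗ₜ[ℂ] q (β ⊗ₜ[ℂ] b) := by
    rw [hD.comul, preDouble_comul_tmul]
    simp only [map_sw, TensorProduct.map_tmul]
  have hexch (h : H) (ψ : Module.Dual ℂ H) : D.mul (A.iota h) (A.kappa ψ) =
      sw (Δ h) fun a t => sw (Δ t) fun b c => D.mul (A.kappa (A.twist (S a) c ψ)) (A.iota b) := by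
    rw [iota_apply, kappa_apply, hD.mul, preDouble_mul_tmul]
    simp only [map_sw, he2, hA.mul_one, hq]
  exact
  { finite := inferInstance
    exists_tensor := fun x => by
      obtain ⟨x, rfl⟩ := A.doubleIdeal.mkQ_surjective x
      refine ⟨x, ?_⟩
      change q x = _
      conv_lhs => rw [← sw_self x, map_sw]
      simp only [hq]
    mul_assoc := fun x y z => by
      obtain ⟨x, rfl⟩ := A.doubleIdeal.mkQ_surjective x
      obtain ⟨y, rfl⟩ := A.doubleIdeal.mkQ_surjective y
      obtain ⟨z, rfl⟩ := A.doubleIdeal.mkQ_surjective z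
      change D.mul (D.mul (q x) (q y)) (q z) = D.mul (q x) (D.mul (q y) (q z))
      rw [hD.mul, hD.mul, hD.mul, hD.mul, preDouble_mul_assoc hA]
    iota_one := hD.one.symm
    kappa_one := hD.one.symm
    iota_mul := fun g h => by
      rw [iota_apply, iota_apply, iota_apply, hD.mul, preDouble_mul_tmul]
      simp only [map_sw]
      rw [toDouble_sw_counit hA]
    kappa_mul := fun φ ψ => by
      rw [kappa_apply, kappa_apply, kappa_apply, hD.mul, preDouble_mul_tmul]
      simp only [map_sw]
      rw [toDouble_sw_one hA]
    exchange := hexch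
    iota_target := fun z hz => by
      rw [iota_apply, kappa_apply, ← he2 (A.counitL z), counitL_mul hA hz,
        ← toDouble_target_mul hA hz, hA.mul_one]
    iota_source := fun y hy => by
      rw [iota_apply, kappa_apply, ← he2 (A.counitR y), counitR_mul hA hy,
        ← toDouble_source_mul hA hy, hA.mul_one]
    comul_iota := fun h => by
      rw [iota_apply, hcomul, sw_dual_comul_counit hA _ (by fun_prop) (by fun_prop),
        ← hA.sw_one_mul h (fun a b => A.iota a ⊗ₜ[ℂ] A.iota b) (by fun_prop) (by fun_prop)]
      refine hA.sw_one_congr fun c hc d hd => sw_congr fun a b => ?_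
      rw [← he2 (A.counitR c), counitR_mul hA hc, ← toDouble_source_mul hA hc,
        ← he2 (A.counitL d), counitL_mul hA hd, ← toDouble_target_mul hA hd]
      rfl
    comul_kappa := fun φ => by
      have hdual := dual_isQuantumGroupoid hA
      rw [kappa_apply, hcomul,
        ← hdual.sw_one_mul φ (fun a b => A.kappa a ⊗ₜ[ℂ] A.kappa b) (by fun_prop) (by fun_prop),
        dual_one, sw_dual_comul_counit hA _ (by fun_prop) (by fun_prop), sw_sw_comm]
      refine hA.sw_one_congr fun c hc d hd => sw_congr fun α β => ?_
      rw [counitR_mul hA hc, counitL_mul hA hd, kappa_apply, kappa_apply,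
        ← toDouble_target_mul hA hd, ← toDouble_source_mul hA hc, hA.mul_one, hA.mul_one]
    comul_kappa_iota := fun φ h => by
      rw [← hq, hcomul]
      simp only [hq]
    counit_kappa_iota := fun φ h => by
      rw [← hq, hD.counit, preDouble_counit_tmul]
    antipode_kappa_iota := fun φ h => by
      rw [← hq, hD.antipode, preDouble_antipode_tmul, hexch,
        hA.sw_comul_antipode _ _ (by fun_prop) (by fun_prop)]
      simp only [map_sw]
      rw [← hA.sw_assoc h (fun a b c => q (A.dual.antipodeInv (A.twist a (S c) φ) ⊗ₜ[ℂ] S b))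
          (by fun_prop) (by fun_prop) (by fun_prop)]
      refine sw_congr fun t c => ?_
      rw [hA.sw_comul_antipode _ _ (by fun_prop) (by fun_prop)]
      refine sw_congr fun a b => ?_
      rw [hq, dual_antipodeInv_apply hS]
      congr 3
      ext x
      simp only [LinearMap.comp_apply, twist_apply, hS.antipodeInv_mul, hS.antipodeInv_antipode,
        hA.mul_assoc] }

end Representatives

noncomputable section AbstractDouble

variable {H : Type*} [AddCommGroup H] [Module ℂ H] [FiniteDimensional ℂ H] {A : QGData H}
  {U : Type*} [AddCommMonoid U] [Module ℂ U] {st : H →ₛₗ[starRingEnd ℂ] H}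
  {V : Type*} [AddCommGroup V] [Module ℂ V] {D : QGData V} {ι : H →ₗ[ℂ] V}
  {κ : Module.Dual ℂ H →ₗ[ℂ] V}

local notation:70 a:70 " ⬝ " b:71 => QGData.mul A a b
local notation:70 a:70 " ⊙ " b:71 => QGData.mul D a b
local notation:70 a:70 " ⋆ " b:71 => QGData.mul (QGData.dual A) a b
local notation "S" => QGData.antipode A
local notation "Si" => QGData.antipodeInv A
local notation "Δ" => QGData.comul A
local notation "Δ'" => QGData.comul (QGData.dual A)
local notation "ε" => QGData.counit A
local notation "𝟙" => QGData.one A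

/-! ### Consequences of the exchange relation -/

/-- `ε_t(k₁) ε_t(k₂) = ε_t(k)`. -/
theorem IsQuantumGroupoid.sw_epsT_mul_epsT (hA : A.IsQuantumGroupoid) (k : H) (f : H → U)
    (hf : Lin f) :
    (sw (Δ k) fun a b => f (A.epsT a ⬝ A.epsT b)) = f (A.epsT k) := by
  rw [hA.sw_epsT_left k (fun a b => f (a ⬝ A.epsT b)) (by fun_prop) (by fun_prop)]
  trans sw (Δ 𝟙) fun a b => f (S a ⬝ b ⬝ A.epsT k)
  · refine hA.sw_one_congr fun a _ b hb => ?_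
    rw [hA.epsT_target_mul hb, hA.mul_assoc]
  · rw [hA.sw_antipode_one (fun u => f (u ⬝ A.epsT k)) (by fun_prop), hA.one_mul]

namespace IsDouble

variable (hD : A.IsDouble D ι κ)
include hD

/-- The products `κ φ ι h` span the double. -/
theorem lin_ext (f g : V → U) (x : V) (h : ∀ φ h, f (κ φ ⊙ ι h) = g (κ φ ⊙ ι h))
    (hf : Lin f := by fun_prop) (hg : Lin g := by fun_prop) : f x = g x := by
  obtain ⟨t, rfl⟩ := hD.exists_tensor x
  rw [hf.map_sw, hg.map_sw]
  simp only [h]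

variable (hS : A.IsStarQuantumGroupoid st)
include hS

theorem one_mul (x : V) : D.one ⊙ x = x := by
  refine hD.lin_ext (fun x => D.one ⊙ x)
    (fun x => x) x (fun φ h => ?_)
  have := dual_mul_one hS.isQuantumGroupoid φ
  rw [dual_one] at this
  rw [← hD.mul_assoc, ← hD.kappa_one, ← hD.kappa_mul, this]

theorem mul_one (x : V) : x ⊙ D.one = x := by
  refine hD.lin_ext (fun x => x ⊙ D.one)
    (fun x => x) x (fun φ h => ?_)
  rw [hD.mul_assoc, ← hD.iota_one, ← hD.iota_mul, hS.isQuantumGroupoid.mul_one]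

theorem kappa_twist_left {z : H} (hz : z ∈ A.targetSub) (φ : Module.Dual ℂ H) :
    κ (A.twist z 𝟙 φ) = κ φ ⊙ ι z := by
  rw [← counitL_mul hS.isQuantumGroupoid hz, hD.kappa_mul, hD.iota_target z hz]

theorem kappa_twist_antipode {y : H} (hy : y ∈ A.sourceSub) (φ : Module.Dual ℂ H) :
    κ (A.twist 𝟙 (S y) φ) = κ φ ⊙ ι y := by
  rw [← counitR_mul hS.isQuantumGroupoid hy, hD.kappa_mul, hD.iota_source y hy]

theorem kappa_twist_right {z : H} (hz : z ∈ A.targetSub) (φ : Module.Dual ℂ H) :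
    κ (A.twist 𝟙 z φ) = κ φ ⊙ ι (Si z) := by
  rw [← hD.kappa_twist_antipode hS (hS.antipodeInv_target_mem hz), hS.antipode_antipodeInv]

theorem iota_mul_kappa_target {z : H} (hz : z ∈ A.targetSub) (φ : Module.Dual ℂ H) :
    ι z ⊙ κ φ = κ (A.twist (S z) 𝟙 φ) := by
  rw [← mul_counitL hS.isQuantumGroupoid hz, hD.kappa_mul, hD.iota_target z hz]

theorem iota_mul_kappa_source {y : H} (hy : y ∈ A.sourceSub) (φ : Module.Dual ℂ H) :
    ι y ⊙ κ φ = κ (A.twist 𝟙 y φ) := by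
  rw [← mul_counitR hS.isQuantumGroupoid hy, hD.kappa_mul, hD.iota_source y hy]

theorem kappa_twist {z z' : H} (hz : z ∈ A.targetSub) (hz' : z' ∈ A.targetSub)
    (φ : Module.Dual ℂ H) : κ (A.twist z z' φ) = κ φ ⊙ ι (Si z' ⬝ z) := by
  have hA := hS.isQuantumGroupoid
  have : A.twist z z' φ = A.twist z 𝟙 (A.twist 𝟙 z' φ) := by
    rw [hA.twist_twist, hA.one_mul, hA.one_mul]
  rw [this, hD.kappa_twist_left hS hz, hD.kappa_twist_right hS hz', hD.mul_assoc, hD.iota_mul]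

/-- The exchange relation solved for `κ χ ι k`. -/
theorem exchange_inv (k : H) (χ : Module.Dual ℂ H) :
    (sw (Δ k) fun a t => sw (Δ t) fun b c => ι b ⊙ κ (A.twist a (S c) χ)) = κ χ ⊙ ι k := by
  have hA := hS.isQuantumGroupoid
  simp only [hD.exchange, hA.twist_twist]
  rw [hA.sw_assoc₅ k (fun a a' b c c' => κ (A.twist (a ⬝ S a') (c ⬝ S c') χ) ⊙ ι b)
    (by fun_prop) (by fun_prop) (by fun_prop) (by fun_prop) (by fun_prop)]
  trans sw (Δ k) fun a t => sw (Δ t) fun b c => κ χ ⊙ ι (Si (A.epsT c) ⬝ (A.epsT a ⬝ b))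
  · refine sw_congr fun a t => sw_congr fun b c => ?_
    rw [← hA.mul_assoc, hD.iota_mul (_ ⬝ _), ← hD.mul_assoc,
      ← hD.kappa_twist hS (hA.epsT_mem a) (hA.epsT_mem c), epsT_eq a, epsT_eq c,
      (show Lin fun u => κ (A.twist u (sw (Δ c) fun a b => a ⬝ S b) χ) ⊙ ι b by fun_prop).map_sw]
    refine sw_congr fun a₁ a₂ => ?_
    rw [(show Lin fun u => κ (A.twist (a₁ ⬝ S a₂) u χ) ⊙ ι b by fun_prop).map_sw]
  rw [← hA.sw_assoc k (fun a b c => κ χ ⊙ ι (Si (A.epsT c) ⬝ (A.epsT a ⬝ b))) (by fun_prop)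
    (by fun_prop) (by fun_prop)]
  refine (sw_congr fun u c => hA.sw_epsT_mul u (fun v => κ χ ⊙ ι (Si (A.epsT c) ⬝ v))
    (by fun_prop)).trans ?_
  exact hS.sw_antipodeInv_epsT_mul k (fun u => κ χ ⊙ ι u) (by fun_prop)

/-! ### The counit -/

theorem counit_iota_kappa_iota (h g : H) (φ : Module.Dual ℂ H) :
    D.counit (ι h ⊙ (κ φ ⊙ ι g)) = φ (A.epsS h ⬝ A.epsT g) := by
  have hA := hS.isQuantumGroupoid
  rw [← hD.mul_assoc, hD.exchange]
  simp only [sw_apply, map_sw, hD.mul_assoc, ← hD.iota_mul, hD.counit_kappa_iota, twist_apply,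
    hA.epsT_mul]
  rw [hA.sw_assoc₄ h (fun a b c d => φ (S a ⬝ (b ⬝ A.epsT g ⬝ S c ⬝ d))) (by fun_prop)
    (by fun_prop) (by fun_prop) (by fun_prop)]
  trans sw (Δ h) fun u v => φ (A.epsS u ⬝ (A.epsS v ⬝ A.epsT g))
  · refine sw_congr fun u v => ?_
    rw [← hA.target_comm_source (hA.epsT_mem g) (hA.epsS_mem v), epsS_eq u, epsS_eq v,
      (show Lin fun w => φ (w ⬝ (A.epsT g ⬝ sw (Δ v) fun a b => S a ⬝ b)) by fun_prop).map_sw]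
    simp only [map_sw, hA.mul_assoc]
  rw [hA.sw_epsS_right h (fun u v => φ (A.epsS u ⬝ (v ⬝ A.epsT g)))]
  trans sw (Δ 𝟙) fun a b => φ (A.epsS h ⬝ (a ⬝ S b ⬝ A.epsT g))
  · refine hA.sw_one_congr fun a ha b _ => ?_
    rw [hA.epsS_mul_source ha, hA.mul_assoc, hA.mul_assoc]
  · rw [← (show Lin fun u => φ (A.epsS h ⬝ (u ⬝ A.epsT g)) by fun_prop).map_sw,
      hA.one_mul_antipode, hA.one_mul]

theorem counit_iota (h : H) : D.counit (ι h) = ε h := by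
  have hA := hS.isQuantumGroupoid
  rw [← hD.one_mul hS (ι h), ← hD.kappa_one, hD.counit_kappa_iota, ← hA.one_mul (A.epsT h),
    hA.counit_mul_epsT, hA.one_mul]

theorem counit_iota_mul (h : H) (w : V) : D.counit (ι h ⊙ w) = D.counit (ι (A.epsS h) ⊙ w) := by
  have hA := hS.isQuantumGroupoid
  refine hD.lin_ext (fun w => D.counit (ι h ⊙ w))
    (fun w => D.counit (ι (A.epsS h) ⊙ w)) w (fun φ g => ?_)
  rw [hD.counit_iota_kappa_iota hS, hD.counit_iota_kappa_iota hS, hA.epsS_source (hA.epsS_mem h)]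

theorem counit_kappa_mul (φ : Module.Dual ℂ H) (w : V) :
    D.counit (κ φ ⊙ w) = sw (Δ 𝟙) fun c d => φ d * D.counit (ι c ⊙ w) := by
  have hA := hS.isQuantumGroupoid
  refine hD.lin_ext (fun w => D.counit (κ φ ⊙ w))
    (fun w => sw (Δ 𝟙) fun c d => φ d * D.counit (ι c ⊙ w)) w (fun ψ g => ?_)
  rw [← hD.mul_assoc, ← hD.kappa_mul, hD.counit_kappa_iota, dual_mul_apply,
    hA.sw_comul_target' (hA.epsT_mem g) _ (by fun_prop) (by fun_prop)]
  refine hA.sw_one_congr fun c hc d _ => ?_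
  rw [hD.counit_iota_kappa_iota hS, hA.epsS_source hc, mul_comm]

/-- As far as the counit of products is concerned, a left factor may be taken in `ι(H_s)`. -/
theorem exists_source (x : V) :
    ∃ a ∈ A.sourceSub, ∀ w, D.counit (x ⊙ w) = D.counit (ι a ⊙ w) := by
  obtain ⟨t, rfl⟩ := hD.exists_tensor x
  refine ⟨A.epsS (sw t fun φ h => sw (Δ 𝟙) fun c d => φ d • (c ⬝ h)), ⟨_, rfl⟩, fun w => ?_⟩
  rw [← hD.counit_iota_mul hS,
    (show Lin fun u => D.counit (u ⊙ w) by fun_prop).map_sw,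
    (show Lin fun u => D.counit (ι u ⊙ w) by fun_prop).map_sw]
  refine sw_congr fun φ h => ?_
  rw [(show Lin fun u => D.counit (ι u ⊙ w) by fun_prop).map_sw, hD.mul_assoc,
    hD.counit_kappa_mul hS]
  refine sw_congr fun c d => ?_
  rw [map_smul, map_smul, LinearMap.smul_apply, map_smul, smul_eq_mul, hD.iota_mul, hD.mul_assoc]

/-- As far as the counit of products is concerned, a right factor may be taken in `ι(H_t)`. -/
theorem exists_target (x : V) :
    ∃ b ∈ A.targetSub, ∀ w, D.counit (w ⊙ x) = D.counit (w ⊙ ι b) := by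
  have hA := hS.isQuantumGroupoid
  obtain ⟨t, rfl⟩ := hD.exists_tensor x
  refine ⟨A.epsT (sw t fun φ g => sw (Δ 𝟙) fun c d => φ (c ⬝ A.epsT g) • d), ⟨_, rfl⟩, fun w => ?_⟩
  obtain ⟨a, ha, h⟩ := hD.exists_source hS w
  rw [h, h, ← hD.iota_mul, hD.counit_iota hS, hA.counit_mul_epsT]
  simp only [map_sw]
  refine sw_congr fun φ g => ?_
  rw [hD.counit_iota_kappa_iota hS, hA.epsS_source ha]
  conv_lhs => rw [← hA.epsS_source ha, hA.epsS_eq',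
    (show Lin fun u => φ (u ⬝ A.epsT g) by fun_prop).map_sw]
  refine sw_congr fun c d => ?_
  rw [map_smul, map_smul, map_smul, LinearMap.smul_apply, map_smul, smul_eq_mul, smul_eq_mul,
    mul_comm]

theorem sw_counit_mul_left (f g h : V) :
    D.counit (f ⊙ g ⊙ h) = sw (D.comul g) fun x y => D.counit (f ⊙ x) * D.counit (y ⊙ h) := by
  have hA := hS.isQuantumGroupoid
  obtain ⟨a, ha, hfa⟩ := hD.exists_source hS f
  obtain ⟨b, hb, hhb⟩ := hD.exists_target hS h
  simp only [hD.mul_assoc, hfa, hhb]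
  simp only [← hD.mul_assoc, hhb]
  refine hD.lin_ext (fun g => D.counit (ι a ⊙ g ⊙ ι b))
    (fun g => sw (D.comul g) fun x y => D.counit (ι a ⊙ x) * D.counit (y ⊙ ι b)) g (fun φ k => ?_)
  simp (disch := fun_prop) only [hD.comul_kappa_iota, sw_of_sw, sw_of_tmul, hD.mul_assoc,
    ← hD.iota_mul, hD.counit_kappa_iota, hD.counit_iota_kappa_iota hS, hA.epsS_source ha]
  rw [sw_sw_comm]
  simp only [sw_dual_comul]
  rw [hA.sw_epsT_left k (fun u v => φ (a ⬝ u ⬝ A.epsT (v ⬝ b))) (by fun_prop) (by fun_prop)]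
  trans sw (Δ 𝟙) fun c d => φ (a ⬝ (S c ⬝ d ⬝ A.epsT (k ⬝ b)))
  · rw [hA.sw_antipode_one (fun u => φ (a ⬝ (u ⬝ A.epsT (k ⬝ b)))) (by fun_prop), hA.one_mul]
  · refine hA.sw_one_congr fun c _ d hd => ?_
    rw [hA.mul_assoc d, hA.epsT_target_mul hd]
    simp only [hA.mul_assoc]

theorem sw_counit_mul_right (f g h : V) :
    D.counit (f ⊙ g ⊙ h) = sw (D.comul g) fun x y => D.counit (f ⊙ y) * D.counit (x ⊙ h) := by
  have hA := hS.isQuantumGroupoid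
  obtain ⟨a, ha, hfa⟩ := hD.exists_source hS f
  obtain ⟨b, hb, hhb⟩ := hD.exists_target hS h
  simp only [hD.mul_assoc, hfa, hhb]
  simp only [← hD.mul_assoc, hhb]
  refine hD.lin_ext (fun g => D.counit (ι a ⊙ g ⊙ ι b))
    (fun g => sw (D.comul g) fun x y => D.counit (ι a ⊙ y) * D.counit (x ⊙ ι b)) g (fun φ k => ?_)
  simp (disch := fun_prop) only [hD.comul_kappa_iota, sw_of_sw, sw_of_tmul, hD.mul_assoc,
    ← hD.iota_mul, hD.counit_kappa_iota, hD.counit_iota_kappa_iota hS, hA.epsS_source ha]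
  rw [sw_sw_comm]
  have hsw (x y : H) : (sw (Δ' φ) fun p r => r y * p x) = φ (x ⬝ y) := by
    rw [← sw_dual_comul]
    exact sw_congr fun _ _ => mul_comm _ _
  simp only [hsw]
  rw [← hA.sw_mul_target hb k (fun u v => φ (A.epsT u ⬝ (a ⬝ A.epsT v))) (by fun_prop)
    (by fun_prop)]
  refine (hA.sw_epsT_mul_epsT (k ⬝ b) (fun u => φ (a ⬝ u)) (by fun_prop)).symm.trans
    (sw_congr fun u v => ?_)
  rw [← hA.mul_assoc, ← hA.mul_assoc, hA.target_comm_source (hA.epsT_mem u) ha]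

end IsDouble

theorem mulTwo_tmul (B : QGData V) (x y x' y' : V) :
    B.mulTwo (x ⊗ₜ[ℂ] y) (x' ⊗ₜ[ℂ] y') = B.mul x x' ⊗ₜ[ℂ] B.mul y y' := by
  rw [mulTwo, TensorProduct.map₂_apply_tmul, TensorProduct.map_tmul]

theorem bilin_sw_sw {V₁ W₁ V₂ W₂ X Y Z : Type*} [AddCommMonoid V₁] [Module ℂ V₁] [AddCommMonoid W₁]
    [Module ℂ W₁] [AddCommMonoid V₂] [Module ℂ V₂] [AddCommMonoid W₂] [Module ℂ W₂]
    [AddCommMonoid X] [Module ℂ X] [AddCommMonoid Y] [Module ℂ Y] [AddCommMonoid Z] [Module ℂ Z]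
    (B : X →ₗ[ℂ] Y →ₗ[ℂ] Z) (t : V₁ ⊗[ℂ] W₁) (s : V₂ ⊗[ℂ] W₂) (f : V₁ → W₁ → X) (g : V₂ → W₂ → Y) :
    B (sw t f) (sw s g) = sw t fun a b => sw s fun c d => B (f a b) (g c d) := by
  rw [QGData.map_sw B, sw_apply]
  simp only [map_sw]

/-- A sixfold coproduct whose third and fourth factors are joined by `x ↦ x₁ S(x₂)`. -/
theorem IsQuantumGroupoid.sw_assoc₆ (hA : A.IsQuantumGroupoid) (h : H) (f : H → H → H → H → H → U)
    (h1 : ∀ b c d e, Lin fun a => f a b c d e) (h2 : ∀ a c d e, Lin fun b => f a b c d e)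
    (h3 : ∀ a b d e, Lin fun c => f a b c d e) (h4 : ∀ a b c e, Lin fun d => f a b c d e)
    (h5 : ∀ a b c d, Lin fun e => f a b c d e) :
    (sw (Δ h) fun u v => sw (Δ u) fun a t => sw (Δ t) fun b c => sw (Δ v) fun a' t' =>
      sw (Δ t') fun b' c' => f a b (c ⬝ S a') b' c') =
    sw (Δ h) fun a s => sw (Δ s) fun b u => sw (Δ u) fun e t' => sw (Δ t') fun b' c' =>
      f a b (A.epsT e) b' c' := by
  rw [hA.sw_assoc h (fun a t v => sw (Δ t) fun b c => sw (Δ v) fun a' t' =>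
    sw (Δ t') fun b' c' => f a b (c ⬝ S a') b' c') (by fun_prop) (by fun_prop) (by fun_prop)]
  refine sw_congr fun a s => ?_
  rw [hA.sw_assoc s (fun b c v => sw (Δ v) fun a' t' =>
    sw (Δ t') fun b' c' => f a b (c ⬝ S a') b' c') (by fun_prop) (by fun_prop) (by fun_prop)]
  refine sw_congr fun b u => ?_
  rw [← hA.sw_assoc u (fun c a' t' => sw (Δ t') fun b' c' => f a b (c ⬝ S a') b' c') (by fun_prop)
    (by fun_prop) (by fun_prop)]
  refine sw_congr fun e t' => ?_
  rw [epsT_eq, (show Lin fun w => sw (Δ t') fun b' c' => f a b w b' c' by fun_prop).map_sw]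

/-- `φ₁(a · c) ⊗ φ₂(a' · c') = φ₁(a ·) ⊗ φ₂(c a' · c')`. -/
theorem sw_dual_comul_twist_move (hA : A.IsQuantumGroupoid) (a c a' c' : H) (φ : Module.Dual ℂ H)
    (f : Module.Dual ℂ H → Module.Dual ℂ H → U)
    (hl : ∀ b, Lin fun a => f a b) (hr : ∀ a, Lin fun b => f a b) :
    (sw (Δ' φ) fun p r => f (A.twist a c p) (A.twist a' c' r)) =
      sw (Δ' φ) fun p r => f (A.twist a 𝟙 p) (A.twist (c ⬝ a') c' r) := by
  rw [← sw_of_map (A.twist a c) (A.twist a' c') _ _ hl hr,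
    ← sw_of_map (A.twist a 𝟙) (A.twist (c ⬝ a') c') _ _ hl hr]
  congr 1
  refine dual_tmul_dual_ext fun x y => ?_
  rw [sw_of_map _ _ _ _ (by fun_prop) (by fun_prop), sw_of_map _ _ _ _ (by fun_prop) (by fun_prop)]
  simp only [twist_apply, hA.mul_one]
  rw [sw_dual_comul, sw_dual_comul]
  simp only [hA.mul_assoc]

theorem sw_dual_comul_comp_antipodeInv (hS : A.IsStarQuantumGroupoid st) (φ : Module.Dual ℂ H)
    (f : Module.Dual ℂ H → Module.Dual ℂ H → U)
    (hl : ∀ b, Lin fun a => f a b) (hr : ∀ a, Lin fun b => f a b) :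
    sw (Δ' (φ ∘ₗ Si)) f = sw (Δ' φ) fun α β => f (β ∘ₗ Si) (α ∘ₗ Si) := by
  rw [← sw_of_comm (Δ' φ) (fun β α => f (β ∘ₗ Si) (α ∘ₗ Si)) (by fun_prop) (by fun_prop)]
  refine Eq.trans ?_ (sw_of_map A.antipodeInv.dualMap A.antipodeInv.dualMap _ f hl hr)
  congr 1
  refine dual_tmul_dual_ext fun x y => ?_
  rw [sw_dual_comul, sw_of_map _ _ _ _ (by fun_prop) (by fun_prop),
    sw_of_comm _ _ (by fun_prop) (by fun_prop), LinearMap.comp_apply, hS.antipodeInv_mul,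
    ← sw_dual_comul]
  exact sw_congr fun _ _ => mul_comm _ _

theorem dual_mul_comp_antipodeInv (hS : A.IsStarQuantumGroupoid st) (φ ψ : Module.Dual ℂ H) :
    (φ ⋆ ψ) ∘ₗ Si = (ψ ∘ₗ Si) ⋆ (φ ∘ₗ Si) := by
  ext x
  rw [LinearMap.comp_apply, dual_mul_apply, dual_mul_apply,
    hS.sw_comul_antipodeInv _ _ (by fun_prop) (by fun_prop)]
  exact sw_congr fun a b => mul_comm _ _

namespace IsDouble

variable (hD : A.IsDouble D ι κ)
include hD

theorem mulTwo_assoc (r s t : V ⊗[ℂ] V) :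
    D.mulTwo (D.mulTwo r s) t = D.mulTwo r (D.mulTwo s t) := by
  rw [← sw_self r]
  simp only [map_sw, sw_apply]
  refine sw_congr fun a b => ?_
  rw [← sw_self s]
  simp only [map_sw, sw_apply, mulTwo_tmul]
  refine sw_congr fun a' b' => ?_
  rw [← sw_self t]
  simp only [map_sw, mulTwo_tmul, hD.mul_assoc]

theorem comul_one : D.comul D.one = sw (Δ 𝟙) fun a b => ι a ⊗ₜ[ℂ] ι b := by
  rw [← hD.iota_one, hD.comul_iota]

variable (hS : A.IsStarQuantumGroupoid st)
include hS

/-! ### The comultiplication is multiplicative -/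

theorem comul_kappa_mul (φ : Module.Dual ℂ H) (w : V) :
    D.comul (κ φ ⊙ w) = D.mulTwo (D.comul (κ φ)) (D.comul w) := by
  have hA := hS.isQuantumGroupoid
  refine hD.lin_ext (fun w => D.comul (κ φ ⊙ w)) (fun w => D.mulTwo (D.comul (κ φ)) (D.comul w)) w
    (fun ψ h => ?_)
  rw [← hD.mul_assoc, ← hD.kappa_mul, hD.comul_kappa_iota, hD.comul_kappa, hD.comul_kappa_iota,
    (dual_isQuantumGroupoid hA).sw_comul_mul ψ φ _ (by fun_prop) (by fun_prop), sw_sw_comm,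
    bilin_sw_sw]
  refine sw_congr fun p r => ?_
  simp only [map_sw, mulTwo_tmul, hD.kappa_mul, hD.mul_assoc]

/-- Applied to `κ(ψ) ι(g)`, both sides are sums over a coproduct of `h`. In `Δ(ι h) Δ(κ ψ)` the
exchange relation is used in both legs, and the two factors of `h` that meet between the legs of
`ψ` combine to `x₁ S(x₂) = ε_t(x)`, which `κ` absorbs. -/
theorem comul_iota_mul (h : H) (w : V) :
    D.comul (ι h ⊙ w) = D.mulTwo (D.comul (ι h)) (D.comul w) := by
  have hA := hS.isQuantumGroupoid
  refine hD.lin_ext (fun w => D.comul (ι h ⊙ w)) (fun w => D.mulTwo (D.comul (ι h)) (D.comul w)) w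
    (fun ψ g => ?_)
  let F (a b e b' c' : H) := sw (Δ' ψ) fun p r => sw (Δ g) fun g₁ g₂ =>
    (κ (A.twist (S a) 𝟙 p) ⊙ ι (b ⬝ g₁)) ⊗ₜ[ℂ] (κ (A.twist e c' r) ⊙ ι (b' ⬝ g₂))
  trans sw (Δ h) fun u v => sw (Δ u) fun a t => sw (Δ t) fun b c => sw (Δ v) fun a' t' =>
      sw (Δ t') fun b' c' => F a b (c ⬝ S a') b' c'
  · rw [hA.sw_assoc₆ h F (by fun_prop) (by fun_prop) (by fun_prop) (by fun_prop) (by fun_prop),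
      ← hD.mul_assoc, hD.exchange]
    simp only [sw_apply, map_sw, hD.mul_assoc, ← hD.iota_mul, hD.comul_kappa_iota]
    refine sw_congr fun a t => ?_
    trans sw (Δ t) fun b u => sw (Δ u) fun w c => F a b 𝟙 w c
    · rw [← hA.sw_assoc t (fun b w c => F a b 𝟙 w c) (by fun_prop) (by fun_prop) (by fun_prop)]
      refine sw_congr fun b c => ?_
      rw [sw_dual_comul_twist ψ _ _ _ (by fun_prop) (by fun_prop) hA]
      simp (disch := fun_prop) only [hA.sw_comul_mul]
      rw [sw_sw_comm]
    · refine sw_congr fun b u => ?_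
      rw [← hA.sw_assoc u (fun e b' c' => F a b (A.epsT e) b' c') (by fun_prop) (by fun_prop)
        (by fun_prop)]
      refine sw_congr fun w c => ?_
      rw [← hA.sw_epsT_mul w (fun w => F a b 𝟙 w c) (by fun_prop)]
      refine sw_congr fun e b' => ?_
      refine sw_congr fun p r => sw_congr fun g₁ g₂ => ?_
      have : A.twist (A.epsT e) c r = A.twist (A.epsT e) 𝟙 (A.twist 𝟙 c r) := by
        rw [hA.twist_twist, hA.one_mul, hA.one_mul]
      rw [this, hD.kappa_twist_left hS (hA.epsT_mem e), hD.mul_assoc, ← hD.iota_mul, hA.mul_assoc]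
  · rw [hD.comul_iota, hD.comul_kappa_iota]
    simp only [map_sw, sw_apply, mulTwo_tmul, ← hD.mul_assoc, hD.exchange]
    simp only [sw_sw_comm _ (Δ h)]
    refine sw_congr fun u v => ?_
    simp only [sw_tmul, tmul_sw, hD.mul_assoc, ← hD.iota_mul]
    simp only [sw_sw_comm _ (Δ u)]
    refine sw_congr fun a t => ?_
    simp only [sw_sw_comm _ (Δ t)]
    refine sw_congr fun b c => ?_
    simp only [sw_sw_comm _ (Δ v)]
    refine sw_congr fun a' t' => ?_
    simp only [sw_sw_comm _ (Δ t')]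
    refine sw_congr fun b' c' => ?_
    exact (sw_dual_comul_twist_move hA (S a) c (S a') c' ψ (fun p r => sw (Δ g) fun g₁ g₂ =>
      (κ p ⊙ ι (b ⬝ g₁)) ⊗ₜ[ℂ] (κ r ⊙ ι (b' ⬝ g₂))) (by fun_prop) (by fun_prop)).symm

theorem comul_mul (x w : V) : D.comul (x ⊙ w) = D.mulTwo (D.comul x) (D.comul w) := by
  refine hD.lin_ext (fun x => D.comul (x ⊙ w)) (fun x => D.mulTwo (D.comul x) (D.comul w)) x
    (fun φ h => ?_)
  rw [hD.mul_assoc, hD.comul_kappa_mul hS, hD.comul_iota_mul hS, hD.comul_kappa_mul hS,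
    hD.mulTwo_assoc]

/-! ### The antipode -/

theorem antipode_iota (h : H) : D.antipode (ι h) = ι (S h) := by
  have : ε ∘ₗ Si = ε := LinearMap.ext fun x => hS.counit_antipodeInv x
  rw [← hD.one_mul hS (ι h), ← hD.kappa_one, hD.antipode_kappa_iota, this, hD.kappa_one,
    hD.mul_one hS]

theorem antipode_kappa_mul (φ : Module.Dual ℂ H) (w : V) :
    D.antipode (κ φ ⊙ w) = D.antipode w ⊙ κ (φ ∘ₗ Si) := by
  refine hD.lin_ext (fun w => D.antipode (κ φ ⊙ w)) (fun w => D.antipode w ⊙ κ (φ ∘ₗ Si)) w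
    (fun ψ h => ?_)
  rw [← hD.mul_assoc, ← hD.kappa_mul, hD.antipode_kappa_iota, hD.antipode_kappa_iota,
    dual_mul_comp_antipodeInv hS, hD.kappa_mul, hD.mul_assoc]

theorem antipode_iota_mul (h : H) (w : V) :
    D.antipode (ι h ⊙ w) = D.antipode w ⊙ ι (S h) := by
  have hA := hS.isQuantumGroupoid
  refine hD.lin_ext (fun w => D.antipode (ι h ⊙ w)) (fun w => D.antipode w ⊙ ι (S h)) w
    (fun ψ g => ?_)
  rw [← hD.mul_assoc, hD.exchange, hD.antipode_kappa_iota, hD.mul_assoc,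
    ← hD.exchange_inv hS (S h) (ψ ∘ₗ Si), hA.sw_comul_antipode _ _ (by fun_prop) (by fun_prop)]
  simp (disch := fun_prop) only [hA.sw_comul_antipode]
  simp only [sw_apply, map_sw, hD.mul_assoc, ← hD.iota_mul, hD.antipode_kappa_iota,
    hA.antipode_mul]
  rw [← hA.sw_assoc h (fun a b c => ι (S g ⬝ S b) ⊙ κ (A.twist (S a) c ψ ∘ₗ Si)) (by fun_prop)
    (by fun_prop) (by fun_prop)]
  refine sw_congr fun t c => sw_congr fun a b => ?_
  rw [hD.iota_mul, hD.mul_assoc]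
  congr 3
  ext x
  simp only [LinearMap.comp_apply, twist_apply, hS.antipodeInv_mul, hS.antipodeInv_antipode,
    hA.mul_assoc]

theorem antipode_mul (x w : V) : D.antipode (x ⊙ w) = D.antipode w ⊙ D.antipode x := by
  refine hD.lin_ext (fun x => D.antipode (x ⊙ w)) (fun x => D.antipode w ⊙ D.antipode x) x
    (fun φ h => ?_)
  rw [hD.mul_assoc, hD.antipode_kappa_mul hS, hD.antipode_iota_mul hS, hD.antipode_kappa_iota,
    hD.mul_assoc]

theorem comul_antipode (x : V) :
    D.comul (D.antipode x) = sw (D.comul x) fun a b => D.antipode b ⊗ₜ[ℂ] D.antipode a := by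
  have hA := hS.isQuantumGroupoid
  refine hD.lin_ext (fun x => D.comul (D.antipode x))
    (fun x => sw (D.comul x) fun a b => D.antipode b ⊗ₜ[ℂ] D.antipode a) x (fun φ h => ?_)
  have hφ : D.comul (κ (φ ∘ₗ Si)) = sw (Δ' φ) fun α β => κ (β ∘ₗ Si) ⊗ₜ[ℂ] κ (α ∘ₗ Si) := by
    rw [hD.comul_kappa, sw_dual_comul_comp_antipodeInv hS _ _ (by fun_prop) (by fun_prop)]
  simp (disch := fun_prop) only [hD.comul_kappa_iota, sw_of_sw, sw_of_tmul, hD.antipode_kappa_iota,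
    hD.comul_mul hS, hφ, hD.comul_iota, hA.sw_comul_antipode]
  rw [bilin_sw_sw, sw_sw_comm]
  simp only [mulTwo_tmul]

/-! ### The counital maps -/

/-- The target counital map of the double. -/
theorem sw_comul_antipode_right (x : V) : (sw (D.comul x) fun a b => a ⊙ D.antipode b) =
    sw (Δ 𝟙) fun c d => D.counit (ι c ⊙ x) • ι d := by
  have hA := hS.isQuantumGroupoid
  refine hD.lin_ext (fun x => sw (D.comul x) fun a b => a ⊙ D.antipode b)
    (fun x => sw (Δ 𝟙) fun c d => D.counit (ι c ⊙ x) • ι d) x (fun φ h => ?_)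
  have key : (sw (Δ' φ) fun α β => (β ∘ₗ Si) ⋆ A.twist (A.epsT h) 𝟙 α) =
      sw (Δ 𝟙) fun c d => φ (c ⬝ A.epsT h) • A.counitL d := by
    ext x
    simp only [sw_apply, dual_mul_apply, LinearMap.comp_apply, twist_apply, hA.mul_one]
    rw [sw_sw_comm]
    trans φ (A.epsT h ⬝ sw (Δ x) fun a b => b ⬝ Si a)
    · simp only [map_sw]
      refine sw_congr fun a b => ?_
      rw [← hA.mul_assoc, ← sw_dual_comul]
      exact sw_congr fun _ _ => mul_comm _ _
    · rw [hS.sw_mul_antipodeInv]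
      simp only [map_sw, map_smul]
      refine hA.sw_one_congr fun c hc d _ => ?_
      rw [hA.target_comm_source (hA.epsT_mem h) hc, LinearMap.smul_apply, counitL_apply,
        smul_eq_mul, smul_eq_mul, mul_comm]
  trans sw (Δ' φ) fun α β => κ ((β ∘ₗ Si) ⋆ A.twist (A.epsT h) 𝟙 α)
  · simp (disch := fun_prop) only [hD.comul_kappa_iota, sw_of_sw, sw_of_tmul,
      hD.antipode_kappa_iota]
    refine sw_congr fun α β => ?_
    rw [hD.kappa_mul, hD.kappa_twist_left hS (hA.epsT_mem h), epsT_eq]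
    simp only [map_sw, sw_apply]
    refine sw_congr fun a b => ?_
    rw [hD.iota_mul]
    simp only [hD.mul_assoc]
  · rw [← map_sw, key, map_sw]
    refine hA.sw_one_congr fun c hc d hd => ?_
    rw [hD.counit_iota_kappa_iota hS, hA.epsS_source hc, map_smul, hD.iota_target d hd]

/-- The source counital map of the double. -/
theorem sw_comul_antipode_left (x : V) : (sw (D.comul x) fun a b => D.antipode a ⊙ b) =
    sw (Δ 𝟙) fun c d => D.counit (x ⊙ ι d) • ι c := by
  have hA := hS.isQuantumGroupoid
  refine hD.lin_ext (fun x => sw (D.comul x) fun a b => D.antipode a ⊙ b)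
    (fun x => sw (Δ 𝟙) fun c d => D.counit (x ⊙ ι d) • ι c) x (fun φ h => ?_)
  have key : (sw (Δ' φ) fun α β => β ⋆ (α ∘ₗ Si)) = sw (Δ 𝟙) fun c d => φ d • A.counitR c := by
    ext x
    simp only [sw_apply, dual_mul_apply, LinearMap.comp_apply]
    rw [sw_sw_comm]
    trans φ (sw (Δ x) fun a b => Si b ⬝ a)
    · simp only [map_sw]
      refine sw_congr fun a b => ?_
      rw [← sw_dual_comul]
      exact sw_congr fun _ _ => mul_comm _ _
    · rw [hS.sw_antipodeInv_mul]
      simp only [map_sw, map_smul]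
      refine sw_congr fun c d => ?_
      rw [LinearMap.smul_apply, counitR_apply, smul_eq_mul, smul_eq_mul, mul_comm]
  have key' : κ (sw (Δ' φ) fun α β => β ⋆ (α ∘ₗ Si)) = sw (Δ 𝟙) fun c d => φ d • ι c := by
    rw [key, map_sw]
    refine hA.sw_one_congr fun c hc d hd => ?_
    rw [map_smul, hD.iota_source c hc]
  trans sw (Δ h) fun a b => ι (S a) ⊙ (κ (sw (Δ' φ) fun α β => β ⋆ (α ∘ₗ Si)) ⊙ ι b)
  · simp (disch := fun_prop) only [hD.comul_kappa_iota, sw_of_sw, sw_of_tmul,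
      hD.antipode_kappa_iota]
    rw [sw_sw_comm]
    refine sw_congr fun a b => ?_
    simp only [map_sw, sw_apply]
    refine sw_congr fun α β => ?_
    rw [hD.kappa_mul]
    simp only [hD.mul_assoc]
  · simp only [key', map_sw, sw_apply, map_smul, LinearMap.smul_apply, ← hD.iota_mul, hD.mul_assoc,
      hD.counit_kappa_iota]
    trans sw (Δ h) fun a t => sw (Δ t) fun b c => φ (A.epsT c) • ι (S a ⬝ b)
    · refine sw_congr fun a t => ?_
      exact (hA.sw_epsT_right t (fun b c => φ c • ι (S a ⬝ b))).symm
    rw [← hA.sw_assoc h (fun a b c => φ (A.epsT c) • ι (S a ⬝ b)) (by fun_prop) (by fun_prop)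
      (by fun_prop), ← hA.sw_epsS_left h (fun c d => φ (A.epsT d) • ι c)]
    refine sw_congr fun u c => ?_
    rw [epsS_eq, map_sw, smul_sw]

/-! ### The axioms of a quantum groupoid -/

theorem isQuantumGroupoid : D.IsQuantumGroupoid where
  finite := hD.finite
  mul_assoc := hD.mul_assoc
  one_mul := hD.one_mul hS
  mul_one := hD.mul_one hS
  coassoc x := by
    have hA := hS.isQuantumGroupoid
    have hdual := dual_isQuantumGroupoid hA
    refine hD.lin_ext
      (fun x => TensorProduct.assoc ℂ V V V (TensorProduct.map D.comul LinearMap.id (D.comul x)))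
      (fun x => TensorProduct.map LinearMap.id D.comul (D.comul x)) x (fun φ h => ?_)
    let F (α β γ : Module.Dual ℂ H) (a b c : H) :=
      (κ α ⊙ ι a) ⊗ₜ[ℂ] ((κ β ⊙ ι b) ⊗ₜ[ℂ] (κ γ ⊙ ι c))
    trans sw (Δ' φ) fun α s => sw (Δ' s) fun β γ => sw (Δ h) fun a t => sw (Δ t) fun b c =>
      F α β γ a b c
    · rw [← hdual.sw_assoc φ (fun α β γ => sw (Δ h) fun a t => sw (Δ t) fun b c => F α β γ a b c)
        (by fun_prop) (by fun_prop) (by fun_prop)]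
      simp only [hD.comul_kappa_iota, map_sw, equiv_sw, TensorProduct.map_tmul, sw_tmul,
        TensorProduct.assoc_tmul, LinearMap.id_apply]
      refine sw_congr fun s γ => ?_
      rw [sw_sw_comm]
      refine sw_congr fun α β => ?_
      exact hA.sw_assoc h (fun a b c => F α β γ a b c) (by fun_prop) (by fun_prop) (by fun_prop)
    · simp only [hD.comul_kappa_iota, map_sw, TensorProduct.map_tmul, tmul_sw, LinearMap.id_apply]
      refine sw_congr fun α s => ?_
      rw [sw_sw_comm]
  counit_left x := by
    have hA := hS.isQuantumGroupoid
    rw [map_eq_sw, equiv_sw]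
    simp only [TensorProduct.lid_tmul, LinearMap.id_apply]
    refine hD.lin_ext (fun x => sw (D.comul x) fun a b => D.counit a • b) (fun x => x) x
      (fun φ h => ?_)
    simp (disch := fun_prop) only [hD.comul_kappa_iota, sw_of_sw, sw_of_tmul, hD.counit_kappa_iota]
    rw [sw_sw_comm, ← hA.sw_epsT_mul h (fun u => κ φ ⊙ ι u) (by fun_prop)]
    refine sw_congr fun a b => ?_
    have h1 : A.twist (A.epsT a) 𝟙 φ = sw (Δ' φ) fun α β => α (A.epsT a) • β := by
      rw [sw_dual_comul_smul]
      ext x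
      simp only [twist_apply, hA.mul_one, LinearMap.comp_apply]
    rw [hD.iota_mul, ← hD.mul_assoc, ← hD.kappa_twist_left hS (hA.epsT_mem a), h1]
    simp only [map_sw, sw_apply, map_smul, LinearMap.smul_apply]
  counit_right x := by
    have hA := hS.isQuantumGroupoid
    rw [map_eq_sw, equiv_sw]
    simp only [TensorProduct.rid_tmul, LinearMap.id_apply]
    refine hD.lin_ext (fun x => sw (D.comul x) fun a b => D.counit b • a) (fun x => x) x
      (fun φ h => ?_)
    simp (disch := fun_prop) only [hD.comul_kappa_iota, sw_of_sw, sw_of_tmul, hD.counit_kappa_iota]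
    rw [sw_sw_comm, ← hS.sw_antipodeInv_epsT_mul h (fun u => κ φ ⊙ ι u) (by fun_prop)]
    refine sw_congr fun a b => ?_
    have h1 : A.twist 𝟙 (A.epsT b) φ = sw (Δ' φ) fun α β => β (A.epsT b) • α := by
      rw [sw_dual_comul_smul']
      ext x
      simp only [twist_apply, hA.one_mul, LinearMap.comp_apply, LinearMap.flip_apply]
    rw [hD.iota_mul, ← hD.mul_assoc, ← hD.kappa_twist_right hS (hA.epsT_mem b), h1]
    simp only [map_sw, sw_apply, map_smul, LinearMap.smul_apply]
  comul_mul := hD.comul_mul hS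
  comul_one_left := by
    have hA := hS.isQuantumGroupoid
    rw [mulThree_assoc_tmul, hD.comul_one]
    simp (disch := fun_prop) only [sw_of_sw, sw_of_tmul, map_sw, equiv_sw, TensorProduct.map_tmul,
      hD.comul_iota, sw_tmul, TensorProduct.assoc_tmul, LinearMap.id_apply, hD.mul_one hS,
      hD.one_mul hS, ← hD.iota_mul]
    rw [hA.sw_assoc 𝟙 (fun a b c => ι a ⊗ₜ[ℂ] (ι b ⊗ₜ[ℂ] ι c)) (by fun_prop) (by fun_prop)
      (by fun_prop)]
    exact hA.sw_one_left (fun a b c => ι a ⊗ₜ[ℂ] (ι b ⊗ₜ[ℂ] ι c)) (by fun_prop) (by fun_prop)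
      (by fun_prop)
  comul_one_right := by
    have hA := hS.isQuantumGroupoid
    rw [mulThree_tmul_assoc, hD.comul_one]
    simp (disch := fun_prop) only [sw_of_sw, sw_of_tmul, map_sw, equiv_sw, TensorProduct.map_tmul,
      hD.comul_iota, sw_tmul, TensorProduct.assoc_tmul, LinearMap.id_apply, hD.mul_one hS,
      hD.one_mul hS, ← hD.iota_mul]
    rw [hA.sw_assoc 𝟙 (fun a b c => ι a ⊗ₜ[ℂ] (ι b ⊗ₜ[ℂ] ι c)) (by fun_prop) (by fun_prop)
      (by fun_prop)]
    exact hA.sw_one_right (fun a b c => ι a ⊗ₜ[ℂ] (ι b ⊗ₜ[ℂ] ι c)) (by fun_prop) (by fun_prop)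
      (by fun_prop)
  counit_mul_left f g h := by
    rw [hD.sw_counit_mul_left hS, map_eq_sw, equiv_sw]
    rfl
  counit_mul_right f g h := by
    rw [hD.sw_counit_mul_right hS, map_eq_sw, equiv_sw, comulOp, LinearMap.comp_apply,
      LinearEquiv.coe_coe, sw_of_comm _ _ (by simp; fun_prop) (by simp; fun_prop)]
    rfl
  antipode_mul := hD.antipode_mul hS
  antipode_one := by
    rw [← hD.iota_one, hD.antipode_iota hS, hS.isQuantumGroupoid.antipode_one]
  comul_antipode x := by
    rw [hD.comul_antipode hS, map_eq_sw, comulOp, LinearMap.comp_apply,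
      LinearEquiv.coe_coe, sw_of_comm _ _ (by fun_prop) (by fun_prop)]
  counit_antipode x := by
    have hA := hS.isQuantumGroupoid
    refine hD.lin_ext (fun x => D.counit (D.antipode x)) (fun x => D.counit x) x (fun φ h => ?_)
    rw [hD.antipode_kappa_iota, hD.counit_kappa_iota, ← hD.mul_one hS (κ _), ← hD.iota_one,
      hD.counit_iota_kappa_iota hS, hA.epsT_target hA.one_mem_target, hA.mul_one, hA.epsS_antipode,
      LinearMap.comp_apply, hS.antipodeInv_antipode]
  antipode_target x := by
    refine (epsT_eq x).trans ((hD.sw_comul_antipode_right hS x).trans ?_)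
    rw [hD.comul_one]
    simp only [map_sw, sw_apply, equiv_sw, mulTwo_tmul, TensorProduct.map_tmul,
      TensorProduct.lid_tmul, LinearMap.id_apply, hD.mul_one hS]
  antipode_source x := by
    refine (epsS_eq x).trans ((hD.sw_comul_antipode_left hS x).trans ?_)
    rw [hD.comul_one]
    simp only [map_sw, equiv_sw, mulTwo_tmul, TensorProduct.map_tmul,
      TensorProduct.rid_tmul, LinearMap.id_apply, hD.one_mul hS]

end IsDouble

end AbstractDouble

noncomputable section RMatrix

variable {H : Type*} [AddCommGroup H] [Module ℂ H] [FiniteDimensional ℂ H] {A : QGData H}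
  {U : Type*} [AddCommMonoid U] [Module ℂ U] {st : H →ₛₗ[starRingEnd ℂ] H}
  {V : Type*} [AddCommGroup V] [Module ℂ V] {D : QGData V} {ι : H →ₗ[ℂ] V}
  {κ : Module.Dual ℂ H →ₗ[ℂ] V} {stD : V →ₛₗ[starRingEnd ℂ] V}

local notation:70 a:70 " ⬝ " b:71 => QGData.mul A a b
local notation:70 a:70 " ⊙ " b:71 => QGData.mul D a b
local notation:70 a:70 " ⋆ " b:71 => QGData.mul (QGData.dual A) a b
local notation "S" => QGData.antipode A
local notation "Si" => QGData.antipodeInv A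
local notation "Δ" => QGData.comul A
local notation "Δ'" => QGData.comul (QGData.dual A)
local notation "ε" => QGData.counit A
local notation "𝟙" => QGData.one A

/-! ### The canonical element -/

/-- The canonical element `∑ᵢ ξⁱ ⊗ fᵢ` of `Ĥ ⊗ H`. -/
def coev (H : Type*) [AddCommGroup H] [Module ℂ H] [FiniteDimensional ℂ H] :
    Module.Dual ℂ H ⊗[ℂ] H :=
  ∑ i, (Module.finBasis ℂ H).coord i ⊗ₜ[ℂ] Module.finBasis ℂ H i

local notation "θ" => QGData.coev H

/-- `∑ ⟨ξⁱ, x⟩ fᵢ = x`. -/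
theorem sw_coev_apply_smul (x : H) : (sw θ fun p u => p x • u) = x := by
  rw [coev, sw_eq_lift _ (by fun_prop) (by fun_prop), map_sum]
  exact (Module.finBasis ℂ H).sum_repr x

/-- An element of `Ĥ ⊗ W` is `∑ ξⁱ ⊗ F(fᵢ)` for the map `F` that it represents. -/
theorem sw_coev_eq {t : Module.Dual ℂ H ⊗[ℂ] U} {F : H → U} (hF : Lin F)
    (h : ∀ x, (sw t fun p u => p x • u) = F x) : (sw θ fun p u => p ⊗ₜ[ℂ] F u) = t := by
  refine dual_tmul_ext fun x => ?_
  rw [sw_of_sw _ _ _ (by fun_prop) (by fun_prop), h]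
  simp (disch := fun_prop) only [sw_of_tmul]
  conv_rhs => rw [← sw_coev_apply_smul x, hF.map_sw]
  simp only [hF.smul]

/-- A linear map acts on the second leg of the canonical element as its transpose does on the
first. -/
theorem sw_coev_comp (L : H →ₗ[ℂ] H) (f : Module.Dual ℂ H → H → U)
    (hl : ∀ b, Lin fun a => f a b) (hr : ∀ a, Lin fun b => f a b) :
    (sw θ fun p u => f (p ∘ₗ L) u) = sw θ fun p u => f p (L u) := by
  have h : (sw θ fun p u => p ⊗ₜ[ℂ] L u) = sw θ fun p u => (p ∘ₗ L) ⊗ₜ[ℂ] u := by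
    refine sw_coev_eq (by fun_prop) fun x => ?_
    rw [sw_of_sw _ _ _ (by fun_prop) (by fun_prop)]
    simp (disch := fun_prop) only [sw_of_tmul]
    exact sw_coev_apply_smul (L x)
  have := congrArg (fun t => sw t f) h
  simp (disch := fun_prop) only [sw_of_sw, sw_of_tmul] at this
  exact this.symm

theorem sw_coev_twist (a c : H) (f : Module.Dual ℂ H → H → U)
    (hl : ∀ b, Lin fun a => f a b) (hr : ∀ a, Lin fun b => f a b) :
    (sw θ fun p u => f (A.twist a c p) u) = sw θ fun p u => f p (a ⬝ (u ⬝ c)) :=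
  sw_coev_comp (A.mul a ∘ₗ A.mul.flip c) f hl hr

/-- `∑ ψ(fᵢ) ξⁱ = ψ`. -/
theorem sw_coev_smul (ψ : Module.Dual ℂ H) : (sw θ fun p u => ψ u • p) = ψ := by
  ext x
  conv_rhs => rw [← sw_coev_apply_smul x, map_sw]
  rw [sw_apply]
  exact sw_congr fun p u => by
    rw [LinearMap.smul_apply, map_smul, smul_eq_mul, smul_eq_mul, mul_comm]

/-- The coproduct of `H` on the second leg is given by the product of `Ĥ`. -/
theorem sw_coev_comul (f : Module.Dual ℂ H → H → H → U) (h1 : ∀ b c, Lin fun a => f a b c)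
    (h2 : ∀ a c, Lin fun b => f a b c) (h3 : ∀ a b, Lin fun c => f a b c) :
    (sw θ fun p u => sw (Δ u) fun a b => f p a b) =
      sw θ fun p u => sw θ fun p' u' => f (p ⋆ p') u u' := by
  have h : (sw θ fun p u => p ⊗ₜ[ℂ] Δ u) = sw θ fun p u => sw θ fun p' u' =>
      (p ⋆ p') ⊗ₜ[ℂ] (u ⊗ₜ[ℂ] u') := by
    refine sw_coev_eq (by fun_prop) fun x => ?_
    simp (disch := fun_prop) only [sw_of_sw, sw_of_tmul, dual_mul_apply, sw_smul]
    simp only [sw_sw_comm _ (Δ x)]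
    conv_rhs => rw [← sw_self (Δ x)]
    refine sw_congr fun a b => ?_
    conv_rhs => rw [← sw_coev_apply_smul a, ← sw_coev_apply_smul b, sw_tmul]
    refine sw_congr fun p u => ?_
    rw [tmul_sw]
    refine sw_congr fun p' u' => ?_
    rw [TensorProduct.tmul_smul, ← TensorProduct.smul_tmul', smul_smul, mul_comm]
  have := congrArg (fun t => sw t fun p s => sw s fun a b => f p a b) h
  simp (disch := fun_prop) only [sw_of_sw, sw_of_tmul] at this
  exact this

/-- The coproduct of `Ĥ` on the first leg is given by the product of `H`. -/
theorem sw_coev_dual_comul (f : Module.Dual ℂ H → Module.Dual ℂ H → H → U)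
    (h1 : ∀ b c, Lin fun a => f a b c)
    (h2 : ∀ a c, Lin fun b => f a b c) (h3 : ∀ a b, Lin fun c => f a b c) :
    (sw θ fun p u => sw (Δ' p) fun α β => f α β u) =
      sw θ fun p u => sw θ fun p' u' => f p p' (u ⬝ u') := by
  have h : (sw θ fun p u => p ⊗ₜ[ℂ] sw θ fun p' u' => p' ⊗ₜ[ℂ] (u ⬝ u')) =
      sw θ fun p u => sw (Δ' p) fun α β => α ⊗ₜ[ℂ] (β ⊗ₜ[ℂ] u) := by
    refine sw_coev_eq (F := fun u => sw θ fun p' u' => p' ⊗ₜ[ℂ] (u ⬝ u')) (by fun_prop) fun x => ?_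
    refine (sw_coev_eq (F := fun u' => x ⬝ u') (by fun_prop) fun y => ?_).symm
    simp (disch := fun_prop) only [sw_of_sw, sw_of_tmul, sw_of_smul, smul_smul]
    conv_rhs => rw [← sw_coev_apply_smul (x ⬝ y)]
    refine sw_congr fun p u => ?_
    rw [← sw_dual_comul, sw_smul]
  have := congrArg (fun t => sw t fun α s => sw s fun β u => f α β u) h
  simp (disch := fun_prop) only [sw_of_sw, sw_of_tmul] at this
  exact this.symm

/-! ### The `R`-matrix -/

theorem mulThree_tmul (x y z x' y' z' : V) :
    D.mulThree (x ⊗ₜ[ℂ] (y ⊗ₜ[ℂ] z)) (x' ⊗ₜ[ℂ] (y' ⊗ₜ[ℂ] z')) =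
      (x ⊙ x') ⊗ₜ[ℂ] ((y ⊙ y') ⊗ₜ[ℂ] (z ⊙ z')) := by
  rw [mulThree, TensorProduct.map₂_apply_tmul, TensorProduct.map_tmul, mulTwo_tmul]

namespace IsDouble

variable (hD : A.IsDouble D ι κ)
include hD

theorem comulOp_iota (h : H) : D.comulOp (ι h) = sw (Δ h) fun a b => ι b ⊗ₜ[ℂ] ι a := by
  rw [comulOp, LinearMap.comp_apply, hD.comul_iota, LinearEquiv.coe_coe, equiv_sw]
  rfl

theorem comulOp_kappa (φ : Module.Dual ℂ H) :
    D.comulOp (κ φ) = sw (Δ' φ) fun α β => κ β ⊗ₜ[ℂ] κ α := by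
  rw [comulOp, LinearMap.comp_apply, hD.comul_kappa, LinearEquiv.coe_coe, equiv_sw]
  rfl

theorem comulOp_one : D.comulOp D.one = sw (Δ 𝟙) fun a b => ι b ⊗ₜ[ℂ] ι a := by
  rw [← hD.iota_one, hD.comulOp_iota]

variable (hS : A.IsStarQuantumGroupoid st)
include hS

theorem comulOp_mul (x y : V) : D.comulOp (x ⊙ y) = D.mulTwo (D.comulOp x) (D.comulOp y) := by
  simp only [comulOp, LinearMap.comp_apply, LinearEquiv.coe_coe, hD.comul_mul hS]
  rw [← sw_self (D.comul x), ← sw_self (D.comul y)]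
  simp only [bilin_sw_sw, equiv_sw, mulTwo_tmul, TensorProduct.comm_tmul]

/-- `κ(φ(· x₂)) ι(x₁) = ι(x₂) κ(φ(x₁ ·))`. -/
theorem sw_kappa_iota (x : H) (φ : Module.Dual ℂ H) :
    (sw (Δ x) fun a b => κ (A.twist 𝟙 b φ) ⊙ ι a) =
      sw (Δ x) fun a b => ι b ⊙ κ (A.twist a 𝟙 φ) := by
  have hA := hS.isQuantumGroupoid
  symm
  simp only [hD.exchange, hA.twist_twist, hA.mul_one]
  rw [← hA.sw_assoc x (fun a p t => sw (Δ t) fun q c => κ (A.twist (a ⬝ S p) c φ) ⊙ ι q)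
    (by fun_prop) (by fun_prop) (by fun_prop)]
  trans sw (Δ x) fun e t => sw (Δ t) fun q c => κ (A.twist 𝟙 c φ) ⊙ ι (A.epsT e ⬝ q)
  · refine sw_congr fun e t => ?_
    rw [← (show Lin fun w => sw (Δ t) fun q c => κ (A.twist w c φ) ⊙ ι q by fun_prop).map_sw,
      ← epsT_eq]
    refine sw_congr fun q c => ?_
    have : A.twist (A.epsT e) c φ = A.twist (A.epsT e) 𝟙 (A.twist 𝟙 c φ) := by
      rw [hA.twist_twist, hA.one_mul, hA.one_mul]
    rw [this, hD.kappa_twist_left hS (hA.epsT_mem e), hD.mul_assoc, ← hD.iota_mul]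
  · rw [← hA.sw_assoc x (fun e q c => κ (A.twist 𝟙 c φ) ⊙ ι (A.epsT e ⬝ q)) (by fun_prop)
      (by fun_prop) (by fun_prop)]
    refine sw_congr fun u c => ?_
    exact hA.sw_epsT_mul u (fun w => κ (A.twist 𝟙 c φ) ⊙ ι w) (by fun_prop)

/-- The first legs lie in `κ(Ĥ)`; evaluating them at `x` leaves the two sides of `sw_kappa_iota`. -/
theorem intertwines_kappa (φ : Module.Dual ℂ H) :
    D.mulTwo (D.comulOp (κ φ)) (TensorProduct.map κ ι θ) =
      D.mulTwo (TensorProduct.map κ ι θ) (D.comul (κ φ)) := by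
  have hA := hS.isQuantumGroupoid
  have hr (b : H) : κ (A.twist 𝟙 b φ) = sw (Δ' φ) fun α β => β b • κ α := by
    have : A.twist 𝟙 b φ = φ ∘ₗ A.mul.flip b := by
      ext x
      rw [twist_apply, hA.one_mul]
      rfl
    rw [this, ← sw_dual_comul_smul', map_sw]
    simp only [map_smul]
  have hl (a : H) : κ (A.twist a 𝟙 φ) = sw (Δ' φ) fun α β => α a • κ β := by
    have : A.twist a 𝟙 φ = φ ∘ₗ A.mul a := by
      ext x
      rw [twist_apply, hA.mul_one]
      rfl
    rw [this, ← sw_dual_comul_smul, map_sw]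
    simp only [map_smul]
  have h : (sw (Δ' φ) fun α β => sw θ fun p u => (p ⋆ β) ⊗ₜ[ℂ] (κ α ⊙ ι u)) =
      sw θ fun p u => sw (Δ' φ) fun α β => (α ⋆ p) ⊗ₜ[ℂ] (ι u ⊙ κ β) := by
    refine dual_tmul_ext fun x => ?_
    simp (disch := fun_prop) only [sw_of_sw, sw_of_tmul, dual_mul_apply, sw_smul]
    simp only [sw_sw_comm _ (Δ x)]
    trans sw (Δ x) fun a b => κ (A.twist 𝟙 b φ) ⊙ ι a
    · refine sw_congr fun a b => ?_
      conv_rhs => rw [← sw_coev_apply_smul a, map_sw, hr b]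
      rw [bilin_sw_sw]
      refine sw_congr fun α β => sw_congr fun p u => ?_
      simp only [map_smul, LinearMap.smul_apply, smul_smul]
    · rw [hD.sw_kappa_iota hS]
      refine sw_congr fun a b => ?_
      conv_lhs => rw [← sw_coev_apply_smul b, map_sw, hl a]
      rw [bilin_sw_sw]
      refine sw_congr fun α β => sw_congr fun p u => ?_
      simp only [map_smul, LinearMap.smul_apply, smul_smul]
  rw [hD.comulOp_kappa, hD.comul_kappa, map_eq_sw κ ι, bilin_sw_sw, bilin_sw_sw]
  simp only [mulTwo_tmul, ← hD.kappa_mul]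
  have := congrArg (TensorProduct.map κ LinearMap.id) h
  simpa only [map_sw, TensorProduct.map_tmul, LinearMap.id_apply] using this

theorem intertwines_iota (h : H) :
    D.mulTwo (D.comulOp (ι h)) (TensorProduct.map κ ι θ) =
      D.mulTwo (TensorProduct.map κ ι θ) (D.comul (ι h)) := by
  have hA := hS.isQuantumGroupoid
  rw [hD.comulOp_iota, hD.comul_iota, map_eq_sw κ ι, bilin_sw_sw, bilin_sw_sw]
  simp only [mulTwo_tmul, ← hD.iota_mul, hD.exchange, sw_tmul]
  trans sw (Δ h) fun a b => sw (Δ b) fun c t => sw (Δ t) fun d e => sw θ fun p u =>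
      (κ p ⊙ ι d) ⊗ₜ[ℂ] ι (a ⬝ S c ⬝ (u ⬝ e))
  · simp only [sw_sw_comm θ]
    refine sw_congr fun a b => sw_congr fun c t => sw_congr fun d e => ?_
    rw [sw_coev_twist (S c) e (fun p u => (κ p ⊙ ι d) ⊗ₜ[ℂ] ι (a ⬝ u)) (by fun_prop)
      (by fun_prop)]
    simp only [hA.mul_assoc]
  rw [← hA.sw_assoc h (fun a c t => sw (Δ t) fun d e => sw θ fun p u =>
    (κ p ⊙ ι d) ⊗ₜ[ℂ] ι (a ⬝ S c ⬝ (u ⬝ e))) (by fun_prop) (by fun_prop) (by fun_prop)]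
  trans sw (Δ h) fun v t => sw (Δ t) fun d e => sw θ fun p u =>
      (κ p ⊙ ι (A.epsT v ⬝ d)) ⊗ₜ[ℂ] ι (u ⬝ e)
  · refine sw_congr fun v t => ?_
    rw [← (show Lin fun w => sw (Δ t) fun d e => sw θ fun p u =>
      (κ p ⊙ ι d) ⊗ₜ[ℂ] ι (w ⬝ (u ⬝ e)) by fun_prop).map_sw, ← epsT_eq]
    refine sw_congr fun d e => ?_
    have := sw_coev_twist (A := A) (A.epsT v) 𝟙 (fun p u => (κ p ⊙ ι d) ⊗ₜ[ℂ] ι (u ⬝ e))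
      (by fun_prop) (by fun_prop)
    simp only [hA.mul_one, hD.kappa_twist_left hS (hA.epsT_mem v), hD.mul_assoc,
      ← hD.iota_mul] at this
    simp only [this, hA.mul_assoc]
  rw [← hA.sw_assoc h (fun v d e => sw θ fun p u =>
    (κ p ⊙ ι (A.epsT v ⬝ d)) ⊗ₜ[ℂ] ι (u ⬝ e)) (by fun_prop) (by fun_prop) (by fun_prop),
    sw_sw_comm θ]
  refine sw_congr fun w e => ?_
  exact hA.sw_epsT_mul w (fun d => sw θ fun p u => (κ p ⊙ ι d) ⊗ₜ[ℂ] ι (u ⬝ e)) (by fun_prop)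

theorem intertwines (x : V) :
    D.mulTwo (D.comulOp x) (TensorProduct.map κ ι θ) =
      D.mulTwo (TensorProduct.map κ ι θ) (D.comul x) := by
  refine hD.lin_ext (fun x => D.mulTwo (D.comulOp x) (TensorProduct.map κ ι θ))
    (fun x => D.mulTwo (TensorProduct.map κ ι θ) (D.comul x)) x (fun φ h => ?_)
  rw [hD.comulOp_mul hS, hD.comul_mul hS, hD.mulTwo_assoc, hD.intertwines_iota hS,
    ← hD.mulTwo_assoc, hD.intertwines_kappa hS, hD.mulTwo_assoc]

/-- The element `R` absorbs `Δ(1)` on the right. -/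
theorem map_coev_mul_comul_one :
    D.mulTwo (TensorProduct.map κ ι θ) (D.comul D.one) = TensorProduct.map κ ι θ := by
  have hA := hS.isQuantumGroupoid
  rw [map_eq_sw κ ι, hD.comul_one, bilin_sw_sw]
  simp only [mulTwo_tmul, ← hD.iota_mul]
  rw [sw_sw_comm]
  trans sw (Δ 𝟙) fun c d => sw θ fun p u => κ p ⊗ₜ[ℂ] ι (u ⬝ (S c ⬝ d))
  · refine hA.sw_one_congr fun c hc d _ => ?_
    simp only [← hD.kappa_twist_antipode hS hc]
    rw [sw_coev_twist 𝟙 (S c) (fun p u => κ p ⊗ₜ[ℂ] ι (u ⬝ d)) (by fun_prop) (by fun_prop)]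
    simp only [hA.one_mul, hA.mul_assoc]
  · rw [hA.sw_antipode_one (fun v => sw θ fun p u => κ p ⊗ₜ[ℂ] ι (u ⬝ v)) (by fun_prop)]
    simp only [hA.mul_one]

theorem map_coev_mul_inv :
    D.mulTwo (TensorProduct.map κ ι θ) (TensorProduct.map κ (ι ∘ₗ Si) θ) = D.comulOp D.one := by
  have hA := hS.isQuantumGroupoid
  rw [map_eq_sw, map_eq_sw, bilin_sw_sw, hD.comulOp_one]
  simp only [mulTwo_tmul, ← hD.iota_mul, ← hD.kappa_mul, LinearMap.comp_apply]
  rw [sw_sw_comm, ← sw_coev_comul (fun p a b => κ p ⊗ₜ[ℂ] ι (b ⬝ Si a)) (by fun_prop)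
    (by fun_prop) (by fun_prop)]
  trans sw θ fun p u => sw (Δ 𝟙) fun c d => κ (A.counitL d u • p) ⊗ₜ[ℂ] ι c
  · refine sw_congr fun p u => ?_
    rw [← (show Lin fun w => κ p ⊗ₜ[ℂ] ι w by fun_prop).map_sw, hS.sw_mul_antipodeInv]
    simp only [map_sw, tmul_sw, map_smul, TensorProduct.tmul_smul, TensorProduct.smul_tmul']
    rfl
  · rw [sw_sw_comm]
    refine hA.sw_one_congr fun c hc d hd => ?_
    rw [← (show Lin fun w => κ w ⊗ₜ[ℂ] ι c by fun_prop).map_sw, sw_coev_smul, hD.iota_target d hd]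

theorem map_coev_inv_mul :
    D.mulTwo (TensorProduct.map κ (ι ∘ₗ Si) θ) (TensorProduct.map κ ι θ) = D.comul D.one := by
  have hA := hS.isQuantumGroupoid
  rw [map_eq_sw, map_eq_sw, bilin_sw_sw, hD.comul_one]
  simp only [mulTwo_tmul, ← hD.iota_mul, ← hD.kappa_mul, LinearMap.comp_apply]
  rw [sw_sw_comm, ← sw_coev_comul (fun p a b => κ p ⊗ₜ[ℂ] ι (Si b ⬝ a)) (by fun_prop)
    (by fun_prop) (by fun_prop)]
  trans sw θ fun p u => sw (Δ 𝟙) fun c d => κ (A.counitR c u • p) ⊗ₜ[ℂ] ι d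
  · refine sw_congr fun p u => ?_
    rw [← (show Lin fun w => κ p ⊗ₜ[ℂ] ι w by fun_prop).map_sw, hS.sw_antipodeInv_mul]
    simp only [map_sw, tmul_sw, map_smul, TensorProduct.tmul_smul, TensorProduct.smul_tmul']
    rfl
  · rw [sw_sw_comm]
    refine hA.sw_one_congr fun c hc d hd => ?_
    rw [← (show Lin fun w => κ w ⊗ₜ[ℂ] ι d by fun_prop).map_sw, sw_coev_smul, hD.iota_source c hc]

/-- The element `R̄` absorbs `Δᵒᵖ(1)` on the right. -/
theorem map_coev_inv_mul_comulOp_one :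
    D.mulTwo (TensorProduct.map κ (ι ∘ₗ Si) θ) (D.comulOp D.one) =
      TensorProduct.map κ (ι ∘ₗ Si) θ := by
  have hA := hS.isQuantumGroupoid
  rw [map_eq_sw, hD.comulOp_one, bilin_sw_sw]
  simp only [mulTwo_tmul, ← hD.iota_mul, LinearMap.comp_apply]
  rw [sw_sw_comm]
  trans sw (Δ 𝟙) fun c d => sw θ fun p u => κ p ⊗ₜ[ℂ] ι (Si u ⬝ (Si d ⬝ c))
  · refine hA.sw_one_congr fun c _ d hd => ?_
    simp only [← hD.kappa_twist_left hS hd]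
    rw [sw_coev_twist d 𝟙 (fun p u => κ p ⊗ₜ[ℂ] ι (Si u ⬝ c)) (by fun_prop) (by fun_prop)]
    simp only [hA.mul_one, hS.antipodeInv_mul, hA.mul_assoc]
  · rw [← (show Lin fun v => sw θ fun p u => κ p ⊗ₜ[ℂ] ι (Si u ⬝ v) by fun_prop).map_sw,
      hS.antipodeInv_one_mul]
    simp only [hA.mul_one]

theorem isRMatrixInverse :
    D.IsRMatrixInverse (TensorProduct.map κ ι θ) (TensorProduct.map κ (ι ∘ₗ Si) θ) where
  mem := ⟨TensorProduct.map κ (ι ∘ₗ Si) θ, by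
    rw [← hD.map_coev_inv_mul hS, hD.mulTwo_assoc, hD.mulTwo_assoc,
      hD.map_coev_inv_mul_comulOp_one hS, hD.map_coev_mul_inv hS,
      hD.map_coev_inv_mul_comulOp_one hS]⟩
  mul_inv := hD.map_coev_mul_inv hS
  inv_mul := hD.map_coev_inv_mul hS

theorem isQuasitriangular : D.IsQuasitriangular (TensorProduct.map κ ι θ) where
  mem := ⟨TensorProduct.map κ ι θ, by
    rw [hD.intertwines hS, hD.map_coev_mul_comul_one hS, hD.map_coev_mul_comul_one hS]⟩
  intertwines := hD.intertwines hS
  id_comul := by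
    rw [map_eq_sw κ ι]
    simp only [map_sw, TensorProduct.map_tmul, hD.comul_iota, sw_tmul, equiv_sw,
      TensorProduct.assoc_tmul, LinearMap.id_apply, TensorProduct.mk_apply, tmul_sw]
    rw [sw_coev_comul (fun p a b => κ p ⊗ₜ[ℂ] (ι a ⊗ₜ[ℂ] ι b)) (by fun_prop)
      (by fun_prop) (by fun_prop)]
    simp only [sw_apply, mulThree_tmul, hD.kappa_mul, hD.one_mul hS, hD.mul_one hS]
  comul_id := by
    rw [map_eq_sw κ ι]
    simp only [map_sw, TensorProduct.map_tmul, hD.comul_kappa, sw_tmul, equiv_sw,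
      TensorProduct.assoc_tmul, LinearMap.id_apply, TensorProduct.mk_apply, tmul_sw]
    rw [sw_coev_dual_comul (fun α β u => κ α ⊗ₜ[ℂ] (κ β ⊗ₜ[ℂ] ι u)) (by fun_prop)
      (by fun_prop) (by fun_prop), sw_sw_comm]
    simp only [sw_apply, mulThree_tmul, hD.iota_mul, hD.one_mul hS, hD.mul_one hS]
  exists_inverse := ⟨_, hD.isRMatrixInverse hS⟩

end IsDouble

/-! ### The involution of the double -/

/-- The involution `⟨φ♯, x⟩ = conj ⟨φ, S(x*)⟩` on functionals. The involution of `Ĥ` has `S(x)*` in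
place of `S(x*)`; the two differ by a power of `S²`. -/
def sharp (A : QGData H) (st : H →ₛₗ[starRingEnd ℂ] H) :
    Module.Dual ℂ H →ₛₗ[starRingEnd ℂ] Module.Dual ℂ H where
  toFun φ :=
    { toFun := fun x => starRingEnd ℂ (φ (A.antipode (st x)))
      map_add' := fun x y => by simp
      map_smul' := fun c x => by simp }
  map_add' φ ψ := by ext x; simp
  map_smul' c φ := by ext x; simp

theorem sharp_apply (φ : Module.Dual ℂ H) (x : H) :
    A.sharp st φ x = starRingEnd ℂ (φ (S (st x))) := rfl

namespace IsStarQuantumGroupoid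

variable (hS : A.IsStarQuantumGroupoid st)
include hS

theorem sharp_sharp (φ : Module.Dual ℂ H) : A.sharp st (A.sharp st φ) = φ := by
  ext x
  rw [sharp_apply, sharp_apply, Complex.conj_conj, hS.antipode_star_antipode_star]

theorem sharp_counit : A.sharp st ε = ε := by
  ext x
  rw [sharp_apply, hS.isQuantumGroupoid.counit_antipode, hS.counit_star, Complex.conj_conj]

theorem sharp_mul (φ ψ : Module.Dual ℂ H) :
    A.sharp st (φ ⋆ ψ) = A.sharp st ψ ⋆ A.sharp st φ := by
  have hA := hS.isQuantumGroupoid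
  ext x
  rw [sharp_apply, dual_mul_apply, dual_mul_apply,
    hA.sw_comul_antipode _ _ (by fun_prop) (by fun_prop),
    hS.sw_comul_star _ _ (by fun_prop) (by fun_prop), conj_sw]
  exact sw_congr fun a b => by rw [map_mul, mul_comm, sharp_apply, sharp_apply]

theorem sharp_twist (a c : H) (φ : Module.Dual ℂ H) :
    A.sharp st (A.twist a c φ) = A.twist (S (st a)) (S (st c)) (A.sharp st φ) := by
  have hA := hS.isQuantumGroupoid
  ext x
  simp only [sharp_apply, twist_apply, hS.star_mul, hA.antipode_mul,
    hS.antipode_star_antipode_star, hA.mul_assoc]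

theorem sw_dual_comul_sharp (φ : Module.Dual ℂ H) (f : Module.Dual ℂ H → Module.Dual ℂ H → U)
    (hl : ∀ b, Lin fun a => f a b) (hr : ∀ a, Lin fun b => f a b) :
    sw (Δ' (A.sharp st φ)) f = sw (Δ' φ) fun α β => f (A.sharp st α) (A.sharp st β) := by
  have hA := hS.isQuantumGroupoid
  have : Δ' (A.sharp st φ) = TensorProduct.map (A.sharp st) (A.sharp st) (Δ' φ) := by
    refine dual_tmul_dual_ext fun x y => ?_
    rw [sw_dual_comul, sw_of_map_star _ _ _ _ (by fun_prop) (by fun_prop), sharp_apply,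
      hS.star_mul, hA.antipode_mul, ← sw_dual_comul, conj_sw]
    exact sw_congr fun α β => map_mul _ _ _
  rw [this, sw_of_map_star _ _ _ _ hl hr]

/-- `∑ (ξⁱ)♯ ⊗ fᵢ* = ∑ ξⁱ ⊗ S⁻¹(fᵢ)`, because `S(x*)* = S⁻¹(x)`. -/
theorem map_sharp_star_coev :
    TensorProduct.map (A.sharp st) st θ = sw θ fun p u => p ⊗ₜ[ℂ] Si u := by
  rw [map_star_eq_sw]
  refine (sw_coev_eq (F := fun u => Si u) (by fun_prop) fun x => ?_).symm
  simp (disch := fun_prop) only [sw_of_sw, sw_of_tmul, sharp_apply]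
  rw [hS.antipodeInv_apply]
  conv_rhs => rw [← sw_coev_apply_smul (S (st x)), star_sw]
  exact sw_congr fun p u => by rw [LinearMap.map_smulₛₗ]

end IsStarQuantumGroupoid

/-- The formula `[φ ⊗ h] ↦ [ε ⊗ h*][φ♯ ⊗ 1]` is well defined on the double. -/
theorem exists_double_star (hS : A.IsStarQuantumGroupoid st) {D : QGData A.DrinfeldDouble}
    (hD : A.preDouble.Descends A.toDouble D) :
    ∃ stD : A.DrinfeldDouble →ₛₗ[starRingEnd ℂ] A.DrinfeldDouble, ∀ φ h,
      stD (D.mul (A.kappa φ) (A.iota h)) = D.mul (A.iota (st h)) (A.kappa (A.sharp st φ)) := by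
  have hA := hS.isQuantumGroupoid
  have hd := isDouble_drinfeldDouble hS hD
  let f : Module.Dual ℂ H ⊗[ℂ] H →ₛₗ[starRingEnd ℂ] A.DrinfeldDouble :=
    (TensorProduct.lift (D.mul.compl₁₂ A.iota A.kappa).flip).comp
      (TensorProduct.map (A.sharp st) st)
  have hf (φ : Module.Dual ℂ H) (h : H) :
      f (φ ⊗ₜ[ℂ] h) = D.mul (A.iota (st h)) (A.kappa (A.sharp st φ)) := rfl
  refine ⟨A.doubleIdeal.liftQ f (doubleIdeal_le_ker hA f (fun z hz φ h => ?_)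
    (fun y hy φ h => ?_)), fun φ h => ?_⟩
  · rw [hf, hf, hS.star_mul, hd.iota_mul, hd.mul_assoc,
      hd.iota_mul_kappa_target hS (hS.star_target_mem hz), hS.sharp_twist, hS.star_one,
      hA.antipode_one]
  · rw [hf, hf, hS.star_mul, hd.iota_mul, hd.mul_assoc,
      hd.iota_mul_kappa_source hS (hS.star_source_mem hy), hS.sharp_twist, hS.star_one,
      hA.antipode_one, hS.antipode_star_antipode]
  · rw [← toDouble_eq hA hD]
    exact hf φ h

namespace IsDouble

variable (hD : A.IsDouble D ι κ) (hS : A.IsStarQuantumGroupoid st)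
  (hst : ∀ (φ : Module.Dual ℂ H) (h : H),
    stD (D.mul (κ φ) (ι h)) = D.mul (ι (st h)) (κ (A.sharp st φ)))
include hD hS hst

theorem star_kappa (φ : Module.Dual ℂ H) : stD (κ φ) = κ (A.sharp st φ) := by
  have := hst φ 𝟙
  rwa [hS.star_one, hD.iota_one, hD.mul_one hS, hD.one_mul hS] at this

theorem star_iota (h : H) : stD (ι h) = ι (st h) := by
  have := hst ε h
  rwa [hS.sharp_counit, hD.kappa_one, hD.mul_one hS, hD.one_mul hS] at this

theorem star_kappa_mul (φ : Module.Dual ℂ H) (w : V) :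
    stD (κ φ ⊙ w) = stD w ⊙ κ (A.sharp st φ) := by
  obtain ⟨t, rfl⟩ := hD.exists_tensor w
  simp only [map_sw, star_sw, sw_apply]
  refine sw_congr fun ψ h => ?_
  rw [← hD.mul_assoc, ← hD.kappa_mul, hst, hst, hS.sharp_mul, hD.kappa_mul, hD.mul_assoc]

theorem star_iota_mul (k : H) (w : V) : stD (ι k ⊙ w) = stD w ⊙ ι (st k) := by
  have hA := hS.isQuantumGroupoid
  obtain ⟨t, rfl⟩ := hD.exists_tensor w
  simp only [map_sw, star_sw, sw_apply]
  refine sw_congr fun ψ h => ?_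
  rw [← hD.mul_assoc, hD.exchange, hst, hD.mul_assoc, ← hD.exchange_inv hS,
    hS.sw_comul_star _ _ (by fun_prop) (by fun_prop)]
  simp only [sw_apply, map_sw, star_sw]
  refine sw_congr fun a s => ?_
  rw [hS.sw_comul_star _ _ (by fun_prop) (by fun_prop)]
  refine sw_congr fun b c => ?_
  rw [hD.mul_assoc, ← hD.iota_mul, hst, hS.sharp_twist, hS.antipode_star_antipode, hS.star_mul,
    hD.iota_mul, hD.mul_assoc]

theorem star_mul (x w : V) : stD (x ⊙ w) = stD w ⊙ stD x := by
  obtain ⟨t, rfl⟩ := hD.exists_tensor x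
  simp only [map_sw, star_sw, sw_apply]
  refine sw_congr fun φ h => ?_
  rw [hD.mul_assoc, hD.star_kappa_mul hS hst, hD.star_iota_mul hS hst, hst, hD.mul_assoc]

theorem star_star (x : V) : stD (stD x) = x := by
  obtain ⟨t, rfl⟩ := hD.exists_tensor x
  simp only [star_sw]
  refine sw_congr fun φ h => ?_
  rw [hst, hD.star_mul hS hst, hD.star_iota hS hst, hD.star_kappa hS hst, hS.sharp_sharp,
    hS.star_star]

theorem comul_star (x : V) : D.comul (stD x) = TensorProduct.map stD stD (D.comul x) := by
  obtain ⟨t, rfl⟩ := hD.exists_tensor x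
  simp only [star_sw, map_sw]
  refine sw_congr fun φ h => ?_
  rw [hst, hD.comul_mul hS, hD.comul_iota, hD.comul_kappa, bilin_sw_sw,
    hS.sw_comul_star _ _ (by fun_prop) (by fun_prop), hD.comul_kappa_iota, star_sw, sw_sw_comm]
  simp only [star_sw, TensorProduct.map_tmul, hst]
  rw [hS.sw_dual_comul_sharp _ _ (by fun_prop) (by fun_prop)]
  simp only [mulTwo_tmul]

theorem isStarQuantumGroupoid : D.IsStarQuantumGroupoid stD where
  isQuantumGroupoid := hD.isQuantumGroupoid hS
  star_star := hD.star_star hS hst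
  star_mul := hD.star_mul hS hst
  comul_star := hD.comul_star hS hst

theorem map_star_coev :
    TensorProduct.map stD stD (TensorProduct.map κ ι θ) =
      TensorProduct.map κ (ι ∘ₗ Si) θ := by
  have := congrArg (TensorProduct.map κ ι) hS.map_sharp_star_coev
  rw [map_star_eq_sw] at this
  simp only [map_sw, TensorProduct.map_tmul] at this
  rw [map_eq_sw κ ι, star_sw, map_eq_sw κ (ι ∘ₗ Si)]
  simp only [TensorProduct.map_tmul, hD.star_kappa hS hst, hD.star_iota hS hst, this,
    LinearMap.comp_apply]

/-- The map `* ∘ S` of the double is `[φ ⊗ h] ↦ [(S φ)* ⊗ S(h)*]`; it defines the involution of the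
dual. -/
theorem star_antipode (φ : Module.Dual ℂ H) (h : H) :
    stD (D.antipode (κ φ ⊙ ι h)) =
      κ (A.dualStar st (A.dual.antipode φ)) ⊙ ι (st (S h)) := by
  rw [hD.antipode_kappa_iota, hD.star_mul hS hst, hD.star_iota hS hst, hD.star_kappa hS hst]
  congr 3
  ext x
  rw [sharp_apply, dualStar_apply, dual_antipode_apply, LinearMap.comp_apply,
    hS.antipodeInv_antipode, hS.antipode_star_antipode]

end IsDouble

end RMatrix

noncomputable section DualOfDouble

variable {H : Type*} [AddCommGroup H] [Module ℂ H] [FiniteDimensional ℂ H] {A : QGData H}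
  {st : H →ₛₗ[starRingEnd ℂ] H}

local notation:70 a:70 " ⬝ " b:71 => QGData.mul A a b
local notation:70 a:70 " ⋆ " b:71 => QGData.mul (QGData.dual A) a b
local notation "S" => QGData.antipode A
local notation "Si" => QGData.antipodeInv A
local notation "Δ" => QGData.comul A
local notation "Δ'" => QGData.comul (QGData.dual A)
local notation "θ" => QGData.coev H

/-! ### The dual of the double inside `H ⊗ Ĥ` -/

/-- If the dual of a quantum groupoid with involution is a `C*`-algebra, then so is the quantum
groupoid itself, because it is its own bidual. -/
theorem IsStarQuantumGroupoid.isCStar_of_dual (hS : A.IsStarQuantumGroupoid st)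
    (hC : A.dual.IsCStarQuantumGroupoid (A.dualStar st)) : A.IsCStarQuantumGroupoid st := by
  have hA := hS.isQuantumGroupoid
  have hdd := (dual_isCStar hC).isCStarAlgebra.star_mul_self_eq_zero_iff
  have hmul (x y : H) : A.dual.dual.mul (Module.Dual.eval ℂ H x) (Module.Dual.eval ℂ H y) =
      Module.Dual.eval ℂ H (x ⬝ y) := by
    ext φ
    rw [dual_mul_apply]
    exact sw_dual_comul φ x y
  have hstar (x : H) : A.dual.dualStar (A.dualStar st) (Module.Dual.eval ℂ H x) =
      Module.Dual.eval ℂ H (st x) := by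
    ext φ
    rw [dualStar_apply, Module.Dual.eval_apply, Module.Dual.eval_apply, dualStar_apply,
      dual_antipode_apply, Complex.conj_conj, hS.antipode_star_antipode]
  refine ⟨hA, ⟨hA.finite, hA.mul_assoc, hA.one_mul, hA.mul_one, hS.star_star, hS.star_mul,
    fun x => ⟨fun hx => ?_, fun hx => ?_⟩⟩, hS.comul_star⟩
  · have := (hdd (Module.Dual.eval ℂ H x)).mp (by rw [hstar, hmul, hx, map_zero])
    exact (Module.evalEquiv ℂ H).injective (this.trans (map_zero (Module.evalEquiv ℂ H)).symm)
  · rw [hx, map_zero]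

theorem pairing_apply (Y : H ⊗[ℂ] Module.Dual ℂ H) (ψ : Module.Dual ℂ H) (g : H) :
    pairing H Y (ψ ⊗ₜ[ℂ] g) = sw Y fun a α => ψ a * α g := by
  conv_lhs => rw [← sw_self Y, map_sw, sw_apply]
  rfl

/-- The nondegenerate pairing as an isomorphism. -/
def pairingEquiv (H : Type*) [AddCommGroup H] [Module ℂ H] [FiniteDimensional ℂ H] :
    (H ⊗[ℂ] Module.Dual ℂ H) ≃ₗ[ℂ] Module.Dual ℂ (Module.Dual ℂ H ⊗[ℂ] H) :=
  TensorProduct.congr (Module.evalEquiv ℂ H) (LinearEquiv.refl ℂ _) ≪≫ₗ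
    TensorProduct.dualDistribEquiv ℂ (Module.Dual ℂ H) H

theorem pairingEquiv_apply (Y : H ⊗[ℂ] Module.Dual ℂ H) : pairingEquiv H Y = pairing H Y := rfl

/-- The functionals on the double, as elements of `H ⊗ Ĥ`. -/
def dualDouble (A : QGData H) : Module.Dual ℂ A.DrinfeldDouble →ₗ[ℂ] H ⊗[ℂ] Module.Dual ℂ H :=
  (pairingEquiv H).symm.toLinearMap ∘ₗ A.toDouble.dualMap

theorem pairing_dualDouble (X : Module.Dual ℂ A.DrinfeldDouble) :
    pairing H (A.dualDouble X) = X ∘ₗ A.toDouble := by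
  rw [← pairingEquiv_apply]
  exact (pairingEquiv H).apply_symm_apply _

theorem pairing_injective : Function.Injective (pairing H) := (pairingEquiv H).injective

theorem dualDouble_injective : Function.Injective A.dualDouble := fun X X' h => by
  have := congrArg (pairing H) h
  rw [pairing_dualDouble, pairing_dualDouble] at this
  exact (LinearMap.cancel_right (Submodule.mkQ_surjective _)).mp this

theorem mem_range_dualDouble (Y : H ⊗[ℂ] Module.Dual ℂ H) :
    Y ∈ LinearMap.range A.dualDouble ↔ ∀ x ∈ A.doubleIdeal, pairing H Y x = 0 := by
  constructor
  · rintro ⟨X, rfl⟩ x hx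
    rw [pairing_dualDouble, LinearMap.comp_apply]
    have : A.toDouble x = 0 := (Submodule.Quotient.mk_eq_zero _).mpr hx
    rw [this, map_zero]
  · intro h
    refine ⟨A.doubleIdeal.liftQ (pairing H Y) h, pairing_injective ?_⟩
    rw [pairing_dualDouble]
    exact A.doubleIdeal.liftQ_mkQ _ _

theorem pairing_ext {Y Y' : H ⊗[ℂ] Module.Dual ℂ H}
    (h : ∀ ψ g, pairing H Y (ψ ⊗ₜ[ℂ] g) = pairing H Y' (ψ ⊗ₜ[ℂ] g)) : Y = Y' :=
  pairing_injective (TensorProduct.ext' h)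

/-- The product of `H ⊗ Ĥ` is dual to the coproduct of representatives. -/
theorem pairing_map₂ (Y Y' : H ⊗[ℂ] Module.Dual ℂ H) (ψ : Module.Dual ℂ H) (g : H) :
    pairing H (TensorProduct.map₂ A.mul A.dual.mul Y Y') (ψ ⊗ₜ[ℂ] g) =
      sw (Δ' ψ) fun p q => sw (Δ g) fun a b =>
        pairing H Y (p ⊗ₜ[ℂ] a) * pairing H Y' (q ⊗ₜ[ℂ] b) := by
  rw [pairing_apply, sw_of_map₂ _ _ _ _ _ (by fun_prop) (by fun_prop)]
  simp only [pairing_apply, mul_sw, sw_mul]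
  simp only [sw_sw_comm (Δ g) Y', sw_sw_comm (Δ g) Y, sw_sw_comm (Δ' ψ) Y', sw_sw_comm (Δ' ψ) Y]
  rw [sw_sw_comm Y' Y]
  refine sw_congr fun a α => sw_congr fun b β => ?_
  rw [← sw_dual_comul, dual_mul_apply, sw_mul]
  refine sw_congr fun p q => ?_
  rw [mul_sw]
  exact sw_congr fun c d => mul_mul_mul_comm _ _ _ _

theorem dualDouble_mul {D : QGData A.DrinfeldDouble} (hD : A.preDouble.Descends A.toDouble D)
    (X X' : Module.Dual ℂ A.DrinfeldDouble) :
    A.dualDouble (D.dual.mul X X') =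
      TensorProduct.map₂ A.mul A.dual.mul (A.dualDouble X) (A.dualDouble X') := by
  refine pairing_ext fun ψ g => ?_
  rw [pairing_map₂]
  simp only [pairing_dualDouble, LinearMap.comp_apply]
  rw [dual_mul_apply, hD.comul, preDouble_comul_tmul]
  simp (disch := fun_prop) only [map_sw, TensorProduct.map_tmul, sw_of_sw, sw_of_tmul]

theorem dualDouble_star (hS : A.IsStarQuantumGroupoid st) {D : QGData A.DrinfeldDouble}
    {stD : A.DrinfeldDouble →ₛₗ[starRingEnd ℂ] A.DrinfeldDouble}
    (h : ∀ (X : Module.Dual ℂ A.DrinfeldDouble) (φ : Module.Dual ℂ H) (h : H),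
        D.dualStar stD X (A.toDouble (φ ⊗ₜ[ℂ] h)) =
          starRingEnd ℂ (X (A.toDouble
            (A.dualStar st (A.dual.antipode φ) ⊗ₜ[ℂ] st (A.antipode h)))))
    (X : Module.Dual ℂ A.DrinfeldDouble) :
    A.dualDouble (D.dualStar stD X) = TensorProduct.map st (A.dualStar st) (A.dualDouble X) := by
  refine pairing_ext fun ψ g => ?_
  rw [pairing_dualDouble, LinearMap.comp_apply, h, ← LinearMap.comp_apply X A.toDouble,
    ← pairing_dualDouble, pairing_apply, pairing_apply,
    sw_of_map_star _ _ _ _ (by fun_prop) (by fun_prop), conj_sw]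
  refine sw_congr fun a α => ?_
  rw [map_mul, dualStar_apply, dualStar_apply, dual_antipode_apply, Complex.conj_conj,
    hS.antipode_star_antipode]

/-- The dual of the double is proper because it embeds into `H ⊗ Ĥ`, which is. -/
theorem dual_isCStar_of_dualDouble_star (hC : A.IsCStarQuantumGroupoid st)
    {D : QGData A.DrinfeldDouble} (hD : A.preDouble.Descends A.toDouble D)
    {stD : A.DrinfeldDouble →ₛₗ[starRingEnd ℂ] A.DrinfeldDouble}
    (hDS : D.IsStarQuantumGroupoid stD)
    (hstar : ∀ X, A.dualDouble (D.dualStar stD X) =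
      TensorProduct.map st (A.dualStar st) (A.dualDouble X)) :
    D.dual.IsCStarQuantumGroupoid (D.dualStar stD) := by
  have h := dual_isStar hDS
  have hQ := h.isQuantumGroupoid
  have hT := hC.isCStarAlgebra.tmul (dual_isCStar hC).isCStarAlgebra
  refine ⟨hQ, ⟨hQ.finite, hQ.mul_assoc, hQ.one_mul, hQ.mul_one, h.star_star, h.star_mul,
    fun X => ⟨fun hX => ?_, fun hX => ?_⟩⟩, h.comul_star⟩
  · refine dualDouble_injective ((hT.star_mul_self_eq_zero_iff _).mp ?_ |>.trans
      (map_zero A.dualDouble).symm)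
    rw [← hstar, ← dualDouble_mul hD, hX, map_zero]
  · rw [hX, map_zero]

theorem doubleR_eq : A.doubleR = TensorProduct.map A.kappa A.iota θ := by
  rw [coev, map_sum]
  rfl

theorem doubleRbar_eq (hS : A.IsStarQuantumGroupoid st) :
    A.doubleRbar = TensorProduct.map A.kappa (A.iota ∘ₗ Si) θ := by
  rw [map_eq_sw]
  simp only [LinearMap.comp_apply]
  rw [← sw_coev_comp A.antipodeInv (fun p u => A.kappa p ⊗ₜ[ℂ] A.iota u) (by fun_prop)
    (by fun_prop)]
  trans TensorProduct.map (A.kappa ∘ₗ A.dual.antipodeInv) A.iota θ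
  · rw [coev, map_sum]
    rfl
  · rw [map_eq_sw]
    simp only [LinearMap.comp_apply, dual_antipodeInv_apply hS]

end DualOfDouble

end QGData

theorem mainTheorem6 {H : Type*} [AddCommGroup H] [Module ℂ H] [FiniteDimensional ℂ H]
    (A : QGData H) (st : H →ₛₗ[starRingEnd ℂ] H) (hA : A.IsCStarQuantumGroupoid st) :
    Function.Bijective A.antipode ∧
    ∃ (D : QGData A.DrinfeldDouble)
      (stD : A.DrinfeldDouble →ₛₗ[starRingEnd ℂ] A.DrinfeldDouble),
      -- the structure maps of `D(H)` are well defined by the formulas on `Ĥᵒᵖ ⊗ H`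
      A.preDouble.Descends A.toDouble D ∧
      -- `D(H)` is a C*-quantum groupoid, quasitriangular with the canonical `R`-matrix
      D.IsCStarQuantumGroupoid stD ∧
      D.IsQuasitriangular A.doubleR ∧
      D.IsRMatrixInverse A.doubleR A.doubleRbar ∧
      TensorProduct.map stD stD A.doubleR = A.doubleRbar ∧
      -- the dual of `D(H)` is a C*-quantum groupoid for the natural involution
      D.dual.IsCStarQuantumGroupoid (D.dualStar stD) ∧
      (∀ (X : Module.Dual ℂ A.DrinfeldDouble) (φ : Module.Dual ℂ H) (h : H),
        D.dualStar stD X (A.toDouble (φ ⊗ₜ[ℂ] h)) =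
          starRingEnd ℂ (X (A.toDouble
            (A.dualStar st (A.dual.antipode φ) ⊗ₜ[ℂ] st (A.antipode h))))) ∧
      -- and it is a C*-subalgebra of the C*-algebra `H ⊗ Ĥ`
      QGData.IsFinDimCStarAlgebra (TensorProduct.map₂ A.mul A.dual.mul) (A.one ⊗ₜ[ℂ] A.counit)
        (TensorProduct.map st (A.dualStar st)) ∧
      ∃ j : Module.Dual ℂ A.DrinfeldDouble →ₗ[ℂ] H ⊗[ℂ] Module.Dual ℂ H,
        (∀ X, QGData.pairing H (j X) = X ∘ₗ A.toDouble) ∧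
        Function.Injective j ∧
        (∀ Y, Y ∈ LinearMap.range j ↔ ∀ x ∈ A.doubleIdeal, QGData.pairing H Y x = 0) ∧
        (∀ X X', j (D.dual.mul X X') = TensorProduct.map₂ A.mul A.dual.mul (j X) (j X')) ∧
        (∀ X, j (D.dualStar stD X) = TensorProduct.map st (A.dualStar st) (j X)) := by
  have hS := hA.isStar
  have hQ := hS.isQuantumGroupoid
  obtain ⟨D, hD⟩ := QGData.exists_descends hS
  obtain ⟨stD, hst⟩ := QGData.exists_double_star hS hD
  have hd := QGData.isDouble_drinfeldDouble hS hD
  have hDS := hd.isStarQuantumGroupoid hS hst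
  have hnat (X : Module.Dual ℂ A.DrinfeldDouble) (φ : Module.Dual ℂ H) (h : H) :
      D.dualStar stD X (A.toDouble (φ ⊗ₜ[ℂ] h)) = starRingEnd ℂ (X (A.toDouble
        (A.dualStar st (A.dual.antipode φ) ⊗ₜ[ℂ] st (A.antipode h)))) := by
    rw [QGData.dualStar_apply, QGData.toDouble_eq hQ hD, QGData.toDouble_eq hQ hD,
      hd.star_antipode hS hst]
  have hj := QGData.dualDouble_star hS hnat
  have hdC := QGData.dual_isCStar_of_dualDouble_star hA hD hDS hj
  refine ⟨hS.antipode_bijective, D, stD, hD, hDS.isCStar_of_dual hdC, ?_, ?_, ?_, hdC, hnat,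
    hA.isCStarAlgebra.tmul (QGData.dual_isCStar hA).isCStarAlgebra, A.dualDouble,
    QGData.pairing_dualDouble, QGData.dualDouble_injective, QGData.mem_range_dualDouble,
    QGData.dualDouble_mul hD, hj⟩
  · rw [QGData.doubleR_eq]
    exact hd.isQuasitriangular hS
  · rw [QGData.doubleR_eq, QGData.doubleRbar_eq hS]
    exact hd.isRMatrixInverse hS
  · rw [QGData.doubleR_eq, QGData.doubleRbar_eq hS]
    exact hd.map_star_coev hS hst
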